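/- **Theorem 2 (Biot–Savart integrals in $S^3$ and $H^3$).** Let $S^3=\{x\in\mathbb R^4:\langle x,x\rangle=1\}$ be the unit 3-sphere, with $\langle x,y\rangle=x_0y_0+x_1y_1+x_2y_2+x_3y_3$, regarded as the group of unit quaternions and oriented so that $i,j,k$ is a positive basis of the tangent space at $1$. Let $H^3=\{x\in\mathbb R^{1,3}:\langle x,x\rangle=1,\ x_0>0\}$ be hyperbolic 3-space of curvature $-1$, with $\langle x,y\rangle=x_0y_0-x_1y_1-x_2y_2-x_3y_3$ and with the Riemannian metric $v\cdot w=-\langle v,w\rangle$. On both spaces let $\alpha(x,y)$ be the Riemannian distance and $dx$ the Riemannian volume, and write $\varphi(x,y)$ for $\varphi(\alpha(x,y))$. Let $\varphi_0(\alpha)=-\frac{1}{4\pi^2}(\pi-\alpha)\cot\alpha$ on $S^3$ and $\varphi_0(\alpha)=-\frac1{4\pi}(\coth\alpha-1)$ on $H^3$ (the fundamental solution of the scalar Laplacian). For $v\in T_x$, let $P_{yx}v=v-\frac{\langle y,v\rangle}{1+\langle x,y\rangle}(x+y)\in T_y$ be its parallel transport along the geodesic segment from $x$ to $y$ (on $S^3$: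 for $y\ne -x$), and on $S^3$ let $L_{yx^{-1}}v=yx^{-1}v\in T_y$ be its left translation. A *Biot–Savart operator* on $S^3$ or $H^3$ is a linear operator $BS$ from smooth compactly supported vector fields to smooth vector fields such that, for every such $V$, (a) $\nabla\cdot BS(V)=0$; (b) the integral $\int V(x)\cdot\nabla_x\varphi_0(x,y)\,dx$ converges absolutely for every $y$ and is a smooth function of $y$, and $$\nabla\times BS(V)(y)=V(y)+\nabla_y\int V(x)\cdot\nabla_x\varphi_0(x,y)\,dx$$ (Maxwell's equation); (c) $BS(V)(y)\to0$ as $y\to\infty$ (an empty condition on $S^3$). Biot–Savart operators exist on $S^3$ and on $H^3$, and are given by the following formulas, in which $V$ is a smooth compactly supported vector field, all integrals converge absolutely for every $y$, and the last integral in (1) is a smooth function of $y$. On $S^3$ the formulas (1) and (2) give the same operator. (1) On $S^3$, in left-translation format, $$BS(V)(y)=\int_{S^3}L_{yx^{-1}}V(x)\times\nabla_y\varphi_0(x,y)\,dx-\frac1{4\pi^2}\int_{S^3}L_{yx^{-1}}V(x)\,dx+2\,\nabla_y\int_{S^3}L_{yx^{-1}}V(x)\cdot\nabla_y\varphi_1(x,y)\,dx,$$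 where $\varphi_0(\alpha)=-\frac1{4\pi^2}(\pi-\alpha)\cot\alpha$ and $\varphi_1(\alpha)=-\frac1{16\pi^2}\alpha(2\pi-\alpha)$. (2) On $S^3$, in parallel transport format, $$BS(V)(y)=\int_{S^3}P_{yx}V(x)\times\nabla_y\varphi(x,y)\,dx,\qquad \varphi(\alpha)=-\frac1{4\pi^2}(\pi-\alpha)\csc\alpha.$$ (3) On $H^3$, in parallel transport format, $$BS(V)(y)=\int_{H^3}P_{yx}V(x)\times\nabla_y\varphi(x,y)\,dx,\qquad \varphi(\alpha)=-\frac1{4\pi}\operatorname{csch}\alpha.$$ Moreover, in (3) the field goes to zero at infinity like $e^{-\alpha}$: for every $V$ and every $p\in H^3$ there is a constant $C$ with $|BS(V)(y)|\le C\,e^{-\alpha(p,y)}$ for all $y\in H^3$. -/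

import Mathlib

open MeasureTheory Filter Topology
open scoped ContDiff Quaternion

noncomputable section

namespace BiotSavart

/-- The ambient space `ℝ⁴`, with coordinates `x 0, x 1, x 2, x 3`. -/
abbrev E4 : Type := EuclideanSpace ℝ (Fin 4)

/-- The standard basis vectors of `ℝ⁴`. -/
def e (i : Fin 4) : E4 := EuclideanSpace.single i 1

/-- The two geometries: the unit 3-sphere `S³ ⊆ ℝ⁴`, and hyperbolic 3-space `H³`, the upper sheet
of the hyperboloid in Minkowski space `ℝ^{1,3}`. -/
inductive Geometry : Type
  | spherical
  | hyperbolic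

namespace Geometry

/-- The constant curvature, `+1` for `S³` and `-1` for `H³`. -/
def sign : Geometry → ℝ
  | spherical => 1
  | hyperbolic => -1

/-- The ambient bilinear form `⟨u, v⟩ = u₀v₀ ± (u₁v₁ + u₂v₂ + u₃v₃)`: the Euclidean inner product
(sign `+`), or the Minkowski product (sign `-`). -/
def form (G : Geometry) (u v : E4) : ℝ :=
  u 0 * v 0 + G.sign * (u 1 * v 1 + u 2 * v 2 + u 3 * v 3)

/-- `u • v = ±⟨u, v⟩`; restricted to the tangent spaces this is the Riemannian metric. -/
def dot (G : Geometry) (u v : E4) : ℝ := G.sign * G.form u v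

/-- The points of the space: `S³ = {x | ⟨x, x⟩ = 1}`, and `H³ = {x | ⟨x, x⟩ = 1, x₀ > 0}`. -/
def points : Geometry → Set E4
  | spherical => Metric.sphere (0 : E4) 1
  | hyperbolic => {x | hyperbolic.form x x = 1 ∧ 0 < x 0}

/-- The Riemannian distance `α(x, y)`: `cos α = ⟨x, y⟩` on `S³` and `cosh α = ⟨x, y⟩` on `H³`. -/
def dist : (G : Geometry) → E4 → E4 → ℝ
  | spherical, x, y => Real.arccos (spherical.form x y)
  | hyperbolic, x, y => Real.arcosh (hyperbolic.form x y)

/-- The point of `H³` lying over `p ∈ ℝ³`: the hyperboloid is the graph of `√(1 + |p|²)`. -/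
def hyperboloidPoint (p : EuclideanSpace ℝ (Fin 3)) : hyperbolic.points :=
  ⟨!₂[√(1 + ‖p‖ ^ 2), p 0, p 1, p 2], by
    have h : (0 : ℝ) < 1 + ‖p‖ ^ 2 := by positivity
    refine ⟨?_, by simpa using Real.sqrt_pos.2 h⟩
    have h1 := Real.mul_self_sqrt h.le
    have h2 := EuclideanSpace.real_norm_sq_eq p
    simp [Fin.sum_univ_three] at h2
    simp [form, sign]
    nlinarith⟩

/-- The Riemannian volume. On `S³` it is the surface measure of the unit sphere. On `H³`, the
metric induced on the graph of `√(1 + |p|²)` is `δᵢⱼ - pᵢpⱼ / (1 + |p|²)`, which has determinant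
`1 / (1 + |p|²)`, so the volume element is `dp / √(1 + |p|²)`. -/
def vol : (G : Geometry) → Measure G.points
  | spherical => (volume : Measure E4).toSphere
  | hyperbolic => Measure.map hyperboloidPoint
      ((volume : Measure (EuclideanSpace ℝ (Fin 3))).withDensity
        fun p => ENNReal.ofReal (1 / √(1 + ‖p‖ ^ 2)))

/-! ### Smooth functions and vector fields -/

/-- The open cone over the space: `ℝ⁴ ∖ {0}`, or the open future light cone. -/
def cone : Geometry → Set E4
  | spherical => {z | z ≠ 0}
  | hyperbolic => {z | 0 < hyperbolic.form z z ∧ 0 < z 0}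

/-- The radial projection `z ↦ z / √⟨z, z⟩` of the cone onto the space. -/
def proj (G : Geometry) (z : E4) : E4 := (√(G.form z z))⁻¹ • z

/-- The extension of a function from the space to the cone that is constant on rays. -/
def ext (G : Geometry) {F : Type*} [Zero F] (f : G.points → F) (z : E4) : F :=
  Function.extend Subtype.val f 0 (G.proj z)

/-- A function on the space is smooth if its extension to the (open) cone is smooth. -/
def Smooth (G : Geometry) {F : Type*} [NormedAddCommGroup F] [NormedSpace ℝ F]
    (f : G.points → F) : Prop :=
  ContDiffOn ℝ ∞ (G.ext f) G.cone

/-- The orthogonal projection onto the tangent space `T_y = {v | ⟨y, v⟩ = 0}`. -/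
def tan (G : Geometry) (y v : E4) : E4 := v - G.form y v • y

/-- The derivative of `f` at `y` in the direction of the tangential part of `v`. -/
def D (G : Geometry) {F : Type*} [NormedAddCommGroup F] [NormedSpace ℝ F]
    (f : G.points → F) (y : G.points) (v : E4) : F :=
  fderiv ℝ (G.ext f) y (G.tan y v)

/-- The covariant derivative `∇_v W` at `y`, in the direction of the tangential part of `v`: the
tangential part of the derivative of `W`. -/
def cov (G : Geometry) (W : G.points → E4) (y : G.points) (v : E4) : E4 :=
  G.tan y (G.D W y v)

/-- The coefficients `±1, 1, 1, 1` of the form `dot`, that is, the numbers `eᵢ • eᵢ`. -/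
def coeff (G : Geometry) (i : Fin 4) : ℝ := if i = 0 then G.sign else 1

/-- The vector `a` with `a • eᵢ = l i` for all `i` (raising an index). -/
def raise (G : Geometry) (l : Fin 4 → ℝ) : E4 := WithLp.toLp 2 fun i => G.coeff i * l i

/-- The volume form of the tangent space at `y`, with the orientation for which the basis
`e₁, e₂, e₃` of the tangent space at `e₀` is positive. -/
def volForm (y a b c : E4) : ℝ := Matrix.det (Matrix.of ![y.ofLp, a.ofLp, b.ofLp, c.ofLp])

/-- The cross product `v × w` in the tangent space at `y`: it is the vector with
`(v × w) • u = volForm y v w u` for all `u`. -/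
def cross (G : Geometry) (y v w : E4) : E4 := G.raise fun i => volForm y v w (e i)

/-- The gradient of `f`: the vector with `∇f • v = D_v f`. -/
def grad (G : Geometry) (f : G.points → ℝ) (y : G.points) : E4 := G.raise fun i => G.D f y (e i)

/-- The divergence of `W`: the trace of the covariant derivative `v ↦ ∇_v W` (the normal direction
contributes nothing). -/
def div (G : Geometry) (W : G.points → E4) (y : G.points) : ℝ := ∑ i, G.cov W y (e i) i

/-- The curl of `W`: the sum of `b × ∇_b W` over an orthonormal basis `b` of the tangent space.
The sum may be taken over the basis `e₀, …, e₃` of the ambient space, with the signs `eᵢ • eᵢ`,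
since the normal direction contributes nothing. See `volForm_curl`. -/
def curl (G : Geometry) (W : G.points → E4) (y : G.points) : E4 :=
  ∑ i, G.coeff i • G.cross y (e i) (G.cov W y (e i))

/-- The curl of `W` is the
vector field dual to the 2-form `d(↓W)`, where `↓W` is the 1-form `a ↦ W • a`. -/
theorem volForm_curl (G : Geometry) (W : G.points → E4) (y : G.points) (a b : E4)
    (ha : G.form y a = 0) (hb : G.form y b = 0) :
    volForm y (G.curl W y) a b =
      G.dot (fderiv ℝ (G.ext W) y a) b - G.dot (fderiv ℝ (G.ext W) y b) a := by
  have hy : G.form y y = 1 := by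
    obtain ⟨y, hy⟩ := y
    cases G with
    | spherical =>
      have h := EuclideanSpace.real_norm_sq_eq y
      have h1 : ‖y‖ = 1 := by simpa [points] using! hy
      simp only [h1, Fin.sum_univ_four] at h
      simp only [form, sign]
      linarith
    | hyperbolic => exact hy.1
  have hs : G.sign * G.sign = 1 := by cases G <;> simp [sign]
  have key : ∀ p q : E4, volForm y (G.cross y p q) a b =
      G.dot p a * G.dot q b - G.dot p b * G.dot q a := by
    intro p q
    have h : volForm y (G.cross y p q) a b =
        G.form y y * (G.dot p a * G.dot q b - G.dot p b * G.dot q a)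
        - G.form y a * (G.form p y * G.form q b - G.form p b * G.form q y)
        + G.form y b * (G.form p y * G.form q a - G.form p a * G.form q y) := by
      cases G <;>
      · simp [volForm, cross, raise, coeff, dot, form, sign, e, Matrix.det_succ_row_zero,
          Fin.sum_univ_succ, Fin.succAbove]
        ring
    rw [h, hy, ha, hb]
    ring
  have hlin : ∀ c : Fin 4 → E4, volForm y (∑ i, G.coeff i • c i) a b =
      ∑ i, G.coeff i * volForm y (c i) a b := by
    intro c
    simp [volForm, Matrix.det_succ_row_zero, Fin.sum_univ_succ, Fin.succAbove]
    ring
  have htan : ∀ w v : E4, G.form y v = 0 → G.dot (G.tan y w) v = G.dot w v := by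
    intro w v hv
    have h : G.form (G.tan y w) v = G.form w v - G.form y w * G.form y v := by
      unfold tan
      generalize G.form y w = r
      simp only [form, PiLp.sub_apply, PiLp.smul_apply, smul_eq_mul]
      ring
    rw [dot, dot, h, hv, mul_zero, sub_zero]
  have hsum : ∀ v w : E4, G.form y v = 0 →
      ∑ i, G.coeff i * (G.dot (e i) v * G.dot (G.D W y (e i)) w) =
        G.dot (fderiv ℝ (G.ext W) y v) w := by
    intro v w hv
    have hv' : G.tan y v = v := by rw [tan, hv, zero_smul, sub_zero]
    have hexp : v = ∑ i, (G.coeff i * G.dot (e i) v) • e i := by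
      ext j
      fin_cases j <;>
        simp [coeff, dot, form, e, Fin.sum_univ_four, ← mul_assoc, hs]
    let T : E4 →ₗ[ℝ] ℝ :=
      { toFun := fun u => G.dot (G.D W y u) w
        map_add' := fun u u' => by
          have h : G.tan y (u + u') = G.tan y u + G.tan y u' := by
            ext j
            simp only [tan, form, PiLp.add_apply, PiLp.sub_apply, PiLp.smul_apply, smul_eq_mul]
            ring
          simp only [D, h, map_add, dot, form, PiLp.add_apply]
          ring
        map_smul' := fun c u => by
          have h : G.tan y (c • u) = c • G.tan y u := by
            ext j
            simp only [tan, form, PiLp.sub_apply, PiLp.smul_apply, smul_eq_mul]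
            ring
          simp only [D, h, map_smul, dot, form, PiLp.smul_apply, smul_eq_mul, RingHom.id_apply]
          ring }
    have hT : T v = G.dot (fderiv ℝ (G.ext W) y v) w := by
      simp only [T, D, hv', LinearMap.coe_mk, AddHom.coe_mk]
    rw [← hT]
    conv_rhs => rw [hexp]
    simp only [map_sum, map_smul, smul_eq_mul, mul_assoc]
    rfl
  rw [curl, hlin]
  simp only [key, cov, htan _ _ ha, htan _ _ hb]
  rw [← hsum a b ha, ← hsum b a hb, ← Finset.sum_sub_distrib]
  exact Finset.sum_congr rfl fun i _ => by ring

/-- The smooth (tangent) vector fields, as functions to `ℝ⁴`. -/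
def fields (G : Geometry) : Submodule ℝ (G.points → E4) where
  carrier := {V | (∀ x : G.points, G.form x (V x) = 0) ∧ G.Smooth V}
  zero_mem' := by
    refine ⟨fun x => by simp [form], ?_⟩
    have h : G.ext (0 : G.points → E4) = 0 := by
      funext z
      simp [ext, Function.extend]
    simpa only [Smooth, h] using! contDiffOn_const
  add_mem' {V W} hV hW := by
    refine ⟨fun x => ?_, ?_⟩
    · have h1 := hV.1 x
      have h2 := hW.1 x
      simp only [form, Pi.add_apply, PiLp.add_apply] at h1 h2 ⊢
      linear_combination h1 + h2
    · have h : G.ext (V + W) = G.ext V + G.ext W := by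
        funext z
        simp only [ext, Function.extend, Pi.add_apply, Pi.zero_apply]
        split_ifs <;> simp
      simpa only [Smooth, h] using! hV.2.add hW.2
  smul_mem' c V hV := by
    refine ⟨fun x => ?_, ?_⟩
    · have h1 := hV.1 x
      simp only [form, Pi.smul_apply, PiLp.smul_apply, smul_eq_mul] at h1 ⊢
      linear_combination c * h1
    · have h : G.ext (c • V) = c • G.ext V := by
        funext z
        simp only [ext, Function.extend, Pi.smul_apply, Pi.zero_apply]
        split_ifs <;> simp
      simpa only [Smooth, h] using! hV.2.const_smul c

/-- The smooth vector fields with compact support. -/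
def compactFields (G : Geometry) : Submodule ℝ (G.points → E4) where
  carrier := {V | V ∈ G.fields ∧ HasCompactSupport V}
  zero_mem' := ⟨G.fields.zero_mem, HasCompactSupport.zero⟩
  add_mem' h h' := ⟨G.fields.add_mem h.1 h'.1, h.2.add h'.2⟩
  smul_mem' c _ h := ⟨G.fields.smul_mem c h.1, h.2.smul_left (f := fun _ => c)⟩

/-! ### Moving tangent vectors from one point to another -/

/-- The parallel transport `P_{yx} v` of `v ∈ T_x` to `y` along the geodesic segment from `x` to
`y`: it is given by the isometry of the ambient form that takes `x` to `y` and is the identity on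
the vectors orthogonal to `x` and `y`. -/
def transport (G : Geometry) (y x v : E4) : E4 :=
  v - (G.form y v / (1 + G.form x y)) • (x + y)

/-- The identification of `ℝ⁴` with the quaternions, `x ↦ x₀ + x₁ i + x₂ j + x₃ k`. -/
def quat : E4 ≃ₗᵢ[ℝ] ℍ[ℝ] := Quaternion.linearIsometryEquivTuple.symm

/-- The left translation `L_{yx⁻¹}` of tangent vectors of `S³` from `x` to `y`, the differential of
left multiplication by the quaternion `yx⁻¹`. -/
def leftTranslate (y x v : E4) : E4 := quat.symm (quat y * (quat x)⁻¹ * quat v)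

/-! ### Biot-Savart operators -/

/-- The gradient `∇_y φ(x, y)` with respect to `y`, where `φ(x, y)` stands for `φ(α(x, y))`. -/
def gradKernel (G : Geometry) (φ : ℝ → ℝ) (x y : G.points) : E4 :=
  G.grad (fun z => φ (G.dist x z)) y

/-- The fundamental solution `φ₀` of the scalar Laplacian,
`-(π - α) cot α / 4π²` on `S³` and `-(coth α - 1) / 4π` on `H³`. -/
def phi0 : Geometry → ℝ → ℝ
  | spherical, α => -1 / (4 * Real.pi ^ 2) * ((Real.pi - α) * Real.cot α)
  | hyperbolic, α => -1 / (4 * Real.pi) * (Real.cosh α / Real.sinh α - 1)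

/-- The integrand `V(x) • ∇_x φ₀(x, y)`. -/
def potentialIntegrand (G : Geometry) (V : G.points → E4) (y x : G.points) : ℝ :=
  G.dot (V x) (G.grad (fun w => G.phi0 (G.dist w y)) x)

/-- The function `y ↦ ∫ V(x) • ∇_x φ₀(x, y) dx`. -/
def potential (G : Geometry) (V : G.points → E4) (y : G.points) : ℝ :=
  ∫ x, G.potentialIntegrand V y x ∂G.vol

/-- A Biot-Savart operator is a linear operator from the smooth, compactly supported vector fields
to the smooth vector fields for which `BS(V)`
(1) is divergence-free,
(2) satisfies Maxwell's equation `∇ × BS(V)(y) = V(y) + ∇_y ∫ V(x) • ∇_x φ₀(x, y) dx`, where the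
integral converges and is a smooth function of `y`, and
(3) goes to zero at infinity (an empty condition on the compact space `S³`). -/
structure IsBiotSavart (G : Geometry) (BS : G.compactFields →ₗ[ℝ] G.fields) : Prop where
  div_eq_zero : ∀ (V : G.compactFields) (y : G.points), G.div (BS V).1 y = 0
  integrable_potential : ∀ (V : G.compactFields) (y : G.points),
    Integrable (G.potentialIntegrand V.1 y) G.vol
  smooth_potential : ∀ V : G.compactFields, G.Smooth (G.potential V.1)
  maxwell : ∀ (V : G.compactFields) (y : G.points),
    G.curl (BS V).1 y = V.1 y + G.grad (G.potential V.1) y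
  tendsto_zero : ∀ V : G.compactFields,
    Tendsto (fun y => √(G.dot ((BS V).1 y) ((BS V).1 y))) (cocompact G.points) (𝓝 0)

/-- The kernel `φ₁(α) = -α (2π - α) / 16π²` on `S³`. -/
def phi1 (α : ℝ) : ℝ := -1 / (16 * Real.pi ^ 2) * (α * (2 * Real.pi - α))

/-- The kernel of the parallel transport formula: `-(π - α) csc α / 4π²` on `S³` and
`-csch α / 4π` on `H³`. -/
def phiTransport : Geometry → ℝ → ℝ
  | spherical, α => -1 / (4 * Real.pi ^ 2) * ((Real.pi - α) / Real.sin α)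
  | hyperbolic, α => -1 / (4 * Real.pi) * (1 / Real.sinh α)

/-- The integrand `P_{yx} V(x) × ∇_y φ(x, y)`. -/
def transportIntegrand (G : Geometry) (V : G.points → E4) (y x : G.points) : E4 :=
  G.cross y (G.transport y x (V x)) (G.gradKernel G.phiTransport x y)

/-- The integrand `L_{yx⁻¹} V(x) × ∇_y φ₀(x, y)` on `S³`. -/
def leftIntegrand₀ (V : spherical.points → E4) (y x : spherical.points) : E4 :=
  spherical.cross y (leftTranslate y x (V x)) (spherical.gradKernel spherical.phi0 x y)

/-- The integrand `L_{yx⁻¹} V(x) • ∇_y φ₁(x, y)` on `S³`. -/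
def leftIntegrand₁ (V : spherical.points → E4) (y x : spherical.points) : ℝ :=
  spherical.dot (leftTranslate y x (V x)) (spherical.gradKernel phi1 x y)

end Geometry

/-- The 3-sphere. -/
abbrev S3 : Geometry := Geometry.spherical

/-- Hyperbolic 3-space. -/
abbrev H3 : Geometry := Geometry.hyperbolic

end BiotSavart

end

open BiotSavart

open MeasureTheory Filter Topology
open scoped ContDiff Quaternion

noncomputable section

namespace BiotSavart

namespace Geometry

/-! ### The ambient form -/

/-! Write c = ⟨x, y⟩, let σ = `sign` be the curvature, and let `ker` be the kernel φ of the parallel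
transport formula regarded as a function of c. This kernel is the fundamental solution of Δ - σ. Off
the diagonal that is the equation (1 - c²)k'' - 3ck' - k = 0, which is the same on both spaces, and
the normalisation of `ker` produces the delta function (`IsTest.laplacian_pot`).

Apply the kernel to the four ambient components of -V separately. The result A = `vpot` is an
ℝ⁴-valued function, in general not tangent, with ΔA = -V + σA componentwise. For any smooth A,
`Smooth.curl_curl` says that curl curl A equals minus the tangential part of ΔA, plus a gradient,
plus σ times the tangential part of A. The two terms in σ cancel, and curl curl A = V + gradient
remains (`curl_curl_vpot`). The function under the gradient is the potential in Maxwell's equation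
because φ₀ is c · ker(c) up to an additive constant (`phi0_dist`, `potentialIntegrand_eq`,
`potential_neg`). Hence BS(V) = curl A satisfies Maxwell's equation and has divergence zero.

Differentiating under the integral turns curl A into ∫ σ ker'(c) V(x) × x dx, the cross product
being taken at y. Parallel transport changes V(x) by a multiple of x + y only. The y part is killed
by the cross product at y, and the x part because ∇_y φ is a multiple of the tangential part of x
(`transportIntegrand_eq`). For the left-translation formula on S³, quaternion algebra
(`leftTranslate_identities`) shows that its first integrand is the integrand of BS, minus the
integrand of ∇⟨y, ∫ ker V⟩, plus L V / 4π². The other two terms of the formula cancel these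
corrections.

The analysis is done with infinitesimal isometries. They preserve the volume (`integral_rot`), and a
derivative along one of them passes through a kernel in c onto the density (`conv_rotD`). So
derivatives of an integral operator are again such operators with the same, undifferentiated kernel,
which gives smoothness although `ker` is singular. The kernel is regularised to ker(λₙ c), on which
Δ - σ gives a nonnegative function `delta` of c. To see that it is an approximate identity it is
enough to integrate it against affine functions of c. Such integrals are one-dimensional, because x
↦ ⟨x, y⟩ pushes the volume to the measure `nu`, which does not depend on y
(`measurePreserving_form`).

On H³ the integrand of BS has length at most c |V| / (4π(c² - 1)), and y₀ is at most a constant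
times c when x stays in the support of V. This gives a bound by a multiple of 1/y₀
(`exists_mag_biotSavart_le`), hence by a multiple of exp(-α). -/

/-- The diagonal entries of the ambient form. -/
def met (G : Geometry) (i : Fin 4) : ℝ := G.sign * G.coeff i

theorem sign_mul_self (G : Geometry) : G.sign * G.sign = 1 := by cases G <;> simp [sign]

theorem coeff_mul_self (G : Geometry) (i : Fin 4) : G.coeff i * G.coeff i = 1 := by
  unfold coeff; split_ifs <;> simp [sign_mul_self]

theorem met_mul_self (G : Geometry) (i : Fin 4) : G.met i * G.met i = 1 := by
  unfold met
  linear_combination G.sign * G.sign * G.coeff_mul_self i + G.sign_mul_self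

/-- The ambient form as a continuous bilinear map. -/
def bil (G : Geometry) : E4 →L[ℝ] E4 →L[ℝ] ℝ :=
  ∑ i, G.met i • (EuclideanSpace.proj i : E4 →L[ℝ] ℝ).smulRight
    (EuclideanSpace.proj i : E4 →L[ℝ] ℝ)

theorem bil_apply (G : Geometry) (u v : E4) : G.bil u v = G.form u v := by
  simp [bil, form, met, coeff, Fin.sum_univ_four]
  cases G <;> simp [sign] <;> ring

theorem form_comm (G : Geometry) (u v : E4) : G.form u v = G.form v u := by
  simp only [form]; ring

theorem form_add_right (G : Geometry) (u v w : E4) :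
    G.form u (v + w) = G.form u v + G.form u w := by simp only [← bil_apply, map_add]

theorem form_sub_right (G : Geometry) (u v w : E4) :
    G.form u (v - w) = G.form u v - G.form u w := by simp only [← bil_apply, map_sub]

theorem form_smul_right (G : Geometry) (c : ℝ) (u v : E4) :
    G.form u (c • v) = c * G.form u v := by simp only [← bil_apply, map_smul, smul_eq_mul]

theorem form_smul_left (G : Geometry) (c : ℝ) (u v : E4) :
    G.form (c • u) v = c * G.form u v := by rw [form_comm, form_smul_right, form_comm]

theorem form_sub_left (G : Geometry) (u v w : E4) :
    G.form (u - v) w = G.form u w - G.form v w := by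
  rw [form_comm, form_sub_right, form_comm, G.form_comm w v]

theorem form_add_left (G : Geometry) (u v w : E4) :
    G.form (u + v) w = G.form u w + G.form v w := by
  rw [form_comm, form_add_right, form_comm, G.form_comm w v]

@[simp] theorem e_apply (i j : Fin 4) : e i j = if j = i then 1 else 0 := by
  simp [e]

theorem form_e (G : Geometry) (u : E4) (i : Fin 4) : G.form u (e i) = G.met i * u i := by
  have := G.sign_mul_self
  fin_cases i <;> simp [form, met, coeff, this]

theorem form_eq_sum (G : Geometry) (u v : E4) : G.form u v = ∑ i, G.met i * u i * v i := by
  simp [form, met, coeff, Fin.sum_univ_four]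
  linear_combination -(u 0 * v 0) * G.sign_mul_self

theorem eq_sum_e (v : E4) : v = ∑ i, v i • e i := by
  ext j; fin_cases j <;> simp [Fin.sum_univ_four]

theorem continuous_form (G : Geometry) : Continuous fun p : E4 × E4 => G.form p.1 p.2 := by
  unfold form; fun_prop

theorem contDiff_form (G : Geometry) {n} : ContDiff ℝ n fun p : E4 × E4 => G.form p.1 p.2 := by
  unfold form; fun_prop

theorem contDiff_form_self (G : Geometry) {n} : ContDiff ℝ n fun z : E4 => G.form z z := by
  unfold form; fun_prop

theorem spherical_form_self (z : E4) : spherical.form z z = ‖z‖ ^ 2 := by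
  rw [EuclideanSpace.real_norm_sq_eq]
  simp [form, sign, Fin.sum_univ_four]; ring

/-! ### Points and the radial projection -/

theorem mem_points_spherical {z : E4} : z ∈ spherical.points ↔ spherical.form z z = 1 := by
  rw [spherical_form_self, pow_eq_one_iff_of_nonneg (norm_nonneg z) two_ne_zero]
  simp [points]

theorem form_self {G : Geometry} {y : E4} (hy : y ∈ G.points) : G.form y y = 1 := by
  cases G with
  | spherical => exact mem_points_spherical.1 hy
  | hyperbolic => exact hy.1

theorem form_self_pos {G : Geometry} {z : E4} (hz : z ∈ G.cone) : 0 < G.form z z := by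
  cases G with
  | spherical =>
    rw [spherical_form_self]
    have : z ≠ 0 := hz
    positivity
  | hyperbolic => exact hz.1

theorem points_subset_cone (G : Geometry) : G.points ⊆ G.cone := by
  intro y hy
  cases G with
  | spherical =>
    rintro rfl
    simpa [form] using form_self hy
  | hyperbolic => exact ⟨by rw [hy.1]; exact one_pos, hy.2⟩

theorem mem_cone {G : Geometry} (y : G.points) : (y : E4) ∈ G.cone := G.points_subset_cone y.2

theorem isOpen_cone (G : Geometry) : IsOpen G.cone := by
  cases G with
  | spherical => exact isOpen_ne
  | hyperbolic =>
    exact (isOpen_lt continuous_const (contDiff_form_self (n := 0) _).continuous).inter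
      (isOpen_lt continuous_const (by fun_prop : Continuous fun z : E4 => z 0))

theorem proj_mem {G : Geometry} {z : E4} (hz : z ∈ G.cone) : G.proj z ∈ G.points := by
  have h := form_self_pos hz
  have h1 : G.form (G.proj z) (G.proj z) = 1 := by
    rw [proj, form_smul_left, form_smul_right]
    have := Real.mul_self_sqrt h.le
    have h2 := (Real.sqrt_pos.2 h).ne'
    field_simp
    nlinarith
  cases G with
  | spherical => exact mem_points_spherical.2 h1
  | hyperbolic =>
    refine ⟨h1, ?_⟩
    have h2 := Real.sqrt_pos.2 h
    have h3 : 0 < z 0 := hz.2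
    simp only [proj, PiLp.smul_apply, smul_eq_mul]
    positivity

theorem proj_of_mem {G : Geometry} {y : E4} (hy : y ∈ G.points) : G.proj y = y := by
  simp [proj, form_self hy]

theorem contDiffOn_proj (G : Geometry) {n} : ContDiffOn ℝ n G.proj G.cone := by
  intro z hz
  have h := form_self_pos hz
  have h1 := G.contDiff_form_self.contDiffAt (n := n) (x := z)
  exact (((h1.sqrt h.ne').inv (Real.sqrt_pos.2 h).ne').smul contDiffAt_id).contDiffWithinAt

theorem contDiffAt_proj {G : Geometry} {n} {z : E4} (hz : z ∈ G.cone) :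
    ContDiffAt ℝ n G.proj z := G.contDiffOn_proj.contDiffAt (G.isOpen_cone.mem_nhds hz)

theorem continuousAt_proj {G : Geometry} {z : E4} (hz : z ∈ G.cone) :
    ContinuousAt G.proj z := (contDiffAt_proj (n := 0) hz).continuousAt

/-- The projection onto the tangent space as a continuous linear map. -/
def tanL (G : Geometry) (y : E4) : E4 →L[ℝ] E4 :=
  ContinuousLinearMap.id ℝ E4 - (G.bil y).smulRight y

@[simp] theorem tanL_apply (G : Geometry) (y v : E4) : G.tanL y v = G.tan y v := by
  simp [tanL, tan, bil_apply]

theorem form_tan {G : Geometry} {y : E4} (hy : y ∈ G.points) (v : E4) :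
    G.form y (G.tan y v) = 0 := by
  rw [tan, form_sub_right, form_smul_right, form_self hy]; ring

theorem tan_of_form_eq_zero {G : Geometry} {y v : E4} (h : G.form y v = 0) : G.tan y v = v := by
  simp [tan, h]

theorem hasFDerivAt_form_self (G : Geometry) (z : E4) :
    HasFDerivAt (fun z => G.form z z) ((2 : ℝ) • G.bil z) z := by
  have h := (G.bil.hasFDerivAt (x := z)).clm_apply (hasFDerivAt_id z)
  refine (h.congr_fderiv ?_).congr_of_eventuallyEq (Eventually.of_forall fun w => by
    simp [bil_apply])
  ext v
  simp [bil_apply, G.form_comm v z]; ring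

/-- Since √⟨y, y⟩ = 1, the quotient rule leaves v - ⟨y, v⟩ y. Hence the derivative of an extension
constant on rays sees only the tangential part of a vector. -/
theorem hasFDerivAt_proj {G : Geometry} {y : E4} (hy : y ∈ G.points) :
    HasFDerivAt G.proj (G.tanL y) y := by
  have h0 := form_self hy
  have h1 := (G.hasFDerivAt_form_self y).sqrt (by rw [h0]; exact one_ne_zero)
  have h2 := ((hasDerivAt_inv (x := √(G.form y y)) (by simp [h0])).comp_hasFDerivAt y h1).smul
    (hasFDerivAt_id y)
  refine h2.congr_fderiv ?_
  ext v : 1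
  simp [h0, tan, bil_apply, sub_eq_add_neg]

theorem form_fderiv_proj {G : Geometry} {z : E4} (hz : z ∈ G.cone) (v : E4) :
    G.form (G.proj z) (fderiv ℝ G.proj z v) = 0 := by
  have h1 : HasFDerivAt G.proj (fderiv ℝ G.proj z) z :=
    ((contDiffAt_proj (n := 1) hz).differentiableAt one_ne_zero).hasFDerivAt
  have h2 := (G.hasFDerivAt_form_self (G.proj z)).comp z h1
  have h3 : (fun w => G.form (G.proj w) (G.proj w)) =ᶠ[𝓝 z] fun _ => (1 : ℝ) := by
    filter_upwards [G.isOpen_cone.mem_nhds hz] with w hw using form_self (proj_mem hw)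
  have h4 := h2.unique ((hasFDerivAt_const (1 : ℝ) z).congr_of_eventuallyEq h3)
  have h5 := DFunLike.congr_fun h4 v
  simpa [bil_apply] using h5

/-! ### Functions on the space -/

section Functions

theorem ext_of_mem {F : Type*} [Zero F] {G : Geometry} (f : G.points → F) {z : E4} (hz : z ∈ G.cone) :
    G.ext f z = f ⟨G.proj z, proj_mem hz⟩ :=
  Subtype.val_injective.extend_apply f 0 ⟨G.proj z, proj_mem hz⟩

@[simp] theorem ext_coe {F : Type*} [Zero F] {G : Geometry} (f : G.points → F) (y : G.points) : G.ext f y = f y := by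
  rw [ext_of_mem f (mem_cone y)]
  congr
  exact proj_of_mem y.2

theorem ext_eq_comp_proj {F : Type*} [Zero F] {G : Geometry} {f : G.points → F} {g : E4 → F}
    (h : ∀ x : G.points, g x = f x) {z : E4} (hz : z ∈ G.cone) :
    G.ext f z = g (G.proj z) := by
  rw [ext_of_mem f hz, ← h]

theorem ext_eventuallyEq {F : Type*} [Zero F] {G : Geometry} {f : G.points → F} {g : E4 → F}
    (h : ∀ x : G.points, g x = f x) {z : E4} (hz : z ∈ G.cone) :
    G.ext f =ᶠ[𝓝 z] g ∘ G.proj := by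
  filter_upwards [G.isOpen_cone.mem_nhds hz] with w hw using ext_eq_comp_proj h hw

variable {F : Type*} [NormedAddCommGroup F] [NormedSpace ℝ F]

theorem hasFDerivAt_ext {G : Geometry} {f : G.points → F} {g : E4 → F} {g' : E4 →L[ℝ] F}
    (h : ∀ x : G.points, g x = f x) {y : G.points} (hg : HasFDerivAt g g' y) :
    HasFDerivAt (G.ext f) (g'.comp (G.tanL y)) y := by
  refine HasFDerivAt.congr_of_eventuallyEq ?_ (ext_eventuallyEq h (mem_cone y))
  exact HasFDerivAt.comp _ (by rwa [proj_of_mem y.2]) (hasFDerivAt_proj y.2)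

/-- The tangential derivative may be computed from any extension. -/
theorem D_eq_of_hasFDerivAt {G : Geometry} {f : G.points → F} {g : E4 → F} {g' : E4 →L[ℝ] F}
    (h : ∀ x : G.points, g x = f x) {y : G.points} (hg : HasFDerivAt g g' y) (v : E4) :
    G.D f y v = g' (G.tan y v) := by
  rw [D, (hasFDerivAt_ext h hg).fderiv]
  simp [tan_of_form_eq_zero (form_tan y.2 v)]

theorem D_eq {G : Geometry} {f : G.points → F} {g : E4 → F}
    (h : ∀ x : G.points, g x = f x) {y : G.points} (hg : DifferentiableAt ℝ g y) (v : E4) :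
    G.D f y v = fderiv ℝ g y (G.tan y v) := D_eq_of_hasFDerivAt h hg.hasFDerivAt v

theorem smooth_of_contDiffAt {G : Geometry} {f : G.points → F} {g : E4 → F}
    (h : ∀ x : G.points, g x = f x) (hg : ∀ y : G.points, ContDiffAt ℝ ∞ g y) : G.Smooth f := by
  intro z hz
  refine ContDiffAt.contDiffWithinAt ?_
  refine ContDiffAt.congr_of_eventuallyEq ?_ (ext_eventuallyEq h hz)
  exact (hg ⟨_, proj_mem hz⟩).comp z (contDiffAt_proj hz)

theorem Smooth.contDiffAt {G : Geometry} {f : G.points → F} (hf : G.Smooth f) {z : E4}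
    (hz : z ∈ G.cone) : ContDiffAt ℝ ∞ (G.ext f) z :=
  ContDiffOn.contDiffAt (f := G.ext f) hf (G.isOpen_cone.mem_nhds hz)

theorem Smooth.differentiableAt {G : Geometry} {f : G.points → F} (hf : G.Smooth f) {z : E4}
    (hz : z ∈ G.cone) : DifferentiableAt ℝ (G.ext f) z :=
  (hf.contDiffAt hz).differentiableAt (by simp)

theorem Smooth.continuous {G : Geometry} {f : G.points → F} (hf : G.Smooth f) :
    Continuous f := by
  have h0 : ContinuousOn (G.ext f) G.cone := ContDiffOn.continuousOn (f := G.ext f) hf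
  have h : Continuous ((G.ext f) ∘ Subtype.val) :=
    h0.comp_continuous continuous_subtype_val mem_cone
  exact h.congr fun y => ext_coe f y

theorem D_eq_fderiv {G : Geometry} {f : G.points → F} {y : G.points}
    (hf : DifferentiableAt ℝ (G.ext f) y) (v : E4) : G.D f y v = fderiv ℝ (G.ext f) y v := by
  have h := (hasFDerivAt_ext (fun x => ext_coe f x) hf.hasFDerivAt).fderiv
  conv_rhs => rw [h]
  simp [D]

theorem Smooth.hasFDerivAt {G : Geometry} {f : G.points → F} (hf : G.Smooth f) (y : G.points) :
    HasFDerivAt (G.ext f) (fderiv ℝ (G.ext f) y) y :=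
  (hf.differentiableAt (mem_cone y)).hasFDerivAt

end Functions

/-! ### The metric on the tangent spaces -/

/-- Compares the Euclidean norm of ℝ⁴ with the Riemannian metric on one tangent space. On H³ the
constant must grow with y. -/
theorem exists_norm_sq_le_dot {G : Geometry} {y : E4} (hy : y ∈ G.points) :
    ∃ C : ℝ, 0 ≤ C ∧ ∀ v, G.form y v = 0 → ‖v‖ ^ 2 ≤ C * G.dot v v := by
  cases G with
  | spherical =>
    refine ⟨1, zero_le_one, fun v _ => ?_⟩
    rw [dot, spherical_form_self]; simp [sign]
  | hyperbolic =>
    -- Tangency says that the spatial product of y and v is y₀v₀. Cauchy–Schwarz then gives w ≤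
    -- y₀²(w - v₀²), where w is the squared spatial length of v and w - v₀² is the metric; moreover
    -- ‖v‖² = v₀² + w ≤ 2w.
    refine ⟨2 * y 0 ^ 2, by positivity, fun v hv => ?_⟩
    have h1 := form_self hy
    rw [EuclideanSpace.real_norm_sq_eq]
    simp only [form, sign, dot, Fin.sum_univ_four] at *
    set a := y 1 * v 1 + y 2 * v 2 + y 3 * v 3
    set b := y 1 ^ 2 + y 2 ^ 2 + y 3 ^ 2
    set w := v 1 ^ 2 + v 2 ^ 2 + v 3 ^ 2
    have h2 : a ^ 2 ≤ b * w := by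
      simp only [a, b, w]
      nlinarith [sq_nonneg (y 1 * v 2 - y 2 * v 1), sq_nonneg (y 1 * v 3 - y 3 * v 1),
        sq_nonneg (y 2 * v 3 - y 3 * v 2)]
    have h3 : a = y 0 * v 0 := by simp only [a]; linarith
    have h4 : b = y 0 ^ 2 - 1 := by simp only [b]; linarith
    rw [h3, h4] at h2
    have h5 : w ≤ y 0 ^ 2 * (w - v 0 ^ 2) := by nlinarith
    have h6 : 0 ≤ w := by positivity
    have h7 : v 0 ^ 2 ≤ w := by nlinarith [sq_nonneg (y 0)]
    nlinarith

theorem dot_self_nonneg {G : Geometry} {y : E4} (hy : y ∈ G.points) {v : E4}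
    (hv : G.form y v = 0) : 0 ≤ G.dot v v := by
  obtain ⟨C, hC, h⟩ := exists_norm_sq_le_dot hy
  by_contra! h1
  have h2 := h v hv
  have h3 : ‖v‖ ^ 2 ≤ 0 := by nlinarith
  have h4 : v = 0 := by simpa using sq_nonpos_iff _ |>.1 h3
  simp [h4, dot, form] at h1

/-- Cauchy–Schwarz in T_y: the quadratic t ↦ |u + tv|² is nonnegative, so its discriminant is not
positive. -/
theorem dot_sq_le {G : Geometry} {y : E4} (hy : y ∈ G.points) {u v : E4}
    (hu : G.form y u = 0) (hv : G.form y v = 0) :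
    G.dot u v ^ 2 ≤ G.dot u u * G.dot v v := by
  have h1 : ∀ t : ℝ, 0 ≤ G.dot v v * (t * t) + 2 * G.dot u v * t + G.dot u u := by
    intro t
    have h2 : G.form y (u + t • v) = 0 := by
      rw [form_add_right, form_smul_right, hu, hv]; ring
    have h3 := dot_self_nonneg hy h2
    rw [dot, form_add_left, form_add_right, form_add_right, form_smul_left, form_smul_right,
      form_smul_left, form_smul_right, form_comm G v u] at h3
    simp only [dot]
    linarith
  have h2 := discrim_le_zero h1
  simp only [discrim] at h2
  linarith

/-- `q(c) = ±(1 - c²)`: the square of `sin α` or `sinh α` where `c` is `cos α` or `cosh α`. -/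
def q (G : Geometry) (c : ℝ) : ℝ := G.sign * (1 - c ^ 2)

/-- The values of `⟨x, y⟩` on pairs of points. -/
def rng : Geometry → Set ℝ
  | spherical => Set.Icc (-1) 1
  | hyperbolic => Set.Ici 1

/-- The interior of `rng`. -/
def dom : Geometry → Set ℝ
  | spherical => Set.Ioo (-1) 1
  | hyperbolic => Set.Ioi 1

theorem dot_tan_tan {G : Geometry} {y : E4} (hy : y ∈ G.points) (u v : E4) :
    G.dot (G.tan y u) (G.tan y v) = G.sign * (G.form u v - G.form u y * G.form y v) := by
  rw [dot, tan, tan, form_sub_left, form_sub_right, form_sub_right, form_smul_left,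
    form_smul_left, form_smul_right, form_smul_right, form_self hy, G.form_comm u y]
  ring

theorem dot_tan_self {G : Geometry} {x y : E4} (hx : x ∈ G.points) (hy : y ∈ G.points) :
    G.dot (G.tan y x) (G.tan y x) = G.q (G.form x y) := by
  rw [dot_tan_tan hy, form_self hx, form_comm G y x, q]; ring

/-- The number q⟨x, y⟩ is the squared length of the tangential part of x at y, hence nonnegative, so
c² ≤ 1 or c² ≥ 1 respectively. On H³ the branch c ≤ -1 is excluded by Cauchy–Schwarz for the spatial
parts and x₀, y₀ > 0. -/
theorem form_mem_rng {G : Geometry} {x y : E4} (hx : x ∈ G.points) (hy : y ∈ G.points) :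
    G.form x y ∈ G.rng := by
  have h := dot_self_nonneg hy (form_tan hy x)
  rw [dot_tan_self hx hy, q] at h
  cases G with
  | spherical =>
    simp only [sign] at h
    exact abs_le.1 (abs_le_one_iff_mul_self_le_one.2 (by nlinarith))
  | hyperbolic =>
    simp only [sign] at h
    have h1 : 0 < hyperbolic.form x y := by
      have h2 := form_self hx
      have h3 := form_self hy
      have hx0 := hx.2
      have hy0 := hy.2
      simp only [form, sign] at h2 h3 ⊢
      set a := x 1 * y 1 + x 2 * y 2 + x 3 * y 3
      set b := y 1 ^ 2 + y 2 ^ 2 + y 3 ^ 2 with hb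
      set w := x 1 ^ 2 + x 2 ^ 2 + x 3 ^ 2 with hw
      have h4 : a ^ 2 ≤ b * w := by
        simp only [a, b, w]
        nlinarith [sq_nonneg (y 1 * x 2 - y 2 * x 1), sq_nonneg (y 1 * x 3 - y 3 * x 1),
          sq_nonneg (y 2 * x 3 - y 3 * x 2)]
      have h5 : b = y 0 ^ 2 - 1 := by linarith
      have h6 : w = x 0 ^ 2 - 1 := by linarith
      have h7 : a ^ 2 < (x 0 * y 0) ^ 2 := by
        rw [h5, h6] at h4
        have h8 : 0 ≤ w := by positivity
        have h9 : 0 ≤ b := by positivity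
        nlinarith
      have h8 := (abs_lt_of_sq_lt_sq h7 (by positivity))
      have h9 := (abs_lt.1 h8).2
      linarith
    show (1 : ℝ) ≤ _
    nlinarith

theorem q_nonneg {G : Geometry} {c : ℝ} (hc : c ∈ G.rng) : 0 ≤ G.q c := by
  cases G with
  | spherical => obtain ⟨h1, h2⟩ := hc; simp only [q, sign]; nlinarith
  | hyperbolic => have h1 : 1 ≤ c := hc; simp only [q, sign]; nlinarith

theorem q_pos {G : Geometry} {c : ℝ} (hc : c ∈ G.dom) : 0 < G.q c := by
  cases G with
  | spherical => obtain ⟨h1, h2⟩ := hc; simp only [q, sign]; nlinarith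
  | hyperbolic => have h1 : 1 < c := hc; simp only [q, sign]; nlinarith

theorem dom_subset_rng (G : Geometry) : G.dom ⊆ G.rng := by
  cases G with
  | spherical => exact Set.Ioo_subset_Icc_self
  | hyperbolic => exact Set.Ioi_subset_Ici_self

theorem isOpen_dom (G : Geometry) : IsOpen G.dom := by
  cases G with
  | spherical => exact isOpen_Ioo
  | hyperbolic => exact isOpen_Ioi

/-- Cauchy–Schwarz against the tangential part of x, whose length is √q. The factor √q tames `ker1`,
bounded by a multiple of q^(-3/2) for bounded c, to the integrable order q⁻¹. -/
theorem abs_form_tan_le {G : Geometry} {x y : E4} (hx : x ∈ G.points) (hy : y ∈ G.points)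
    (v : E4) :
    |G.form x (G.tan y v)| ≤ √(G.q (G.form x y)) * √(G.dot (G.tan y v) (G.tan y v)) := by
  have h1 := dot_sq_le hy (form_tan hy x) (form_tan hy v)
  rw [dot_tan_self hx hy] at h1
  have h2 : G.dot (G.tan y x) (G.tan y v) ^ 2 = G.form x (G.tan y v) ^ 2 := by
    have h3 : G.form (G.tan y x) (G.tan y v) = G.form x (G.tan y v) := by
      conv_lhs => rw [tan]
      rw [form_sub_left, form_smul_left, form_tan hy]; ring
    rw [dot, h3]
    linear_combination (G.form x (G.tan y v)) ^ 2 * G.sign_mul_self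
  rw [h2] at h1
  rw [← Real.sqrt_mul (q_nonneg (form_mem_rng hx hy))]
  exact Real.abs_le_sqrt h1

/-- Split x - y into its tangential part at y, of squared length q(c), and (c - 1) y. -/
theorem exists_norm_sub_sq_le {G : Geometry} {y : E4} (hy : y ∈ G.points) :
    ∃ C : ℝ, 0 ≤ C ∧ ∀ x ∈ G.points,
      ‖x - y‖ ^ 2 ≤ C * (G.q (G.form x y) + (G.form x y - 1) ^ 2) := by
  obtain ⟨C, hC, h⟩ := exists_norm_sq_le_dot hy
  refine ⟨2 * (C + ‖y‖ ^ 2), by positivity, fun x hx => ?_⟩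
  have h1 := h _ (form_tan hy x)
  rw [dot_tan_self hx hy] at h1
  have h2 : x - y = G.tan y x + (G.form x y - 1) • y := by
    rw [tan, form_comm G y x, sub_smul, one_smul]; abel
  have h3 : ‖x - y‖ ≤ ‖G.tan y x‖ + |G.form x y - 1| * ‖y‖ := by
    rw [h2, ← Real.norm_eq_abs, ← norm_smul]; exact norm_add_le _ _
  have h4 : ‖x - y‖ ^ 2 ≤ (‖G.tan y x‖ + |G.form x y - 1| * ‖y‖) ^ 2 := by gcongr
  have h5 := sq_abs (G.form x y - 1)
  have h6 := q_nonneg (form_mem_rng hx hy)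
  have h7 : 0 ≤ ‖y‖ ^ 2 * G.q (G.form x y) := by positivity
  have h8 : 0 ≤ C * (G.form x y - 1) ^ 2 := by positivity
  have h9 : (|G.form x y - 1| * ‖y‖) ^ 2 = (G.form x y - 1) ^ 2 * ‖y‖ ^ 2 := by rw [mul_pow, h5]
  nlinarith [sq_nonneg (‖G.tan y x‖ - |G.form x y - 1| * ‖y‖)]

/-- Points `x` with `⟨x, y⟩` close to `1` are close to `y`. -/
theorem exists_form_lt_imp_mem {G : Geometry} (y : G.points) {U : Set G.points} (hU : U ∈ 𝓝 y) :
    ∃ η > 0, ∀ x : G.points, |G.form x y - 1| < η → x ∈ U := by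
  obtain ⟨ε, hε, hεU⟩ := Metric.mem_nhds_iff.1 hU
  obtain ⟨C, hC, h⟩ := exists_norm_sub_sq_le y.2
  have hlim : Tendsto (fun c : ℝ => C * (G.q c + (c - 1) ^ 2)) (𝓝 1) (𝓝 0) := by
    have hc : Continuous fun c : ℝ => C * (G.q c + (c - 1) ^ 2) := by unfold q; fun_prop
    simpa [q] using hc.tendsto 1
  obtain ⟨η, hη, hη'⟩ := Metric.eventually_nhds_iff.1
    (hlim.eventually (gt_mem_nhds (show (0 : ℝ) < ε ^ 2 by positivity)))
  refine ⟨η, hη, fun x hx => hεU ?_⟩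
  have h1 := (h x x.2).trans_lt (hη' (by rwa [Real.dist_eq]))
  rw [Metric.mem_ball, Subtype.dist_eq, dist_eq_norm]
  exact lt_of_pow_lt_pow_left₀ 2 hε.le h1

/-! ### The infinitesimal isometries -/

/-- The generators of the isometry group of the ambient form. -/
def rot (G : Geometry) (a j : Fin 4) : E4 →L[ℝ] E4 :=
  (G.met a • (EuclideanSpace.proj a : E4 →L[ℝ] ℝ)).smulRight (e j)
    - (G.met j • (EuclideanSpace.proj j : E4 →L[ℝ] ℝ)).smulRight (e a)

theorem rot_apply (G : Geometry) (a j : Fin 4) (y : E4) :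
    G.rot a j y = (G.met a * y a) • e j - (G.met j * y j) • e a := by
  simp [rot]

theorem rot_self (G : Geometry) (a : Fin 4) (y : E4) : G.rot a a y = 0 := by
  simp [rot_apply]

theorem form_rot_right (G : Geometry) (a j : Fin 4) (x y : E4) :
    G.form x (G.rot a j y) = G.met a * G.met j * (y a * x j - y j * x a) := by
  rw [rot_apply, form_sub_right, form_smul_right, form_smul_right, form_e, form_e]; ring

theorem form_rot_left (G : Geometry) (a j : Fin 4) (x y : E4) :
    G.form (G.rot a j x) y = -G.form x (G.rot a j y) := by
  rw [form_comm, form_rot_right, form_rot_right]; ring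

theorem form_self_rot (G : Geometry) (a j : Fin 4) (y : E4) : G.form y (G.rot a j y) = 0 := by
  rw [form_rot_right]; ring

theorem tan_rot (G : Geometry) (a j : Fin 4) (y : E4) : G.tan y (G.rot a j y) = G.rot a j y :=
  tan_of_form_eq_zero (G.form_self_rot a j y)

/-- The sum is ⟨y, y⟩ τ - ⟨y, τ⟩ y. Every tangent vector is thus a combination of infinitesimal
isometries, and derivatives in all directions reduce to derivatives along these. -/
theorem sum_smul_rot {G : Geometry} {y τ : E4} (hy : y ∈ G.points) (hτ : G.form y τ = 0) :
    ∑ j, ∑ a, (τ j * y a) • G.rot a j y = τ := by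
  have h1 := form_self hy
  rw [form_eq_sum] at h1 hτ
  simp only [rot_apply]
  ext k
  simp only [Fin.sum_univ_four] at *
  fin_cases k <;> simp
  · linear_combination τ 0 * h1 - y 0 * hτ
  · linear_combination τ 1 * h1 - y 1 * hτ
  · linear_combination τ 2 * h1 - y 2 * hτ
  · linear_combination τ 3 * h1 - y 3 * hτ

/-! ### Invariance of the measures -/

/-- The action of a linear isometry on the sphere. -/
def sphereMap (R : E4 ≃ₗᵢ[ℝ] E4) (x : spherical.points) : spherical.points :=
  ⟨R x, by have := x.2; simp only [points, mem_sphere_zero_iff_norm] at this ⊢; simpa using this⟩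

theorem continuous_sphereMap (R : E4 ≃ₗᵢ[ℝ] E4) : Continuous (sphereMap R) :=
  (R.continuous.comp continuous_subtype_val).subtype_mk _

open scoped Pointwise in
-- The surface measure of s is a multiple of the volume of the cone (0,1)·s. A linear isometry maps
-- cones to cones and preserves Lebesgue measure.
theorem measurePreserving_sphereMap (R : E4 ≃ₗᵢ[ℝ] E4) :
    MeasurePreserving (sphereMap R) spherical.vol spherical.vol := by
  refine ⟨(continuous_sphereMap R).measurable, ?_⟩
  ext s hs
  rw [Measure.map_apply (continuous_sphereMap R).measurable hs]
  simp only [vol]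
  erw [Measure.toSphere_apply' _ hs,
    Measure.toSphere_apply' _ ((continuous_sphereMap R).measurable hs)]
  congr 1
  have h : Set.Ioo (0 : ℝ) 1 • (Subtype.val '' (sphereMap R ⁻¹' s)) =
      R ⁻¹' (Set.Ioo (0 : ℝ) 1 • (Subtype.val '' s)) := by
    ext z
    simp only [Set.mem_smul, Set.mem_image, Set.mem_preimage]
    constructor
    · rintro ⟨t, ht, _, ⟨x, hx, rfl⟩, rfl⟩
      exact ⟨t, ht, _, ⟨_, hx, rfl⟩, by simp [sphereMap]⟩
    · rintro ⟨t, ht, _, ⟨x, hx, rfl⟩, hz⟩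
      refine ⟨t, ht, _, ⟨sphereMap R.symm x, ?_, rfl⟩, ?_⟩
      · have : sphereMap R (sphereMap R.symm x) = x := Subtype.ext (by simp [sphereMap])
        rwa [this]
      · apply R.injective
        simpa [sphereMap] using hz
  erw [h]
  exact R.measurePreserving.measure_preimage_equiv (f := R.toMeasurableEquiv) _

/-! ### Lorentz boosts in the projection coordinates of the hyperboloid. -/

section Boost

variable {F : Type*} [NormedAddCommGroup F] [InnerProductSpace ℝ F]

/-- The boost of the hyperboloid, in the coordinates given by the projection to `ℝⁿ`. -/
def boost (v p : F) : F := p + (√(1 + ‖p‖ ^ 2) + inner ℝ v p / (1 + √(1 + ‖v‖ ^ 2))) • v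

/-- The time coordinate transforms as under a Lorentz boost. Both sides have the same square, and
Cauchy–Schwarz shows that the right side is the nonnegative root. -/
theorem sqrt_boost (v p : F) :
    √(1 + ‖boost v p‖ ^ 2) = √(1 + ‖v‖ ^ 2) * √(1 + ‖p‖ ^ 2) + inner ℝ v p := by
  have hv : (0 : ℝ) < 1 + ‖v‖ ^ 2 := by positivity
  have hp : (0 : ℝ) < 1 + ‖p‖ ^ 2 := by positivity
  have h1 := Real.sq_sqrt hv.le
  have h2 := Real.sq_sqrt hp.le
  have h3 := Real.sqrt_pos.2 hv
  have h4 := Real.sqrt_pos.2 hp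
  have h5 := abs_real_inner_le_norm v p
  set a := √(1 + ‖v‖ ^ 2)
  set b := √(1 + ‖p‖ ^ 2)
  set t := inner ℝ v p with ht
  have h6 : ‖v‖ * ‖p‖ ≤ a * b := by
    refine mul_le_mul ?_ ?_ (norm_nonneg _) h3.le <;>
      · refine Real.le_sqrt_of_sq_le ?_; linarith
  have h7 : 0 ≤ a * b + t := by linarith [(abs_le.1 h5).1]
  rw [← Real.sqrt_sq h7]
  congr 1
  have h0 : boost v p = p + (b + t / (1 + a)) • v := rfl
  rw [h0, norm_add_sq_real, norm_smul, mul_pow, Real.norm_eq_abs, sq_abs, inner_smul_right,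
    real_inner_comm v p, ← ht]
  have h8 : ‖v‖ ^ 2 = a ^ 2 - 1 := by linarith
  have h9 : ‖p‖ ^ 2 = b ^ 2 - 1 := by linarith
  rw [h8, h9]
  field_simp
  ring

theorem boost_neg_boost (v p : F) : boost (-v) (boost v p) = p := by
  have hv : (0 : ℝ) < 1 + ‖v‖ ^ 2 := by positivity
  have h1 := Real.sq_sqrt hv.le
  have h3 := Real.sqrt_pos.2 hv
  rw [boost, sqrt_boost, norm_neg, boost]
  set a := √(1 + ‖v‖ ^ 2)
  set b := √(1 + ‖p‖ ^ 2)
  rw [inner_neg_left, inner_add_right, inner_smul_right, real_inner_self_eq_norm_sq,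
    show ‖v‖ ^ 2 = a ^ 2 - 1 by linarith, smul_neg, add_assoc, ← sub_eq_add_neg, ← sub_smul]
  convert add_zero p
  convert zero_smul ℝ v
  field_simp
  ring

theorem bijective_boost (v : F) : Function.Bijective (boost v) := by
  refine ⟨Function.LeftInverse.injective (boost_neg_boost v), fun p => ⟨boost (-v) p, ?_⟩⟩
  simpa using boost_neg_boost (-v) p

theorem hasFDerivAt_boost (v p : F) :
    HasFDerivAt (boost v) (ContinuousLinearMap.id ℝ F +
      ((1 / √(1 + ‖p‖ ^ 2)) • innerSL ℝ p + (1 / (1 + √(1 + ‖v‖ ^ 2))) • innerSL ℝ v).smulRight v)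
      p := by
  have hp : (0 : ℝ) < 1 + ‖p‖ ^ 2 := by positivity
  have h1 : HasFDerivAt (fun p : F => 1 + ‖p‖ ^ 2) (2 • innerSL ℝ p) p :=
    ((hasStrictFDerivAt_norm_sq p).hasFDerivAt).const_add 1
  have h2 := h1.sqrt hp.ne'
  have h3 : HasFDerivAt (fun p : F => inner ℝ v p / (1 + √(1 + ‖v‖ ^ 2)))
      ((1 / (1 + √(1 + ‖v‖ ^ 2))) • innerSL ℝ v) p := by
    have := ((innerSL ℝ v).hasFDerivAt (x := p)).const_smul (1 / (1 + √(1 + ‖v‖ ^ 2)))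
    refine this.congr_of_eventuallyEq (Eventually.of_forall fun w => ?_)
    simp; ring
  refine ((hasFDerivAt_id p).add ((h2.add h3).smul_const v)).congr_fderiv ?_
  congr 3
  rw [two_nsmul, ← two_smul ℝ, smul_smul]
  congr 1
  field_simp

variable [FiniteDimensional ℝ F] [MeasurableSpace F] [BorelSpace F]

/-- The derivative of the boost is the identity plus a rank-one map, so its determinant is that of a
transvection. It equals the ratio of √(1 + |p|²) at the image and at p, exactly what the density dp
/ √(1 + |p|²) needs in order to be invariant. -/
theorem lintegral_boost (v : F) (g : F → ENNReal) :
    ∫⁻ p, ENNReal.ofReal (1 / √(1 + ‖p‖ ^ 2)) * g (boost v p) =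
      ∫⁻ p, ENNReal.ofReal (1 / √(1 + ‖p‖ ^ 2)) * g p := by
  have h := lintegral_image_eq_lintegral_abs_det_fderiv_mul (volume : Measure F)
    MeasurableSet.univ (fun p _ => (hasFDerivAt_boost v p).hasFDerivWithinAt)
    (bijective_boost v).injective.injOn fun p => ENNReal.ofReal (1 / √(1 + ‖p‖ ^ 2)) * g p
  rw [Set.image_univ, (bijective_boost v).surjective.range_eq, setLIntegral_univ,
    setLIntegral_univ] at h
  rw [h]
  refine lintegral_congr fun p => ?_
  have hp : (0 : ℝ) < 1 + ‖p‖ ^ 2 := by positivity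
  have hv : (0 : ℝ) < 1 + ‖v‖ ^ 2 := by positivity
  have hb : (0 : ℝ) < 1 + ‖boost v p‖ ^ 2 := by positivity
  have h1 := Real.sq_sqrt hv.le
  have h2 := Real.sqrt_pos.2 hv
  have h3 := Real.sqrt_pos.2 hp
  have h4 := Real.sqrt_pos.2 hb
  rw [← mul_assoc, ← ENNReal.ofReal_mul (abs_nonneg _)]
  congr 2
  have hdet : (ContinuousLinearMap.id ℝ F +
      ((1 / √(1 + ‖p‖ ^ 2)) • innerSL ℝ p + (1 / (1 + √(1 + ‖v‖ ^ 2))) • innerSL ℝ v).smulRight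
        v).det = √(1 + ‖boost v p‖ ^ 2) / √(1 + ‖p‖ ^ 2) := by
    have h5 := LinearMap.transvection.det (R := ℝ) (V := F)
      (((1 / √(1 + ‖p‖ ^ 2)) • innerSL ℝ p +
        (1 / (1 + √(1 + ‖v‖ ^ 2))) • innerSL ℝ v : F →L[ℝ] ℝ) : Module.Dual ℝ F) v
    have h6 : ((ContinuousLinearMap.id ℝ F +
      ((1 / √(1 + ‖p‖ ^ 2)) • innerSL ℝ p + (1 / (1 + √(1 + ‖v‖ ^ 2))) • innerSL ℝ v).smulRight
        v : F →L[ℝ] F) : F →ₗ[ℝ] F) = LinearMap.transvection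
        (((1 / √(1 + ‖p‖ ^ 2)) • innerSL ℝ p +
          (1 / (1 + √(1 + ‖v‖ ^ 2))) • innerSL ℝ v : F →L[ℝ] ℝ) : Module.Dual ℝ F) v := by
      ext w; simp [LinearMap.transvection.apply]
    rw [ContinuousLinearMap.det, h6, h5, sqrt_boost]
    simp only [ContinuousLinearMap.coe_coe, add_apply, smul_apply,
      innerSL_apply_apply, smul_eq_mul, real_inner_self_eq_norm_sq]
    rw [show ‖v‖ ^ 2 = √(1 + ‖v‖ ^ 2) ^ 2 - 1 by linarith, real_inner_comm v p]
    have h7 : (√(1 + ‖v‖ ^ 2)) ^ 2 - 1 + 1 = √(1 + ‖v‖ ^ 2) ^ 2 := by ring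
    rw [show 1 + (√(1 + ‖v‖ ^ 2) ^ 2 - 1) = √(1 + ‖v‖ ^ 2) ^ 2 by ring, Real.sqrt_sq h2.le]
    field_simp
    ring
  rw [hdet, abs_of_pos (by positivity)]
  field_simp

end Boost

/-! ### The distribution of `⟨x, y⟩` -/

/-- The distribution of `⟨x, y⟩`, for a fixed point `y`, under the Riemannian volume. -/
def nu (G : Geometry) : Measure ℝ :=
  (volume.restrict G.dom).withDensity fun c => ENNReal.ofReal (4 * Real.pi * √(G.q c))

theorem measurable_q (G : Geometry) : Measurable G.q := by unfold q; fun_prop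

theorem continuous_q (G : Geometry) : Continuous G.q := by unfold q; fun_prop

theorem measurable_density (G : Geometry) :
    Measurable fun c => ENNReal.ofReal (4 * Real.pi * √(G.q c)) := by
  have := G.measurable_q; fun_prop

theorem lintegral_nu (G : Geometry) {g : ℝ → ENNReal} (hg : Measurable g) :
    ∫⁻ c, g c ∂G.nu = ∫⁻ c in G.dom, ENNReal.ofReal (4 * Real.pi * √(G.q c)) * g c := by
  rw [nu, lintegral_withDensity_eq_lintegral_mul _ G.measurable_density hg]; rfl

/-- Polar coordinates for nonnegative functions without any integrability hypothesis, as needed to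
identify a measure. -/
theorem lintegral_fun_norm {E : Type*} [NormedAddCommGroup E] [NormedSpace ℝ E] [Nontrivial E]
    [MeasurableSpace E] [BorelSpace E] [FiniteDimensional ℝ E] (μ : Measure E)
    [μ.IsAddHaarMeasure] {f : ℝ → ENNReal} (hf : Measurable f) :
    ∫⁻ x, f ‖x‖ ∂μ = μ.toSphere Set.univ *
      ∫⁻ r in Set.Ioi (0 : ℝ), ENNReal.ofReal (r ^ (Module.finrank ℝ E - 1)) * f r :=
  calc
    ∫⁻ x, f ‖x‖ ∂μ = ∫⁻ x : ({(0)}ᶜ : Set E), f ‖x.1‖ ∂(μ.comap (↑)) := by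
      rw [lintegral_subtype_comap (measurableSet_singleton _).compl fun x ↦ f ‖x‖,
        restrict_compl_singleton]
    _ = ∫⁻ x, f x.2 ∂μ.toSphere.prod (.volumeIoiPow (Module.finrank ℝ E - 1)) := by
      rw [← μ.measurePreserving_homeomorphUnitSphereProd.lintegral_comp_emb
        (Homeomorph.measurableEmbedding _)]
      simp
    _ = μ.toSphere Set.univ *
        ∫⁻ x : Set.Ioi (0 : ℝ), f x ∂(.volumeIoiPow (Module.finrank ℝ E - 1)) := by
      rw [lintegral_prod _ (by fun_prop)]
      simp [mul_comm]
    _ = _ := by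
      rw [Measure.volumeIoiPow, lintegral_withDensity_eq_lintegral_mul _ (by fun_prop)
        (by fun_prop), ← lintegral_subtype_comap measurableSet_Ioi]
      rfl

theorem continuous_hyperboloidPoint : Continuous hyperboloidPoint := by
  refine Continuous.subtype_mk ?_ _
  refine (PiLp.continuous_toLp 2 _).comp (continuous_pi fun i => ?_)
  fin_cases i <;> simp <;> fun_prop

/-- The coordinates of a point of the hyperboloid. -/
def spatial (x : E4) : EuclideanSpace ℝ (Fin 3) := !₂[x 1, x 2, x 3]

theorem continuous_spatial : Continuous spatial := by
  refine (PiLp.continuous_toLp 2 _).comp (continuous_pi fun i => ?_)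
  fin_cases i <;> simp <;> fun_prop

theorem norm_sq_E3 (p : EuclideanSpace ℝ (Fin 3)) : ‖p‖ ^ 2 = p 0 ^ 2 + p 1 ^ 2 + p 2 ^ 2 := by
  rw [EuclideanSpace.real_norm_sq_eq, Fin.sum_univ_three]

theorem hyperboloidPoint_spatial (x : hyperbolic.points) : hyperboloidPoint (spatial x) = x := by
  obtain ⟨x, h, h0⟩ := x
  apply Subtype.ext
  simp only [hyperboloidPoint]
  ext i
  simp only [form, sign] at h
  fin_cases i <;> simp [spatial]
  rw [norm_sq_E3]
  simp
  rw [show 1 + (x 1 ^ 2 + x 2 ^ 2 + x 3 ^ 2) = x 0 ^ 2 by linarith, Real.sqrt_sq h0.le]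

@[simp] theorem spatial_hyperboloidPoint (p : EuclideanSpace ℝ (Fin 3)) :
    spatial (hyperboloidPoint p) = p := by
  ext i; fin_cases i <;> simp [spatial, hyperboloidPoint]

theorem form_hyperboloidPoint (p v : EuclideanSpace ℝ (Fin 3)) :
    hyperbolic.form (hyperboloidPoint p) (hyperboloidPoint v) =
      √(1 + ‖p‖ ^ 2) * √(1 + ‖v‖ ^ 2) - inner ℝ v p := by
  simp [hyperboloidPoint, form, sign, PiLp.inner_apply, Fin.sum_univ_three]
  ring

/-- The boost by v is an isometry taking the apex to the point over v, and the product of any point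
with the apex is its time coordinate. -/
theorem form_boost (v p : EuclideanSpace ℝ (Fin 3)) :
    hyperbolic.form (hyperboloidPoint (boost v p)) (hyperboloidPoint v) = √(1 + ‖p‖ ^ 2) := by
  have hv : (0 : ℝ) < 1 + ‖v‖ ^ 2 := by positivity
  have h1 := Real.sq_sqrt hv.le
  have h3 := Real.sqrt_pos.2 hv
  rw [form_hyperboloidPoint, sqrt_boost, boost, inner_add_right, inner_smul_right,
    real_inner_self_eq_norm_sq]
  set a := √(1 + ‖v‖ ^ 2)
  set b := √(1 + ‖p‖ ^ 2)
  rw [show ‖v‖ ^ 2 = a ^ 2 - 1 by linarith]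
  field_simp
  ring

theorem toSphere_E3 : (volume : Measure (EuclideanSpace ℝ (Fin 3))).toSphere Set.univ =
    ENNReal.ofReal (4 * Real.pi) := by
  rw [Measure.toSphere_apply_univ, EuclideanSpace.volume_ball_fin_three,
    ENNReal.ofReal_one, one_pow, one_mul, ← ENNReal.ofReal_natCast,
    ← ENNReal.ofReal_mul (by positivity), finrank_euclideanSpace, Fintype.card_fin]
  congr 1; push_cast; ring

theorem lintegral_vol_hyperbolic {g : hyperbolic.points → ENNReal} (hg : Measurable g) :
    ∫⁻ x, g x ∂hyperbolic.vol =
      ∫⁻ p, ENNReal.ofReal (1 / √(1 + ‖p‖ ^ 2)) * g (hyperboloidPoint p) := by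
  have h := continuous_hyperboloidPoint.measurable
  rw [vol, lintegral_map hg h, lintegral_withDensity_eq_lintegral_mul _ (by fun_prop)
    (by fun_prop)]
  rfl

/-- After y is boosted to the apex, ⟨x, y⟩ = √(1 + |p|²) is radial. Polar coordinates give the
density 4πr²/c dr, and with c = √(1 + r²), dc = (r/c) dr and √q(c) = r this is 4π√q dc. -/
theorem lintegral_form_hyperbolic (y : hyperbolic.points) {g : ℝ → ENNReal}
    (hg : Measurable g) :
    ∫⁻ x : hyperbolic.points, g (hyperbolic.form x y) ∂hyperbolic.vol
      = ∫⁻ c, g c ∂hyperbolic.nu := by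
  have hm : Measurable fun x : hyperbolic.points => hyperbolic.form x y := by
    unfold form; fun_prop
  rw [lintegral_vol_hyperbolic (g := fun x => g (hyperbolic.form x y)) (hg.comp hm)]
  rw [← hyperboloidPoint_spatial y, ← lintegral_boost (spatial y)]
  simp only [form_boost]
  rw [lintegral_fun_norm volume (f := fun r => ENNReal.ofReal (1 / √(1 + r ^ 2)) *
    g √(1 + r ^ 2)) (by fun_prop), toSphere_E3, lintegral_nu _ hg]
  have himg : (fun r : ℝ => √(1 + r ^ 2)) '' Set.Ioi 0 = hyperbolic.dom := by
    ext c
    simp only [Set.mem_image, Set.mem_Ioi, dom]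
    constructor
    · rintro ⟨r, hr, rfl⟩
      exact Real.lt_sqrt_of_sq_lt (by nlinarith)
    · intro hc
      refine ⟨√(c ^ 2 - 1), Real.sqrt_pos.2 (by nlinarith), ?_⟩
      rw [Real.sq_sqrt (by nlinarith), add_sub_cancel, Real.sqrt_sq (by linarith)]
  have hder : ∀ r ∈ Set.Ioi (0 : ℝ), HasDerivWithinAt (fun r : ℝ => √(1 + r ^ 2))
      (r / √(1 + r ^ 2)) (Set.Ioi 0) r := by
    intro r _
    have h1 : (1 : ℝ) + r ^ 2 ≠ 0 := by positivity
    have h2 := (((hasDerivAt_pow 2 r).const_add 1).sqrt h1)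
    refine (h2.congr_deriv ?_).hasDerivWithinAt
    simp; field_simp
  have hinj : Set.InjOn (fun r : ℝ => √(1 + r ^ 2)) (Set.Ioi 0) := by
    intro r hr t ht h
    simp only [Set.mem_Ioi] at hr ht
    have h1 : r ^ 2 = t ^ 2 := by
      have := (Real.sqrt_inj (by positivity) (by positivity)).1 h
      linarith
    exact (pow_left_inj₀ hr.le ht.le two_ne_zero).1 h1
  rw [← himg, lintegral_image_eq_lintegral_abs_deriv_mul measurableSet_Ioi hder hinj,
    ← lintegral_const_mul _ (by fun_prop)]
  refine setLIntegral_congr_fun measurableSet_Ioi fun r hr => ?_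
  have hr0 : 0 < r := hr
  have h1 : (0 : ℝ) < 1 + r ^ 2 := by positivity
  have h2 : hyperbolic.q √(1 + r ^ 2) = r ^ 2 := by
    simp only [q, sign]; rw [Real.sq_sqrt h1.le]; ring
  have h3 := Real.sqrt_pos.2 h1
  simp only [h2, Real.sqrt_sq hr0.le, finrank_euclideanSpace, Fintype.card_fin]
  rw [← mul_assoc, ← mul_assoc, ← mul_assoc, ← ENNReal.ofReal_mul (by positivity),
    ← ENNReal.ofReal_mul (by positivity), ← ENNReal.ofReal_mul (by positivity)]
  rw [abs_of_pos (by positivity)]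
  congr 2
  field_simp

theorem measurable_form (G : Geometry) (y : E4) :
    Measurable fun x : G.points => G.form x y := by
  unfold form; fun_prop

/-! ### Integration by parts -/

theorem rot_swap (G : Geometry) (a j : Fin 4) : G.rot j a = -G.rot a j := by
  simp [rot]

theorem continuous_fderiv_apply {G : Geometry} {h : E4 → ℝ}
    (hh : ∀ x : G.points, ContDiffAt ℝ 1 h x) (X : E4 →L[ℝ] E4) :
    Continuous fun x : G.points => fderiv ℝ h x (X x) := by
  rw [continuous_iff_continuousAt]
  intro x
  have h1 : ContinuousAt (fderiv ℝ h) x :=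
    ((hh x).fderiv_right (m := 0) (by norm_num)).continuousAt
  have h2 : ContinuousAt (fun z : E4 => fderiv ℝ h z (X z)) x := h1.clm_apply X.continuous.continuousAt
  exact h2.comp continuousAt_subtype_val

theorem ext_eventuallyEq_zero {F : Type*} [Zero F] {G : Geometry} {f : G.points → F}
    {y : G.points} (h : f =ᶠ[𝓝 y] 0) : G.ext f =ᶠ[𝓝 (y : E4)] 0 := by
  obtain ⟨U, hU, hUf⟩ := mem_nhds_subtype _ _ _ |>.1 h
  have h1 : Tendsto G.proj (𝓝 y) (𝓝 y) := by
    have := (continuousAt_proj (mem_cone y)).tendsto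
    rwa [proj_of_mem y.2] at this
  filter_upwards [G.isOpen_cone.mem_nhds (mem_cone y), h1 hU] with z hz hzU
  rw [ext_of_mem f hz]
  exact hUf (a := ⟨G.proj z, proj_mem hz⟩) hzU

theorem D_eq_zero {F : Type*} [NormedAddCommGroup F] [NormedSpace ℝ F] {G : Geometry}
    {f : G.points → F} {y : G.points} (h : f =ᶠ[𝓝 y] 0) (v : E4) : G.D f y v = 0 := by
  rw [D, (ext_eventuallyEq_zero h).fderiv_eq]
  simp

theorem hasCompactSupport_D {F : Type*} [NormedAddCommGroup F] [NormedSpace ℝ F] {G : Geometry}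
    {f : G.points → F} (hf : HasCompactSupport f) (X : G.points → E4) :
    HasCompactSupport fun x => G.D f x (X x) :=
  hf.mono' fun x hx => by
    by_contra h
    exact hx (D_eq_zero (notMem_tsupport_iff_eventuallyEq.1 h) _)

theorem hasCompactSupport_fderiv_rot {G : Geometry} {h : E4 → ℝ}
    (hh : ∀ x : G.points, ContDiffAt ℝ 1 h x) (hc : HasCompactSupport fun x : G.points => h x)
    (a j : Fin 4) : HasCompactSupport fun x : G.points => fderiv ℝ h x (G.rot a j x) := by
  have h1 := hasCompactSupport_D hc fun x => G.rot a j x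
  have h2 : (fun x : G.points => fderiv ℝ h x (G.rot a j x)) =
      fun x : G.points => G.D (fun x : G.points => h x) x (G.rot a j x) := by
    funext x
    rw [D_eq (fun _ => rfl) ((hh x).differentiableAt one_ne_zero), tan_rot]
  rwa [h2]

theorem continuous_of_contDiffAt {G : Geometry} {h : E4 → ℝ} {n : WithTop ℕ∞}
    (hh : ∀ x : G.points, ContDiffAt ℝ n h x) : Continuous fun x : G.points => h x := by
  rw [continuous_iff_continuousAt]
  exact fun x => (hh x).continuousAt.comp continuousAt_subtype_val

/-! ### Invariance of integrals over the sphere under rotations. -/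

section Sphere

/-- The rotation of `ℝ⁴` by the angle `t` in a coordinate plane, as a linear map. -/
def rotation (a j : Fin 4) (t : ℝ) : E4 →L[ℝ] E4 :=
  ContinuousLinearMap.id ℝ E4 + (Real.cos t - 1) •
    ((EuclideanSpace.proj a : E4 →L[ℝ] ℝ).smulRight (e a) +
      (EuclideanSpace.proj j : E4 →L[ℝ] ℝ).smulRight (e j)) + Real.sin t • spherical.rot a j

theorem rotation_apply (a j : Fin 4) (t : ℝ) (y : E4) :
    rotation a j t y = y + (Real.cos t - 1) • (y a • e a + y j • e j) +
      Real.sin t • (y a • e j - y j • e a) := by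
  simp [rotation, rot_apply, met, sign, coeff]

theorem norm_rotation {a j : Fin 4} (haj : a ≠ j) (t : ℝ) (y : E4) :
    ‖rotation a j t y‖ = ‖y‖ := by
  rw [← pow_left_inj₀ (norm_nonneg _) (norm_nonneg _) two_ne_zero, rotation_apply,
    EuclideanSpace.real_norm_sq_eq, EuclideanSpace.real_norm_sq_eq]
  have h := Real.sin_sq_add_cos_sq t
  have key : ∀ u v : ℝ, (u + ((Real.cos t - 1) * u - Real.sin t * v)) ^ 2 +
      (v + ((Real.cos t - 1) * v + Real.sin t * u)) ^ 2 = u ^ 2 + v ^ 2 := by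
    intro u v; linear_combination (u ^ 2 + v ^ 2) * h
  have := key (y a) (y j)
  fin_cases a <;> fin_cases j <;> first | exact absurd rfl haj | skip
  all_goals
    simp [Fin.sum_univ_four] at this ⊢
    linear_combination this

theorem hasDerivAt_rotation {a j : Fin 4} (haj : a ≠ j) (t : ℝ) (y : E4) :
    HasDerivAt (fun t => rotation a j t y) (spherical.rot a j (rotation a j t y)) t := by
  have h1 : HasDerivAt (fun t => y + (Real.cos t - 1) • (y a • e a + y j • e j) +
      Real.sin t • (y a • e j - y j • e a)) ((-Real.sin t) • (y a • e a + y j • e j) +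
      Real.cos t • (y a • e j - y j • e a)) t :=
    ((((Real.hasDerivAt_cos t).sub_const 1).smul_const _).const_add y).add
      ((Real.hasDerivAt_sin t).smul_const _)
  simp only [rotation_apply]
  refine h1.congr_deriv ?_
  rw [rot_apply]
  have h2 : spherical.met = fun _ => 1 := by funext i; simp [met, sign, coeff]
  have h3 := haj.symm
  ext k
  simp only [h2, haj, h3, e_apply, PiLp.add_apply, PiLp.sub_apply, PiLp.smul_apply, smul_eq_mul,
    if_true, if_false]
  split_ifs <;> ring

/-- The integral of h over the sphere, composed with the rotation by t, does not depend on t. Its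
derivative at t = 0, taken under the integral sign, is the integral in question; compactness
provides the bound. -/
theorem integral_rot_spherical (a j : Fin 4) {h : E4 → ℝ}
    (hh : ∀ x : spherical.points, ContDiffAt ℝ 1 h x) :
    ∫ x : spherical.points, fderiv ℝ h x (spherical.rot a j x) ∂spherical.vol = 0 := by
  rcases eq_or_ne a j with rfl | haj
  · simp [rot_self]
  have : CompactSpace spherical.points := isCompact_iff_compactSpace.1 (isCompact_sphere 0 1)
  have : IsFiniteMeasure spherical.vol := inferInstanceAs (IsFiniteMeasure (Measure.toSphere _))
  let R : ℝ → E4 ≃ₗᵢ[ℝ] E4 := fun t => LinearIsometry.toLinearIsometryEquiv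
    (⟨(rotation a j t : E4 →ₗ[ℝ] E4), norm_rotation haj t⟩ : E4 →ₗᵢ[ℝ] E4) rfl
  have hR : ∀ t x, ((sphereMap (R t) x : spherical.points) : E4) = rotation a j t x :=
    fun t x => rfl
  have hcont := continuous_fderiv_apply hh (spherical.rot a j)
  have hcont0 := continuous_of_contDiffAt hh
  obtain ⟨C, hC⟩ := (isCompact_univ (X := spherical.points)).exists_bound_of_continuousOn
    hcont.continuousOn
  have hder := hasDerivAt_integral_of_dominated_loc_of_deriv_le (μ := spherical.vol)
    (F := fun t x => h (sphereMap (R t) x))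
    (F' := fun t x => fderiv ℝ h (sphereMap (R t) x) (spherical.rot a j (sphereMap (R t) x)))
    (bound := fun _ => C) (x₀ := 0) univ_mem
    (Eventually.of_forall fun t => (hcont0.comp
      (continuous_sphereMap (R t))).aestronglyMeasurable)
    ((hcont0.comp (continuous_sphereMap (R 0))).integrable_of_hasCompactSupport
      (HasCompactSupport.of_compactSpace _))
    ((hcont.comp (continuous_sphereMap (R 0))).aestronglyMeasurable)
    (Eventually.of_forall fun x t _ => hC _ (Set.mem_univ _))
    (integrable_const C)
    (Eventually.of_forall fun x t _ => by
      have h1 : HasFDerivAt h _ (rotation a j t x) :=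
        (((hh (sphereMap (R t) x)).differentiableAt one_ne_zero)).hasFDerivAt
      exact h1.comp_hasDerivAt t (hasDerivAt_rotation haj t x))
  have hconst : ∀ t, ∫ x, h (sphereMap (R t) x) ∂spherical.vol =
      ∫ x : spherical.points, h x ∂spherical.vol := by
    intro t
    have hm := measurePreserving_sphereMap (R t)
    conv_rhs => rw [← hm.map_eq]
    rw [integral_map hm.measurable.aemeasurable hcont0.aestronglyMeasurable]
  simp only [hconst] at hder
  have h0 := hder.2.unique (hasDerivAt_const _ _)
  have hid : ∀ x, sphereMap (R 0) x = x := fun x => Subtype.ext (by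
    rw [hR]; simp [rotation])
  simpa only [hid] using h0

end Sphere

/-! ### Invariance of integrals over the hyperboloid under boosts and spatial rotations. -/

section Hyperboloid

theorem isClosedEmbedding_hyperboloidPoint :
    IsClosedEmbedding hyperboloidPoint := by
  have h : Function.LeftInverse (fun x : hyperbolic.points => spatial x) hyperboloidPoint :=
    spatial_hyperboloidPoint
  exact h.isClosedEmbedding (continuous_spatial.comp continuous_subtype_val)
    continuous_hyperboloidPoint

instance isFiniteMeasureOnCompacts_vol (G : Geometry) : IsFiniteMeasureOnCompacts G.vol := by
  cases G with
  | spherical =>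
    have : IsFiniteMeasure spherical.vol := inferInstanceAs (IsFiniteMeasure (Measure.toSphere _))
    infer_instance
  | hyperbolic =>
    refine ⟨fun K hK => ?_⟩
    have h1 := isClosedEmbedding_hyperboloidPoint.isCompact_preimage hK
    rw [vol, Measure.map_apply continuous_hyperboloidPoint.measurable hK.measurableSet,
      withDensity_apply _ h1.measurableSet]
    refine lt_of_le_of_lt (lintegral_mono (g := fun _ => 1) fun p => ?_) ?_
    · rw [ENNReal.ofReal_le_one]
      have : 1 ≤ √(1 + ‖p‖ ^ 2) := Real.one_le_sqrt.2 (by nlinarith [sq_nonneg ‖p‖])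
      exact div_le_one_of_le₀ this (by positivity)
    · simpa using h1.measure_lt_top

theorem integral_vol_hyperbolic {g : hyperbolic.points → ℝ} (hg : Continuous g) :
    ∫ x, g x ∂hyperbolic.vol = ∫ p, 1 / √(1 + ‖p‖ ^ 2) * g (hyperboloidPoint p) := by
  rw [vol, integral_map continuous_hyperboloidPoint.measurable.aemeasurable
    hg.aestronglyMeasurable, integral_withDensity_eq_integral_toReal_smul (by fun_prop)
    (Eventually.of_forall fun _ => ENNReal.ofReal_lt_top)]
  refine integral_congr_ae (Eventually.of_forall fun p => ?_)
  simp only [smul_eq_mul]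
  rw [ENNReal.toReal_ofReal (by positivity)]

theorem hasFDerivAt_sqrt_one_add (p : EuclideanSpace ℝ (Fin 3)) :
    HasFDerivAt (fun p : EuclideanSpace ℝ (Fin 3) => √(1 + ‖p‖ ^ 2))
      ((1 / √(1 + ‖p‖ ^ 2)) • innerSL ℝ p) p := by
  have hp : (1 : ℝ) + ‖p‖ ^ 2 ≠ 0 := by positivity
  have h1 : HasFDerivAt (fun p : EuclideanSpace ℝ (Fin 3) => 1 + ‖p‖ ^ 2) (2 • innerSL ℝ p) p :=
    ((hasStrictFDerivAt_norm_sq p).hasFDerivAt).const_add 1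
  refine (h1.sqrt hp).congr_fderiv ?_
  rw [two_nsmul, ← two_smul ℝ, smul_smul]
  congr 1
  field_simp

theorem hyperboloidPoint_eq (p : EuclideanSpace ℝ (Fin 3)) :
    ((hyperboloidPoint p : hyperbolic.points) : E4) =
      √(1 + ‖p‖ ^ 2) • e 0 + ∑ b : Fin 3, p b • e b.succ := by
  ext i
  fin_cases i <;> simp [hyperboloidPoint, Fin.sum_univ_three]

theorem contDiff_hyperboloidPoint :
    ContDiff ℝ 1 fun p => ((hyperboloidPoint p : hyperbolic.points) : E4) := by
  simp only [hyperboloidPoint_eq]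
  have h : ContDiff ℝ 1 fun p : EuclideanSpace ℝ (Fin 3) => √(1 + ‖p‖ ^ 2) :=
    ContDiff.sqrt (contDiff_const.add (contDiff_norm_sq ℝ)) fun p => by positivity
  exact (h.smul contDiff_const).add (ContDiff.sum fun i _ => ContDiff.smul 
    (EuclideanSpace.proj i : EuclideanSpace ℝ (Fin 3) →L[ℝ] ℝ).contDiff contDiff_const)

theorem hasFDerivAt_hyperboloidPoint (p : EuclideanSpace ℝ (Fin 3)) :
    HasFDerivAt (fun p => ((hyperboloidPoint p : hyperbolic.points) : E4))
      (((1 / √(1 + ‖p‖ ^ 2)) • innerSL ℝ p).smulRight (e 0) +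
        ∑ b : Fin 3, (EuclideanSpace.proj b : EuclideanSpace ℝ (Fin 3) →L[ℝ] ℝ).smulRight
          (e b.succ)) p := by
  simp only [hyperboloidPoint_eq]
  exact ((hasFDerivAt_sqrt_one_add p).smul_const (e 0)).add (HasFDerivAt.fun_sum fun b _ =>
    ((EuclideanSpace.proj b : EuclideanSpace ℝ (Fin 3) →L[ℝ] ℝ).hasFDerivAt).smul_const _)

theorem integral_fderiv_eq_zero {E : Type*} [NormedAddCommGroup E] [NormedSpace ℝ E]
    [MeasurableSpace E] [BorelSpace E] [FiniteDimensional ℝ E] (μ : Measure E)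
    [μ.IsAddHaarMeasure] {f : E → ℝ} (hf : ContDiff ℝ 1 f) (hc : HasCompactSupport f) (v : E) :
    ∫ x, fderiv ℝ f x v ∂μ = 0 := by
  have h := integral_mul_fderiv_eq_neg_fderiv_mul_of_integrable (μ := μ) (v := v)
    (f := fun _ => (1 : ℝ)) (g := f) (by simp)
    (by
      simp only [one_mul]
      exact ((hf.continuous_fderiv one_ne_zero).clm_apply
        continuous_const).integrable_of_hasCompactSupport (hc.fderiv_apply ℝ v))
    (by simpa using hf.continuous.integrable_of_hasCompactSupport hc)
    (by simp) (fun x _ => (hf.differentiable one_ne_zero) x)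
  simpa using h

/-- In the coordinates p the generator of the boost is √(1 + |p|²) ∂_b. Its factor cancels the
volume density, and the integral of a partial derivative of a compactly supported function on ℝ³
remains. -/
theorem integral_rot_zero_succ (b : Fin 3) {h : E4 → ℝ}
    (hh : ∀ x : hyperbolic.points, ContDiffAt ℝ 1 h x)
    (hc : HasCompactSupport fun x : hyperbolic.points => h x) :
    ∫ x : hyperbolic.points, fderiv ℝ h x (hyperbolic.rot 0 b.succ x) ∂hyperbolic.vol = 0 := by
  rw [integral_vol_hyperbolic (continuous_fderiv_apply hh _)]
  have h1 : ContDiff ℝ 1 fun p => h (hyperboloidPoint p) := contDiff_iff_contDiffAt.2 fun p =>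
    (hh (hyperboloidPoint p)).comp p contDiff_hyperboloidPoint.contDiffAt
  have h2 : HasCompactSupport fun p => h (hyperboloidPoint p) :=
    hc.comp_isClosedEmbedding isClosedEmbedding_hyperboloidPoint
  rw [← integral_fderiv_eq_zero volume h1 h2 (EuclideanSpace.single b 1)]
  congr 1
  funext p
  have h3 : HasFDerivAt h _ ((hyperboloidPoint p : hyperbolic.points) : E4) :=
    ((hh (hyperboloidPoint p)).differentiableAt one_ne_zero).hasFDerivAt
  have h4 := (h3.comp p (hasFDerivAt_hyperboloidPoint p)).fderiv
  have h5 : fderiv ℝ (fun p => h (hyperboloidPoint p)) p = _ := h4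
  have hp : (0 : ℝ) < √(1 + ‖p‖ ^ 2) := Real.sqrt_pos.2 (by positivity)
  rw [h5, ContinuousLinearMap.comp_apply, ← smul_eq_mul, ← map_smul]
  congr 1
  rw [rot_apply]
  have h6 : hyperbolic.met b.succ = -1 := by simp [met, coeff, sign, Fin.succ_ne_zero]
  have h7 : hyperbolic.met 0 = 1 := by simp [met, coeff, sign]
  have h8 : (hyperboloidPoint p : E4) 0 = √(1 + ‖p‖ ^ 2) := by simp [hyperboloidPoint]
  have h9 : (hyperboloidPoint p : E4) b.succ = p b := by
    fin_cases b <;> simp [hyperboloidPoint]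
  rw [h6, h7, h8, h9]
  simp [sum_apply, EuclideanSpace.inner_single_right, ite_smul, smul_smul, hp.ne']
  exact add_comm _ _

/-- Reduction to boosts. With h_c = (x_c/x₀) h, the derivative of h along the spatial rotation
equals the boost derivative of h_b in direction a minus that of h_a in direction b: the derivatives
of the factors x_c/x₀ are symmetric in a and b and cancel. -/
theorem integral_rot_succ_succ {a b : Fin 3} (hab : a ≠ b) {h : E4 → ℝ}
    (hh : ∀ x : hyperbolic.points, ContDiffAt ℝ 1 h x)
    (hc : HasCompactSupport fun x : hyperbolic.points => h x) :
    ∫ x : hyperbolic.points, fderiv ℝ h x (hyperbolic.rot a.succ b.succ x) ∂hyperbolic.vol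
      = 0 := by
  have hne : ∀ x : hyperbolic.points, (x : E4) 0 ≠ 0 := fun x => x.2.2.ne'
  let h' : Fin 3 → E4 → ℝ := fun c x => (x c.succ * (x 0)⁻¹) * h x
  have hd0 : ∀ (c : Fin 3) (x : hyperbolic.points), HasFDerivAt
      (fun x : E4 => x c.succ * (x 0)⁻¹) ((x : E4) c.succ • ((-((x : E4) 0 ^ 2)⁻¹) •
        (EuclideanSpace.proj 0 : E4 →L[ℝ] ℝ)) + ((x : E4) 0)⁻¹ •
        (EuclideanSpace.proj c.succ : E4 →L[ℝ] ℝ)) x := fun c x =>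
    ((EuclideanSpace.proj c.succ : E4 →L[ℝ] ℝ).hasFDerivAt).mul
      ((hasDerivAt_inv (hne x)).comp_hasFDerivAt (x : E4)
        ((EuclideanSpace.proj 0 : E4 →L[ℝ] ℝ).hasFDerivAt))
  have hh' : ∀ c (x : hyperbolic.points), ContDiffAt ℝ 1 (h' c) x := fun c x =>
    (ContDiffAt.mul (EuclideanSpace.proj c.succ : E4 →L[ℝ] ℝ).contDiff.contDiffAt
      (ContDiffAt.inv (EuclideanSpace.proj 0 : E4 →L[ℝ] ℝ).contDiff.contDiffAt (hne x))).mul (hh x)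
  have hc' : ∀ c, HasCompactSupport fun x : hyperbolic.points => h' c x := fun c =>
    hc.mul_left (f := fun x : hyperbolic.points => (x : E4) c.succ * ((x : E4) 0)⁻¹)
  have h6 : ∀ b : Fin 3, hyperbolic.met b.succ = -1 := fun b => by
    simp [met, coeff, sign, Fin.succ_ne_zero]
  have h7 : hyperbolic.met 0 = 1 := by simp [met, coeff, sign]
  have key : ∀ x : hyperbolic.points, fderiv ℝ h x (hyperbolic.rot a.succ b.succ x) =
      fderiv ℝ (h' b) x (hyperbolic.rot 0 a.succ x) -
      fderiv ℝ (h' a) x (hyperbolic.rot 0 b.succ x) := by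
    intro x
    have hx := hne x
    have hd : ∀ c, fderiv ℝ (h' c) x = _ := fun c => ((hd0 c x).mul
      ((hh x).differentiableAt one_ne_zero).hasFDerivAt).fderiv
    rw [hd, hd]
    have hab' : ¬ (a.succ : Fin 4) = b.succ := fun h => hab (Fin.succ_injective _ h)
    have hba' : ¬ (b.succ : Fin 4) = a.succ := fun h => hab (Fin.succ_injective _ h).symm
    simp [rot_apply, h6, h7, Fin.succ_ne_zero, hab', hba', (Fin.succ_ne_zero _).symm]
    field_simp
    ring
  simp only [key]
  have hint : ∀ c d, Integrable (fun x : hyperbolic.points =>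
      fderiv ℝ (h' c) x (hyperbolic.rot 0 d x)) hyperbolic.vol := fun c d =>
    (continuous_fderiv_apply (hh' c) _).integrable_of_hasCompactSupport
      (hasCompactSupport_fderiv_rot (hh' c) (hc' c) 0 d)
  rw [integral_sub (hint _ _) (hint _ _), integral_rot_zero_succ a (hh' b) (hc' b),
    integral_rot_zero_succ b (hh' a) (hc' a), sub_zero]

end Hyperboloid

/-- The source of all integrations by parts below: infinitesimal isometries are divergence-free and
compact support leaves no boundary term. -/
theorem integral_rot {G : Geometry} (a j : Fin 4) {h : E4 → ℝ}
    (hh : ∀ x : G.points, ContDiffAt ℝ 1 h x)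
    (hc : HasCompactSupport fun x : G.points => h x) :
    ∫ x : G.points, fderiv ℝ h x (G.rot a j x) ∂G.vol = 0 := by
  cases G with
  | spherical => exact integral_rot_spherical a j hh
  | hyperbolic =>
    rcases eq_or_ne a j with rfl | haj
    · simp [rot_self]
    induction a using Fin.cases with
    | zero =>
      induction j using Fin.cases with
      | zero => exact absurd rfl haj
      | succ b => exact integral_rot_zero_succ b hh hc
    | succ a =>
      induction j using Fin.cases with
      | zero =>
        rw [rot_swap]
        simp only [neg_apply, map_neg, integral_neg, neg_eq_zero]
        exact integral_rot_zero_succ a hh hc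
      | succ b => exact integral_rot_succ_succ (fun h => haj (by rw [h])) hh hc

/-! ### Integration against `nu`, and measures determined by moments. -/

theorem integral_nu (G : Geometry) (g : ℝ → ℝ) :
    ∫ c, g c ∂G.nu = ∫ c in G.dom, 4 * Real.pi * √(G.q c) * g c := by
  rw [nu, integral_withDensity_eq_integral_toReal_smul G.measurable_density
    (Eventually.of_forall fun _ => ENNReal.ofReal_lt_top)]
  refine integral_congr_ae (Eventually.of_forall fun c => ?_)
  simp only [smul_eq_mul]
  rw [ENNReal.toReal_ofReal (by positivity)]

theorem integrable_nu {G : Geometry} {g : ℝ → ℝ} :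
    Integrable g G.nu ↔ IntegrableOn (fun c => 4 * Real.pi * √(G.q c) * g c) G.dom := by
  rw [nu, integrable_withDensity_iff_integrable_smul' G.measurable_density
    (Eventually.of_forall fun _ => ENNReal.ofReal_lt_top), IntegrableOn]
  refine integrable_congr (Eventually.of_forall fun c => ?_)
  simp only [smul_eq_mul]
  rw [ENNReal.toReal_ofReal (by positivity)]

theorem ae_nu (G : Geometry) : ∀ᵐ c ∂G.nu, c ∈ G.dom :=
  (withDensity_absolutelyContinuous _ _).ae_le (ae_restrict_mem G.isOpen_dom.measurableSet)

/-- Finite measures on a compact interval are determined by their moments. -/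
theorem ext_of_moments {μ ν : Measure ℝ} [IsFiniteMeasure μ] [IsFiniteMeasure ν] {a b : ℝ}
    (hμ : ∀ᵐ x ∂μ, x ∈ Set.Icc a b) (hν : ∀ᵐ x ∂ν, x ∈ Set.Icc a b)
    (h : ∀ n : ℕ, ∫ x, x ^ n ∂μ = ∫ x, x ^ n ∂ν) : μ = ν := by
  have hint : ∀ (κ : Measure ℝ) [IsFiniteMeasure κ], (∀ᵐ x ∂κ, x ∈ Set.Icc a b) →
      ∀ f : ℝ → ℝ, Continuous f → Integrable f κ := by
    intro κ _ hκ f hf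
    obtain ⟨C, hC⟩ := isCompact_Icc.exists_bound_of_continuousOn (s := Set.Icc a b)
      hf.continuousOn
    exact Integrable.of_bound hf.aestronglyMeasurable C (hκ.mono fun x hx => hC x hx)
  have hpoly : ∀ p : Polynomial ℝ, ∫ x, p.eval x ∂μ = ∫ x, p.eval x ∂ν := by
    intro p
    simp only [Polynomial.eval_eq_sum_range]
    rw [integral_finsetSum, integral_finsetSum]
    · simp only [integral_const_mul, h]
    · exact fun i _ => hint ν hν _ (by fun_prop)
    · exact fun i _ => hint μ hμ _ (by fun_prop)
  refine ext_of_forall_integral_eq_of_IsFiniteMeasure fun f => ?_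
  refine eq_of_forall_dist_le fun ε hε => ?_
  rw [Real.dist_eq]
  -- A polynomial within ε/M of f changes the two integrals by at most ε in total. The summand 1
  -- keeps M positive when both measures vanish.
  set M := μ.real Set.univ + ν.real Set.univ + 1 with hM
  have hμ0 : 0 ≤ μ.real Set.univ := measureReal_nonneg
  have hν0 : 0 ≤ ν.real Set.univ := measureReal_nonneg
  have hMpos : 0 < M := by positivity
  obtain ⟨p, hp⟩ := exists_polynomial_near_of_continuousOn a b f f.continuous.continuousOn
    (ε / M) (by positivity)
  have key : ∀ (κ : Measure ℝ) [IsFiniteMeasure κ], (∀ᵐ x ∂κ, x ∈ Set.Icc a b) →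
      |∫ x, f x ∂κ - ∫ x, p.eval x ∂κ| ≤ ε / M * κ.real Set.univ := by
    intro κ _ hκ
    rw [← integral_sub (hint κ hκ f f.continuous) (hint κ hκ _ p.continuous), ← Real.norm_eq_abs]
    refine norm_integral_le_of_norm_le_const (hκ.mono fun x hx => ?_)
    rw [Real.norm_eq_abs, abs_sub_comm]
    exact (hp x hx).le
  have h1 := key μ hμ
  have h2 := key ν hν
  rw [hpoly] at h1
  have h3 : ε / M * μ.real Set.univ + ε / M * ν.real Set.univ ≤ ε := by
    rw [← mul_add, div_mul_eq_mul_div, div_le_iff₀ hMpos]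
    nlinarith
  rw [abs_le] at *
  constructor <;> linarith

/-! ### The distribution of ⟨x, y⟩ on the sphere, through its moments. -/

section SphereMoments

theorem spherical_met : spherical.met = fun _ => 1 := by
  funext i; simp [met, sign, coeff]

/-- This is the divergence theorem for the field cⁿ∇c with c = ⟨y, x⟩. It is obtained by summing
`integral_rot` for (x_a y_j - x_j y_a) cⁿ over all a and j; each coordinate plane occurs twice,
whence the factor 2 in `key`. -/
theorem sphere_moment_identity (y : spherical.points) (n : ℕ) :
    ∫ x : spherical.points, ((1 - spherical.form y x ^ 2) * (n * spherical.form y x ^ (n - 1))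
      - 3 * spherical.form y x * spherical.form y x ^ n) ∂spherical.vol = 0 := by
  have : CompactSpace spherical.points := isCompact_iff_compactSpace.1 (isCompact_sphere 0 1)
  let h : Fin 4 → Fin 4 → E4 → ℝ := fun a j x =>
    (x a * (y : E4) j - x j * (y : E4) a) * spherical.bil y x ^ n
  have hd : ∀ a j x, HasFDerivAt (h a j) (_ : E4 →L[ℝ] ℝ) x := fun a j x =>
    (((EuclideanSpace.proj a : E4 →L[ℝ] ℝ).hasFDerivAt.mul_const ((y : E4) j)).fun_sub
      ((EuclideanSpace.proj j : E4 →L[ℝ] ℝ).hasFDerivAt.mul_const ((y : E4) a))).fun_mul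
      ((hasDerivAt_pow n (spherical.bil y x)).comp_hasFDerivAt x (spherical.bil y).hasFDerivAt)
  have hc : ∀ a j (x : spherical.points), ContDiffAt ℝ 1 (h a j) x := fun a j x =>
    ((((EuclideanSpace.proj a : E4 →L[ℝ] ℝ).contDiff.mul contDiff_const).sub
      ((EuclideanSpace.proj j : E4 →L[ℝ] ℝ).contDiff.mul contDiff_const)).mul
      ((spherical.bil y).contDiff.pow n)).contDiffAt
  have h0 : ∀ a j, ∫ x : spherical.points, fderiv ℝ (h a j) x (spherical.rot a j x)
      ∂spherical.vol = 0 := fun a j => integral_rot a j (hc a j) (HasCompactSupport.of_compactSpace _)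
  have hint : ∀ a j, Integrable (fun x : spherical.points =>
      fderiv ℝ (h a j) x (spherical.rot a j x)) spherical.vol := fun a j =>
    (continuous_fderiv_apply (hc a j) _).integrable_of_hasCompactSupport
      (HasCompactSupport.of_compactSpace _)
  have hsum : ∫ x : spherical.points, ∑ a, ∑ j, fderiv ℝ (h a j) x (spherical.rot a j x)
      ∂spherical.vol = 0 := by
    rw [integral_finsetSum _ fun a _ => integrable_finsetSum _ fun j _ => hint a j]
    refine Finset.sum_eq_zero fun a _ => ?_
    rw [integral_finsetSum _ fun j _ => hint a j]
    exact Finset.sum_eq_zero fun j _ => h0 a j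
  have key : ∀ x : spherical.points, ∑ a, ∑ j, fderiv ℝ (h a j) x (spherical.rot a j x) =
      2 * ((1 - spherical.form y x ^ 2) * (n * spherical.form y x ^ (n - 1))
      - 3 * spherical.form y x * spherical.form y x ^ n) := by
    intro x
    have hx := form_self x.2
    have hy := form_self y.2
    have hyx := form_eq_sum spherical y x
    have hsum2 : ∀ a j, fderiv ℝ (h a j) x (spherical.rot a j x) =
        ((x : E4) a * (y : E4) j - (x : E4) j * (y : E4) a) ^ 2 *
          (n * spherical.form y x ^ (n - 1)) + spherical.form y x ^ n *
          (((x : E4) a * (if a = j then 1 else 0) - (x : E4) j) * (y : E4) j -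
            ((x : E4) a - (x : E4) j * (if j = a then 1 else 0)) * (y : E4) a) := by
      intro a j
      rw [(hd a j x).fderiv]
      have hbr : spherical.bil y (spherical.rot a j x) = _ :=
        (bil_apply _ _ _).trans (form_rot_right _ _ _ _ _)
      simp only [add_apply, smul_apply, sub_apply, hbr]
      simp only [bil_apply, spherical_met,
        PiLp.proj_apply, rot_apply, PiLp.sub_apply, PiLp.smul_apply, e_apply,
        smul_eq_mul, if_true]
      ring
    simp only [hsum2]
    generalize (n * spherical.form y x ^ (n - 1) : ℝ) = P
    generalize spherical.form y x ^ n = Q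
    generalize spherical.form y x = c at *
    simp only [form_eq_sum, spherical_met, Fin.sum_univ_four] at *
    simp
    subst hyx
    linear_combination 2 * P * (hx * ((y : E4) 0 ^ 2 + (y : E4) 1 ^ 2 + (y : E4) 2 ^ 2 + (y : E4) 3 ^ 2) + hy)
  simp only [key, integral_const_mul] at hsum
  linarith

theorem volume_sphere : spherical.vol Set.univ = ENNReal.ofReal (2 * Real.pi ^ 2) := by
  have h := Measure.toSphere_apply_univ (volume : Measure E4)
  refine h.trans ?_
  rw [InnerProductSpace.volume_ball_of_dim_even (k := 2) (by simp)]
  rw [ENNReal.ofReal_one, one_pow, one_mul, ← ENNReal.ofReal_natCast,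
    ← ENNReal.ofReal_mul (by positivity), finrank_euclideanSpace, Fintype.card_fin]
  congr 1
  norm_num [Nat.factorial]
  ring

theorem integral_Ioo_density (n : ℕ) :
    ∫ c, c ^ n ∂spherical.nu = ∫ c in (-1 : ℝ)..1, 4 * Real.pi * √(1 - c ^ 2) * c ^ n := by
  rw [integral_nu, intervalIntegral.integral_of_le (by norm_num), integral_Ioc_eq_integral_Ioo]
  simp [q, sign, dom]

/-- The integrand is the derivative of 4π(1 - c²)^(3/2) cⁿ, which vanishes at both ends. It is the
same relation as for the moments on the sphere. -/
theorem nu_moment_identity (n : ℕ) :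
    ∫ c in (-1 : ℝ)..1, 4 * Real.pi * √(1 - c ^ 2) *
      ((1 - c ^ 2) * (n * c ^ (n - 1)) - 3 * c * c ^ n) = 0 := by
  have h := intervalIntegral.integral_eq_sub_of_hasDerivAt_of_le (a := (-1 : ℝ)) (b := 1)
    (f := fun c => 4 * Real.pi * (√(1 - c ^ 2) * (1 - c ^ 2) * c ^ n))
    (f' := fun c => 4 * Real.pi * √(1 - c ^ 2) *
      ((1 - c ^ 2) * (n * c ^ (n - 1)) - 3 * c * c ^ n)) (by norm_num) (by fun_prop)
    (fun c hc => by
      have h1 : 0 < 1 - c ^ 2 := by nlinarith [hc.1, hc.2]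
      have h2 := Real.sqrt_pos.2 h1
      have h4 := Real.sq_sqrt h1.le
      have h3 : HasDerivAt (fun c : ℝ => 1 - c ^ 2) (-(2 * c)) c := by
        simpa using (hasDerivAt_pow 2 c).const_sub 1
      refine ((((h3.sqrt h1.ne').fun_mul h3).fun_mul (hasDerivAt_pow n c)).const_mul _).congr_deriv ?_
      field_simp
      rw [h4]
      ring)
    (Continuous.intervalIntegrable (by fun_prop) _ _)
  rw [h]; simp

/-- Both measures live on [-1, 1], have total mass 2π², and have moments with n m(n-1) = (n+3)
m(n+1). So all their moments agree, the first one being zero by the case n = 0. -/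
theorem lintegral_form_spherical (y : spherical.points) :
    Measure.map (fun x : spherical.points => spherical.form y x) spherical.vol = spherical.nu := by
  have hf : IsFiniteMeasure spherical.vol := inferInstanceAs (IsFiniteMeasure (Measure.toSphere _))
  have hm : Measurable fun x : spherical.points => spherical.form y x := by
    unfold form; fun_prop
  have hcont : Continuous fun x : spherical.points => spherical.form y x := by
    unfold form; fun_prop
  have hcpt : CompactSpace spherical.points := isCompact_iff_compactSpace.1 (isCompact_sphere 0 1)
  have hfin : IsFiniteMeasure spherical.nu := by
    refine ⟨?_⟩
    rw [nu, withDensity_apply _ MeasurableSet.univ, Measure.restrict_univ]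
    refine lt_of_le_of_lt (lintegral_mono (g := fun _ => ENNReal.ofReal (4 * Real.pi))
      fun c => ENNReal.ofReal_le_ofReal ?_) ?_
    · have : √(spherical.q c) ≤ 1 := Real.sqrt_le_one.2 (by simp [q, sign]; positivity)
      nlinarith [Real.pi_pos]
    · simp [dom, ENNReal.mul_lt_top]
  have h1 : ∀ n : ℕ, ∫ c, c ^ n ∂Measure.map (fun x : spherical.points => spherical.form y x)
      spherical.vol = ∫ x : spherical.points, spherical.form y x ^ n ∂spherical.vol := fun n =>
    integral_map hm.aemeasurable (by fun_prop)
  have hi : ∀ n : ℕ, Integrable (fun x : spherical.points => spherical.form y x ^ n)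
      spherical.vol := fun n =>
    (hcont.pow n).integrable_of_hasCompactSupport (HasCompactSupport.of_compactSpace _)
  have rec1 : ∀ n : ℕ, (n : ℝ) * ∫ x : spherical.points, spherical.form y x ^ (n - 1)
      ∂spherical.vol = (n + 3) * ∫ x : spherical.points, spherical.form y x ^ (n + 1)
      ∂spherical.vol := by
    intro n
    have h := sphere_moment_identity y n
    have h2 : ∀ x : spherical.points, (1 - spherical.form y x ^ 2) *
        (n * spherical.form y x ^ (n - 1)) - 3 * spherical.form y x * spherical.form y x ^ n =
        n * spherical.form y x ^ (n - 1) - (n + 3) * spherical.form y x ^ (n + 1) := by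
      intro x
      rcases n with - | n
      · simp
      · simp only [Nat.add_sub_cancel]; ring
    simp only [h2] at h
    rw [integral_sub ((hi _).const_mul _) ((hi _).const_mul _), integral_const_mul,
      integral_const_mul] at h
    linarith
  have hi2 : ∀ n : ℕ, IntervalIntegrable (fun c : ℝ => 4 * Real.pi * √(1 - c ^ 2) * c ^ n)
      volume (-1) 1 := fun n => Continuous.intervalIntegrable (by fun_prop) _ _
  have rec2 : ∀ n : ℕ, (n : ℝ) * ∫ c, c ^ (n - 1) ∂spherical.nu =
      (n + 3) * ∫ c, c ^ (n + 1) ∂spherical.nu := by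
    intro n
    have h := nu_moment_identity n
    have h2 : ∀ c : ℝ, 4 * Real.pi * √(1 - c ^ 2) *
      ((1 - c ^ 2) * (n * c ^ (n - 1)) - 3 * c * c ^ n) =
      n * (4 * Real.pi * √(1 - c ^ 2) * c ^ (n - 1)) -
        (n + 3) * (4 * Real.pi * √(1 - c ^ 2) * c ^ (n + 1)) := by
      intro c
      rcases n with - | n
      · simp; ring
      · simp only [Nat.add_sub_cancel]; ring
    simp only [h2] at h
    rw [intervalIntegral.integral_sub ((hi2 _).const_mul _) ((hi2 _).const_mul _),
      intervalIntegral.integral_const_mul, intervalIntegral.integral_const_mul] at h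
    rw [integral_Ioo_density, integral_Ioo_density]
    linarith
  have hmass : ∫ x : spherical.points, spherical.form y x ^ 0 ∂spherical.vol =
      ∫ c, c ^ 0 ∂spherical.nu := by
    rw [integral_Ioo_density]
    simp only [pow_zero, mul_one]
    rw [intervalIntegral.integral_const_mul, integral_sqrt_one_sub_sq, integral_const,
      Measure.real, volume_sphere, ENNReal.toReal_ofReal (by positivity)]
    simp; ring
  refine ext_of_moments (a := -1) (b := 1) ?_ ?_ fun n => ?_
  · refine (ae_map_iff hm.aemeasurable measurableSet_Icc).2 ?_
    exact Eventually.of_forall fun x => form_mem_rng (G := spherical) y.2 x.2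
  · exact (ae_nu spherical).mono fun c hc => spherical.dom_subset_rng hc
  · rw [h1]
    induction n using Nat.strong_induction_on with
    | _ n ih =>
      rcases n with - | n
      · exact hmass
      · have r1 := rec1 n
        have r2 := rec2 n
        -- For n = 0 the exponent n - 1 is truncated to 0, but the factor n removes the term.
        have h3 : (n : ℝ) * ∫ x : spherical.points, spherical.form y x ^ (n - 1) ∂spherical.vol =
            (n : ℝ) * ∫ c, c ^ (n - 1) ∂spherical.nu := by
          rcases n with - | n
          · simp
          · rw [Nat.add_sub_cancel, ih n (by omega)]
        have h4 : (n : ℝ) + 3 ≠ 0 := by positivity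
        rw [h3, r2] at r1
        exact (mul_left_cancel₀ h4 r1).symm

end SphereMoments

/-- The function `x ↦ ⟨x, y⟩` takes the Riemannian volume to `nu`. -/
theorem measurePreserving_form {G : Geometry} (y : G.points) :
    MeasurePreserving (fun x : G.points => G.form x y) G.vol G.nu := by
  refine ⟨G.measurable_form y, ?_⟩
  cases G with
  | spherical =>
    rw [← lintegral_form_spherical y]
    simp only [form_comm _ _ (y : E4)]
  | hyperbolic =>
    ext s hs
    rw [Measure.map_apply (hyperbolic.measurable_form (y : E4)) hs, ← lintegral_indicator_one hs,
      ← lintegral_form_hyperbolic y (measurable_one.indicator hs),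
      ← lintegral_indicator_one ((hyperbolic.measurable_form (y : E4)) hs)]
    rfl

theorem ae_form_mem_dom {G : Geometry} (y : G.points) :
    ∀ᵐ x : G.points ∂G.vol, G.form x y ∈ G.dom :=
  (measurePreserving_form y).quasiMeasurePreserving.ae G.ae_nu

/-! ### The kernel as a function of `⟨x, y⟩` -/

/-- The constant in the differential equation of the kernel. -/
def kap : Geometry → ℝ
  | spherical => 1 / (4 * Real.pi ^ 2)
  | hyperbolic => 0

/-- The kernel of the parallel transport formula, as a function of `⟨x, y⟩`. -/
def ker : Geometry → ℝ → ℝ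
  | spherical, u => -(1 / (4 * Real.pi ^ 2)) * (Real.arccos (-u) / √(1 - u ^ 2))
  | hyperbolic, u => -(1 / (4 * Real.pi)) / √(u ^ 2 - 1)

/-- The derivative of the kernel. -/
def ker1 (G : Geometry) (u : ℝ) : ℝ := (u * G.ker u - G.kap) / (1 - u ^ 2)

/-- The second derivative of the kernel. -/
def ker2 (G : Geometry) (u : ℝ) : ℝ := (3 * u * G.ker1 u + G.ker u) / (1 - u ^ 2)

theorem one_sub_sq_ne_zero {G : Geometry} {u : ℝ} (hu : u ∈ G.dom) : 1 - u ^ 2 ≠ 0 := by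
  have h := q_pos hu
  intro h0
  rw [q, h0, mul_zero] at h
  exact lt_irrefl _ h

theorem hasDerivAt_one_sub_sq (u : ℝ) : HasDerivAt (fun u : ℝ => 1 - u ^ 2) (-(2 * u)) u := by
  simpa using (hasDerivAt_pow 2 u).const_sub 1

/-- The kernel solves (1 - u²)k' = uk - κ with κ = `kap`. On S³ the constant comes from the
derivative of the arccosine, and it is the origin of the term with 1/4π² in the left-translation
formula. -/
theorem hasDerivAt_ker {G : Geometry} {u : ℝ} (hu : u ∈ G.dom) :
    HasDerivAt G.ker (G.ker1 u) u := by
  have h0 := hasDerivAt_one_sub_sq u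
  cases G with
  | spherical =>
    obtain ⟨h1, h2⟩ := hu
    have h3 : 0 < 1 - u ^ 2 := by nlinarith
    have h4 := Real.sqrt_pos.2 h3
    have h5 := Real.sq_sqrt h3.le
    have h6 : HasDerivAt (fun u => Real.arccos (-u)) (1 / √(1 - u ^ 2)) u := by
      have h7 := (Real.hasDerivAt_arccos (x := -u) (by linarith) (by linarith)).comp u
        (hasDerivAt_neg u)
      simpa [Function.comp_def] using! h7
    have h8 := ((h6.fun_div (h0.sqrt h3.ne') h4.ne').const_mul (-(1 / (4 * Real.pi ^ 2))))
    refine h8.congr_deriv ?_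
    simp only [ker1, ker, kap]
    rw [h5]
    have hpi := Real.pi_pos
    field_simp
    ring
  | hyperbolic =>
    have h1 : 1 < u := hu
    have h3 : 0 < u ^ 2 - 1 := by nlinarith
    have h4 := Real.sqrt_pos.2 h3
    have h5 := Real.sq_sqrt h3.le
    have h6 : HasDerivAt (fun u : ℝ => u ^ 2 - 1) (2 * u) u := by
      simpa using (hasDerivAt_pow 2 u).sub_const 1
    have h8 := (hasDerivAt_const u (-(1 / (4 * Real.pi)))).fun_div (h6.sqrt h3.ne') h4.ne'
    refine h8.congr_deriv ?_
    simp only [ker1, ker, kap]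
    have hpi := Real.pi_pos
    rw [h5, show 1 - u ^ 2 = -(u ^ 2 - 1) by ring]
    field_simp
    ring

/-- Differentiating (1 - u²)k' = uk - κ removes κ and gives (1 - u²)k'' = 3uk' + k on both spaces:
the radial form of (Δ - σ)k = 0. -/
theorem hasDerivAt_ker1 {G : Geometry} {u : ℝ} (hu : u ∈ G.dom) :
    HasDerivAt G.ker1 (G.ker2 u) u := by
  have h := one_sub_sq_ne_zero hu
  have h1 := (((hasDerivAt_id u).fun_mul (hasDerivAt_ker hu)).sub_const G.kap).fun_div
    (hasDerivAt_one_sub_sq u) h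
  refine h1.congr_deriv ?_
  simp only [ker2, id]
  have h2 : u * G.ker u - G.kap = (1 - u ^ 2) * G.ker1 u := by
    rw [ker1]; field_simp
  rw [h2]
  field_simp
  ring

theorem contDiffAt_ker {G : Geometry} {u : ℝ} (hu : u ∈ G.dom) {n : ℕ∞} :
    ContDiffAt ℝ n G.ker u := by
  cases G with
  | spherical =>
    obtain ⟨h1, h2⟩ := hu
    have h3 : 0 < 1 - u ^ 2 := by nlinarith
    have h4 : ContDiffAt ℝ n (fun u => Real.arccos (-u)) u :=
      ContDiffAt.comp (g := Real.arccos) (f := fun u => -u) u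
        (Real.contDiffAt_arccos (by linarith) (by linarith)) contDiffAt_id.neg
    exact contDiffAt_const.mul (h4.div (ContDiffAt.sqrt (by fun_prop) h3.ne')
      (Real.sqrt_pos.2 h3).ne')
  | hyperbolic =>
    have h1 : 1 < u := hu
    have h3 : 0 < u ^ 2 - 1 := by nlinarith
    exact contDiffAt_const.div (ContDiffAt.sqrt (by fun_prop) h3.ne') (Real.sqrt_pos.2 h3).ne'

theorem contDiffAt_ker1 {G : Geometry} {u : ℝ} (hu : u ∈ G.dom) {n : ℕ∞} :
    ContDiffAt ℝ n G.ker1 u :=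
  ((contDiffAt_id.mul (contDiffAt_ker hu)).sub contDiffAt_const).div (by fun_prop)
    (one_sub_sq_ne_zero hu)

theorem contDiffAt_ker2 {G : Geometry} {u : ℝ} (hu : u ∈ G.dom) {n : ℕ∞} :
    ContDiffAt ℝ n G.ker2 u :=
  (((contDiffAt_const.mul contDiffAt_id).mul (contDiffAt_ker1 hu)).add (contDiffAt_ker hu)).div
    (by fun_prop) (one_sub_sq_ne_zero hu)

theorem continuousOn_ker (G : Geometry) : ContinuousOn G.ker G.dom := fun _ hu =>
  (contDiffAt_ker (n := 0) hu).continuousAt.continuousWithinAt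

theorem continuousOn_ker1 (G : Geometry) : ContinuousOn G.ker1 G.dom := fun _ hu =>
  (contDiffAt_ker1 (n := 0) hu).continuousAt.continuousWithinAt

theorem continuousOn_ker2 (G : Geometry) : ContinuousOn G.ker2 G.dom := fun _ hu =>
  (contDiffAt_ker2 (n := 0) hu).continuousAt.continuousWithinAt

theorem abs_one_sub_sq {G : Geometry} {u : ℝ} (hu : u ∈ G.rng) : |1 - u ^ 2| = G.q u := by
  have h := q_nonneg hu
  cases G <;> simp only [q, sign] at *
  · rw [abs_of_nonneg (by linarith)]; ring
  · rw [abs_of_nonpos (by linarith)]; ring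

/-- A crude bound, uniform in both geometries. On S³ the singularity at u = -1 is actually
removable, but this is not needed for integrability. -/
theorem abs_ker_le {G : Geometry} {u : ℝ} (hu : u ∈ G.dom) : |G.ker u| ≤ 1 / √(G.q u) := by
  have h := Real.sqrt_pos.2 (q_pos hu)
  have hpi := Real.pi_gt_three
  cases G with
  | spherical =>
    have h1 : spherical.q u = 1 - u ^ 2 := by simp [q, sign]
    rw [h1] at h ⊢
    rw [ker, abs_mul, abs_neg, abs_of_pos (show 0 < 1 / (4 * Real.pi ^ 2) by positivity),
      abs_div, abs_of_pos h, abs_of_nonneg (Real.arccos_nonneg _), ← mul_div_assoc]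
    gcongr
    have h2 := Real.arccos_le_pi (-u)
    have h3 : 1 / (4 * Real.pi ^ 2) * Real.arccos (-u) ≤ 1 / (4 * Real.pi ^ 2) * Real.pi := by
      gcongr
    refine h3.trans ?_
    rw [one_div, inv_mul_le_iff₀ (by positivity)]
    nlinarith
  | hyperbolic =>
    have h1 : hyperbolic.q u = u ^ 2 - 1 := by simp [q, sign]
    rw [h1] at h ⊢
    rw [ker, abs_div, abs_neg, abs_of_pos h, abs_of_pos (by positivity)]
    gcongr
    rw [div_le_one (by positivity)]
    linarith

theorem abs_ker1_le {G : Geometry} {u : ℝ} (hu : u ∈ G.dom) :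
    |G.ker1 u| ≤ (|u| + 1) / (√(G.q u) * G.q u) := by
  have h := Real.sqrt_pos.2 (q_pos hu)
  have h0 := q_pos hu
  rw [ker1, abs_div, abs_one_sub_sq (G.dom_subset_rng hu), ← div_div]
  gcongr
  have h1 : |u * G.ker u| ≤ |u| / √(G.q u) := by
    rw [abs_mul, div_eq_mul_one_div]
    gcongr
    exact abs_ker_le hu
  have h2 : |G.kap| ≤ 1 / √(G.q u) := by
    have hpi := Real.pi_gt_three
    cases G with
    | spherical =>
      have h3 : √(spherical.q u) ≤ 1 := Real.sqrt_le_one.2 (by simp [q, sign]; positivity)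
      rw [kap, abs_of_pos (by positivity)]
      refine one_div_le_one_div_of_le h ?_
      nlinarith
    | hyperbolic => simp only [kap, abs_zero]; positivity
  rw [add_div]
  exact (abs_sub _ _).trans (add_le_add h1 h2)

theorem mul_cos_le_sin {t : ℝ} (h0 : 0 ≤ t) (h1 : t ≤ Real.pi) :
    t * Real.cos t ≤ Real.sin t := by
  have hmono : MonotoneOn (fun t => Real.sin t - t * Real.cos t) (Set.Icc 0 Real.pi) := by
    refine monotoneOn_of_hasDerivWithinAt_nonneg (f' := fun t => t * Real.sin t)
      (convex_Icc _ _) (by fun_prop) (fun t _ => ?_) fun t ht => ?_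
    · refine HasDerivAt.hasDerivWithinAt (((Real.hasDerivAt_sin t).fun_sub
        ((hasDerivAt_id t).fun_mul (Real.hasDerivAt_cos t))).congr_deriv ?_)
      simp
    · rw [interior_Icc] at ht
      exact mul_nonneg ht.1.le (Real.sin_nonneg_of_mem_Icc ⟨ht.1.le, ht.2.le⟩)
  have := hmono ⟨le_rfl, Real.pi_pos.le⟩ ⟨h0, h1⟩ h0
  simp at this
  linarith

/-- The difference of the two sides vanishes at 0 and has derivative 4 sin t (sin t - t cos t),
which is nonnegative by `mul_cos_le_sin`. This is the sign of the second derivative of the spherical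
kernel. -/
theorem three_mul_sin_mul_cos_le {t : ℝ} (h0 : 0 ≤ t) (h1 : t ≤ Real.pi) :
    3 * Real.sin t * Real.cos t ≤ t * (1 + 2 * Real.cos t ^ 2) := by
  have hmono : MonotoneOn (fun t => t * (1 + 2 * Real.cos t ^ 2) - 3 * Real.sin t * Real.cos t)
      (Set.Icc 0 Real.pi) := by
    refine monotoneOn_of_hasDerivWithinAt_nonneg
      (f' := fun t => 4 * Real.sin t * (Real.sin t - t * Real.cos t))
      (convex_Icc _ _) (by fun_prop) (fun t _ => ?_) fun t ht => ?_
    · refine HasDerivAt.hasDerivWithinAt ((((hasDerivAt_id t).fun_mul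
        ((((Real.hasDerivAt_cos t).fun_pow 2).const_mul 2).const_add 1)).fun_sub
        (((Real.hasDerivAt_sin t).const_mul 3).fun_mul (Real.hasDerivAt_cos t))).congr_deriv ?_)
      have := Real.sin_sq_add_cos_sq t
      simp
      linear_combination -this
    · rw [interior_Icc] at ht
      have h2 := Real.sin_nonneg_of_mem_Icc ⟨ht.1.le, ht.2.le⟩
      have h3 := mul_cos_le_sin ht.1.le ht.2.le
      exact mul_nonneg (by positivity) (by linarith)
  have := hmono ⟨le_rfl, Real.pi_pos.le⟩ ⟨h0, h1⟩ h0
  simp at this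
  linarith

/-- This sign makes the approximate identity `delta` nonnegative. On S³ put t = arccos(-u), so that
cos t = -u and sin t = √(1 - u²); then it is the preceding trigonometric inequality. -/
theorem ker2_nonpos {G : Geometry} {u : ℝ} (hu : u ∈ G.dom) : G.ker2 u ≤ 0 := by
  have hpi := Real.pi_pos
  cases G with
  | spherical =>
    obtain ⟨h1, h2⟩ := hu
    have h3 : 0 < 1 - u ^ 2 := by nlinarith
    have h4 := Real.sqrt_pos.2 h3
    have h5 := Real.sq_sqrt h3.le
    set t := Real.arccos (-u) with ht
    have hc : Real.cos t = -u := Real.cos_arccos (by linarith) (by linarith)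
    have hs : Real.sin t = √(1 - u ^ 2) := by rw [ht, Real.sin_arccos, neg_sq]
    have h6 := three_mul_sin_mul_cos_le (Real.arccos_nonneg (-u)) (Real.arccos_le_pi (-u))
    rw [← ht, hc, hs] at h6
    have h7 : spherical.ker2 u = -(1 / (4 * Real.pi ^ 2)) *
        ((t * (1 + 2 * u ^ 2) + 3 * √(1 - u ^ 2) * u) / (√(1 - u ^ 2) * (1 - u ^ 2) ^ 2)) := by
      simp only [ker2, ker1, ker, kap, ← ht]
      field_simp
      ring
    rw [h7]
    have h8 : 0 ≤ t * (1 + 2 * u ^ 2) + 3 * √(1 - u ^ 2) * u := by nlinarith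
    have h9 : 0 ≤ 1 / (4 * Real.pi ^ 2) *
        ((t * (1 + 2 * u ^ 2) + 3 * √(1 - u ^ 2) * u) / (√(1 - u ^ 2) * (1 - u ^ 2) ^ 2)) := by
      positivity
    linarith
  | hyperbolic =>
    have h1 : 1 < u := hu
    have h3 : 0 < u ^ 2 - 1 := by nlinarith
    have h4 := Real.sqrt_pos.2 h3
    have h7 : hyperbolic.ker2 u = -(1 / (4 * Real.pi)) *
        ((2 * u ^ 2 + 1) / (√(u ^ 2 - 1) * (u ^ 2 - 1) ^ 2)) := by
      simp only [ker2, ker1, ker, kap]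
      rw [show 1 - u ^ 2 = -(u ^ 2 - 1) by ring]
      field_simp
      ring
    rw [h7]
    have h9 : 0 ≤ 1 / (4 * Real.pi) *
        ((2 * u ^ 2 + 1) / (√(u ^ 2 - 1) * (u ^ 2 - 1) ^ 2)) := by
      positivity
    linarith

theorem phiTransport_dist {G : Geometry} {x y : E4} (hx : x ∈ G.points) (hy : y ∈ G.points) :
    G.phiTransport (G.dist x y) = G.ker (G.form x y) := by
  have h := form_mem_rng hx hy
  cases G with
  | spherical =>
    simp only [phiTransport, dist, ker, Real.arccos_neg, Real.sin_arccos]; ring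
  | hyperbolic =>
    simp only [phiTransport, dist, ker]
    rw [Real.sinh_arcosh h]; ring

/-- The additive constant in the fundamental solution of the scalar Laplacian. -/
def phi0Const : Geometry → ℝ
  | spherical => 0
  | hyperbolic => 1 / (4 * Real.pi)

/-- From cot α = cos α csc α and coth α = cosh α csch α. This relation between the two kernels is
what identifies the gradient term in Maxwell's equation. -/
theorem phi0_dist {G : Geometry} {x y : E4} (hx : x ∈ G.points) (hy : y ∈ G.points) :
    G.phi0 (G.dist x y) = G.form x y * G.ker (G.form x y) + G.phi0Const := by
  have h := form_mem_rng hx hy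
  cases G with
  | spherical =>
    simp only [phi0, dist, ker, Real.arccos_neg, Real.cot_eq_cos_div_sin, Real.sin_arccos,
      Real.cos_arccos h.1 h.2, phi0Const]
    ring
  | hyperbolic =>
    simp only [phi0, dist, ker, phi0Const]
    rw [Real.sinh_arcosh h, Real.cosh_arcosh h]; ring

/-- The reason for the choice of φ₁: the last integrand of the left-translation formula involves the
same kernel `ker`. -/
theorem hasDerivAt_phi1_arccos {u : ℝ} (hu : u ∈ spherical.dom) :
    HasDerivAt (fun u => phi1 (Real.arccos u)) (-(1 / 2) * spherical.ker u) u := by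
  obtain ⟨h1, h2⟩ := hu
  have h3 : 0 < 1 - u ^ 2 := by nlinarith
  have h4 := Real.sqrt_pos.2 h3
  have h5 := Real.hasDerivAt_arccos (x := u) (by linarith) (by linarith)
  have hpi := Real.pi_pos
  refine ((h5.fun_mul (h5.const_sub (2 * Real.pi))).const_mul (-1 / (16 * Real.pi ^ 2))
    ).congr_deriv ?_
  simp only [ker, Real.arccos_neg]
  field_simp
  ring

/-! ### Regularization of the kernel -/

/-- The scaling factors of the regularized kernels `c ↦ ker (lam n * c)`. -/
def lam (G : Geometry) (n : ℕ) : ℝ := 1 - G.sign / (n + 2)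

theorem tendsto_lam (G : Geometry) : Tendsto G.lam atTop (𝓝 1) := by
  have h : Tendsto (fun n : ℕ => G.sign / ((n : ℝ) + 2)) atTop (𝓝 0) :=
    Tendsto.div_atTop tendsto_const_nhds
      (tendsto_atTop_add_const_right _ _ tendsto_natCast_atTop_atTop)
  have h1 := h.const_sub 1
  rwa [sub_zero] at h1

theorem inv_add_two_mem (n : ℕ) : 0 < 1 / ((n : ℝ) + 2) ∧ 1 / ((n : ℝ) + 2) ≤ 1 / 2 := by
  refine ⟨by positivity, one_div_le_one_div_of_le (by norm_num) ?_⟩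
  have : (0 : ℝ) ≤ n := Nat.cast_nonneg n
  linarith

theorem lam_mem (G : Geometry) (n : ℕ) : 1 / 2 ≤ G.lam n ∧ G.lam n ≤ 3 / 2 := by
  obtain ⟨h1, h2⟩ := inv_add_two_mem n
  cases G
  · rw [lam, sign]; constructor <;> linarith
  · rw [lam, sign, neg_div]; constructor <;> linarith

theorem sign_mul_lam_sq_sub_one_nonpos (G : Geometry) (n : ℕ) :
    G.sign * (G.lam n ^ 2 - 1) ≤ 0 := by
  obtain ⟨h1, h2⟩ := inv_add_two_mem n
  cases G
  · rw [lam, sign]; nlinarith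
  · rw [lam, sign, neg_div]; nlinarith

/-- Since λₙ < 1 on S³ and λₙ > 1 on H³, scaling moves every value of ⟨x, y⟩ off the singularities
±1, respectively 1. So the regularised kernels are smooth everywhere. The denominator n + 2 keeps λₙ
between 1/2 and 3/2 from n = 0 on. -/
theorem lam_mul_mem_dom {G : Geometry} {c : ℝ} (hc : c ∈ G.rng) (n : ℕ) :
    G.lam n * c ∈ G.dom := by
  obtain ⟨h1, h2⟩ := inv_add_two_mem n
  cases G with
  | spherical =>
    obtain ⟨h3, h4⟩ := hc
    rw [lam, sign]; constructor <;> nlinarith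
  | hyperbolic =>
    have h3 : 1 ≤ c := hc
    show (1 : ℝ) < hyperbolic.lam n * c
    rw [lam, sign, neg_div]; nlinarith

/-- Bounds by negative powers of q at λₙc are therefore bounds by the same powers at c, uniformly in
n. -/
theorem q_le_q_lam_mul {G : Geometry} (c : ℝ) (n : ℕ) : G.q c ≤ G.q (G.lam n * c) := by
  have h := G.sign_mul_lam_sq_sub_one_nonpos n
  rw [q, q]
  nlinarith [mul_nonneg (neg_nonneg.2 h) (sq_nonneg c)]

/-- The Laplacian with mass term applied to the regularized kernel: an approximate identity. -/
def delta (G : Geometry) (n : ℕ) (c : ℝ) : ℝ :=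
  G.sign * (G.lam n ^ 2 - 1) * G.ker2 (G.lam n * c)

theorem delta_nonneg {G : Geometry} {c : ℝ} (hc : c ∈ G.rng) (n : ℕ) : 0 ≤ G.delta n c :=
  mul_nonneg_of_nonpos_of_nonpos (G.sign_mul_lam_sq_sub_one_nonpos n)
    (ker2_nonpos (lam_mul_mem_dom hc n))

/-- Subtract the differential equation of the kernel at u = λₙc from (Δ - σ) ker(λₙc). Only the
second derivative survives, with factor λₙ² - 1, since 1 - c² is multiplied by λₙ² while the
equation has 1 - λₙ²c². -/
theorem delta_eq {G : Geometry} {c : ℝ} (hc : c ∈ G.rng) (n : ℕ) :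
    G.delta n c = G.sign * ((1 - c ^ 2) * (G.lam n ^ 2 * G.ker2 (G.lam n * c))
      - 3 * c * (G.lam n * G.ker1 (G.lam n * c)) - G.ker (G.lam n * c)) := by
  have h := one_sub_sq_ne_zero (lam_mul_mem_dom hc n)
  have h1 : (1 - (G.lam n * c) ^ 2) * G.ker2 (G.lam n * c) =
      3 * (G.lam n * c) * G.ker1 (G.lam n * c) + G.ker (G.lam n * c) := by
    rw [ker2]; exact mul_div_cancel₀ _ h
  rw [delta]
  linear_combination (-G.sign) * h1

theorem continuousOn_comp_lam {G : Geometry} {g : ℝ → ℝ} (hg : ContinuousOn g G.dom) (n : ℕ) :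
    ContinuousOn (fun c => g (G.lam n * c)) G.rng :=
  hg.comp (by fun_prop) fun _ hc => lam_mul_mem_dom hc n

theorem tendsto_comp_lam {G : Geometry} {g : ℝ → ℝ} (hg : ContinuousOn g G.dom) {c : ℝ}
    (hc : c ∈ G.dom) : Tendsto (fun n => g (G.lam n * c)) atTop (𝓝 (g c)) := by
  have h1 : Tendsto (fun n => G.lam n * c) atTop (𝓝 c) := by
    simpa using G.tendsto_lam.mul_const c
  exact (hg.continuousAt (G.isOpen_dom.mem_nhds hc)).tendsto.comp h1

theorem abs_le_of_mem_rng {G : Geometry} {c M : ℝ} (hc : c ∈ G.rng) (hM : c ≤ M) :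
    |c| ≤ 1 + |M| := by
  have h := le_abs_self M
  have h' := abs_nonneg M
  cases G with
  | spherical => obtain ⟨h3, h4⟩ := hc; rw [abs_le]; constructor <;> linarith
  | hyperbolic => have h3 : 1 ≤ c := hc; rw [abs_of_nonneg (by linarith)]; linarith

theorem q_le {G : Geometry} {c M : ℝ} (hc : c ∈ G.rng) (hM : c ≤ M) :
    G.q c ≤ (1 + |M|) ^ 2 := by
  have h1 := abs_le_of_mem_rng hc hM
  have h2 : c ^ 2 ≤ (1 + |M|) ^ 2 := by rw [← sq_abs c]; gcongr
  have h' := abs_nonneg M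
  cases G <;> rw [q, sign] <;> nlinarith

/-- For c ≤ M the value q is bounded, so the milder singularity q^(-1/2) is dominated by q⁻¹. The
single function q⁻¹ then dominates both the kernel and its gradient. -/
theorem one_div_sqrt_q_le {G : Geometry} {c M : ℝ} (hc : c ∈ G.dom) (hM : c ≤ M) :
    1 / √(G.q c) ≤ (1 + |M|) * (G.q c)⁻¹ := by
  have h := q_pos hc
  have h0 := Real.sqrt_pos.2 h
  have h1 : √(G.q c) ≤ 1 + |M| :=
    (Real.sqrt_le_left (by positivity)).2 (q_le (G.dom_subset_rng hc) hM)
  have h2 := Real.mul_self_sqrt h.le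
  rw [one_div, inv_le_iff_one_le_mul₀ h0]
  rw [mul_assoc]
  nth_rw 1 [← h2]
  rw [mul_inv, mul_assoc, inv_mul_cancel₀ h0.ne', mul_one, ← div_eq_mul_inv, one_le_div h0]
  exact h1

theorem abs_ker_lam_le {G : Geometry} {c : ℝ} (hc : c ∈ G.dom) (n : ℕ) :
    |G.ker (G.lam n * c)| ≤ 1 / √(G.q c) := by
  refine (abs_ker_le (lam_mul_mem_dom (G.dom_subset_rng hc) n)).trans ?_
  exact one_div_le_one_div_of_le (Real.sqrt_pos.2 (q_pos hc))
    (Real.sqrt_le_sqrt (q_le_q_lam_mul c n))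

/-- The argument u is kept general so as to cover both u = c and u = λₙc; the factor 2 leaves room
for λₙ ≤ 3/2. -/
theorem abs_ker1_mul_le {G : Geometry} {c M : ℝ} (hc : c ∈ G.dom) (hM : c ≤ M) {u : ℝ}
    (hu : u ∈ G.dom) (h : |u| ≤ 2 * |c|) (hq : G.q c ≤ G.q u) :
    |G.ker1 u| * √(G.q c) ≤ 3 * (1 + |M|) * (G.q c)⁻¹ := by
  have h0 := q_pos hc
  have h1 := Real.sqrt_pos.2 h0
  have h2 := abs_le_of_mem_rng (G.dom_subset_rng hc) hM
  have h3 : |G.ker1 u| ≤ 3 * (1 + |M|) / (√(G.q c) * G.q c) := by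
    refine (abs_ker1_le hu).trans ?_
    have h' := abs_nonneg M
    gcongr
    linarith
  calc _ ≤ 3 * (1 + |M|) / (√(G.q c) * G.q c) * √(G.q c) := by gcongr
    _ = _ := by field_simp

theorem abs_ker1_lam_mul_le {G : Geometry} {c M : ℝ} (hc : c ∈ G.dom) (hM : c ≤ M) (n : ℕ) :
    |G.ker1 (G.lam n * c)| * √(G.q c) ≤ 3 * (1 + |M|) * (G.q c)⁻¹ := by
  refine abs_ker1_mul_le hc hM (lam_mul_mem_dom (G.dom_subset_rng hc) n) ?_ (q_le_q_lam_mul c n)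
  have h := G.lam_mem n
  rw [abs_mul, abs_of_pos (by linarith)]
  gcongr
  linarith

theorem abs_ker1_mul_sqrt_le {G : Geometry} {c M : ℝ} (hc : c ∈ G.dom) (hM : c ≤ M) :
    |G.ker1 c| * √(G.q c) ≤ 3 * (1 + |M|) * (G.q c)⁻¹ :=
  abs_ker1_mul_le hc hM hc (by linarith [abs_nonneg c]) le_rfl

theorem aestronglyMeasurable_nu {G : Geometry} {g : ℝ → ℝ} (hg : ContinuousOn g G.dom) :
    AEStronglyMeasurable g G.nu :=
  (hg.aestronglyMeasurable G.isOpen_dom.measurableSet).mono_ac (withDensity_absolutelyContinuous _ _)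

/-! ### One-dimensional integrals over the values c ≤ M; on S³ the cutoff M > 1 has no effect. -/

/-- The left endpoint of the interval of integration. -/
def lo : Geometry → ℝ
  | spherical => -1
  | hyperbolic => 1

/-- The right endpoint of the interval of integration. -/
def hi : Geometry → ℝ → ℝ
  | spherical, _ => 1
  | hyperbolic, M => M

theorem lo_le_hi (G : Geometry) {M : ℝ} (hM : 1 < M) : G.lo ≤ G.hi M := by
  cases G
  · norm_num [lo, hi]
  · exact hM.le

theorem dom_inter_Iic (G : Geometry) {M : ℝ} (hM : 1 < M) :
    (G.dom ∩ Set.Iic M : Set ℝ) =ᵐ[volume] Set.Ioc G.lo (G.hi M) := by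
  cases G with
  | spherical =>
    have : spherical.dom ∩ Set.Iic M = Set.Ioo (-1) 1 := by
      ext c; simp only [dom, Set.mem_inter_iff, Set.mem_Ioo, Set.mem_Iic]
      exact ⟨fun h => h.1, fun h => ⟨h, by linarith [h.2]⟩⟩
    rw [this]; exact Ioo_ae_eq_Ioc
  | hyperbolic => rfl

theorem Icc_subset_rng (G : Geometry) {M : ℝ} : Set.Icc G.lo (G.hi M) ⊆ G.rng := by
  cases G
  · exact subset_rfl
  · exact Set.Icc_subset_Ici_self

theorem Ioo_subset_dom (G : Geometry) {M : ℝ} : Set.Ioo G.lo (G.hi M) ⊆ G.dom := by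
  cases G
  · exact subset_rfl
  · exact Set.Ioo_subset_Ioi_self

theorem setIntegral_nu (G : Geometry) {M : ℝ} (hM : 1 < M) (g : ℝ → ℝ) :
    ∫ c in Set.Iic M, g c ∂G.nu = ∫ c in G.lo..G.hi M, 4 * Real.pi * √(G.q c) * g c := by
  rw [← integral_indicator measurableSet_Iic, integral_nu,
    intervalIntegral.integral_of_le (G.lo_le_hi hM), ← setIntegral_congr_set (G.dom_inter_Iic hM),
    ← setIntegral_indicator measurableSet_Iic]
  congr 1
  funext c
  simp only [Set.indicator]
  split_ifs <;> simp

theorem integrableOn_nu {G : Geometry} {M : ℝ} (hM : 1 < M) {g : ℝ → ℝ} :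
    IntegrableOn g (Set.Iic M) G.nu ↔
      IntegrableOn (fun c => 4 * Real.pi * √(G.q c) * g c) (Set.Ioc G.lo (G.hi M)) := by
  have h : IntegrableOn (fun c => 4 * Real.pi * √(G.q c) * g c) (Set.Iic M ∩ G.dom) ↔
      IntegrableOn (fun c => 4 * Real.pi * √(G.q c) * g c) (Set.Iic M) (volume.restrict G.dom) := by
    rw [IntegrableOn, IntegrableOn, Measure.restrict_restrict measurableSet_Iic]
  rw [← integrableOn_congr_set_ae (G.dom_inter_Iic hM), Set.inter_comm, h,
    ← integrable_indicator_iff measurableSet_Iic, integrable_nu,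
    ← integrable_indicator_iff measurableSet_Iic, IntegrableOn]
  refine iff_of_eq (congrArg (fun f => Integrable f _) ?_)
  funext c
  simp only [Set.indicator]
  split_ifs <;> simp

/-- The integrand is the nonnegative derivative of arcsin, respectively arcosh, both continuous up
to the endpoints. -/
theorem integrableOn_one_div_sqrt_q (G : Geometry) {M : ℝ} :
    IntegrableOn (fun c => 1 / √(G.q c)) (Set.Ioc G.lo (G.hi M)) := by
  cases G with
  | spherical =>
    refine intervalIntegral.integrableOn_deriv_of_nonneg (g := Real.arcsin)
      Real.continuous_arcsin.continuousOn (fun c hc => ?_) fun c _ => by positivity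
    have h := Real.hasDerivAt_arcsin (x := c) hc.1.ne' hc.2.ne
    simpa [q, sign] using h
  | hyperbolic =>
    refine intervalIntegral.integrableOn_deriv_of_nonneg (g := Real.arcosh)
      (Real.continuousOn_arcosh.mono Set.Icc_subset_Ici_self) (fun c hc => ?_)
      fun c _ => by positivity
    have h := Real.hasDerivAt_arcosh (x := c) hc.1
    simpa [q, sign] using h

/-- The density √q of `nu` reduces q⁻¹ to q^(-1/2). -/
theorem integrableOn_inv_q (G : Geometry) {M : ℝ} (hM : 1 < M) :
    IntegrableOn (fun c => (G.q c)⁻¹) (Set.Iic M) G.nu := by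
  rw [integrableOn_nu hM]
  refine ((G.integrableOn_one_div_sqrt_q (M := M)).const_mul (4 * Real.pi)).congr ?_
  refine Eventually.of_forall fun c => ?_
  simp only
  rw [← Real.sqrt_div_self', div_eq_mul_inv, ← mul_assoc]

theorem tendsto_integral_ker_sub (G : Geometry) {M : ℝ} (hM : 1 < M) :
    Tendsto (fun n => ∫ c in Set.Iic M, |G.ker (G.lam n * c) - G.ker c| ∂G.nu) atTop (𝓝 0) := by
  have h := tendsto_integral_of_dominated_convergence (μ := G.nu.restrict (Set.Iic M))
    (F := fun n c => |G.ker (G.lam n * c) - G.ker c|) (f := fun _ => (0 : ℝ))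
    (fun c => 2 * ((1 + |M|) * (G.q c)⁻¹))
    (fun n => ((aestronglyMeasurable_nu
      (((continuousOn_comp_lam G.continuousOn_ker n).mono G.dom_subset_rng).sub
        G.continuousOn_ker)).norm).mono_measure Measure.restrict_le_self)
    (((G.integrableOn_inv_q hM).const_mul _).const_mul _)
    (fun n => by
      filter_upwards [ae_restrict_of_ae G.ae_nu, ae_restrict_mem measurableSet_Iic] with c hc hcM
      rw [Real.norm_eq_abs, abs_abs, two_mul]
      refine (abs_sub _ _).trans (add_le_add ?_ ?_)
      · exact (abs_ker_lam_le hc n).trans (one_div_sqrt_q_le hc hcM)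
      · exact (abs_ker_le hc).trans (one_div_sqrt_q_le hc hcM))
    (by
      filter_upwards [ae_restrict_of_ae G.ae_nu] with c hc
      have h1 := ((tendsto_comp_lam G.continuousOn_ker hc).sub_const (G.ker c)).abs
      simpa using h1)
  simpa using h

/-! ### The regularized Laplacian of the kernel is an approximate identity -/

theorem hasDerivAt_q (G : Geometry) (c : ℝ) : HasDerivAt G.q (-(2 * G.sign * c)) c := by
  have h := (hasDerivAt_one_sub_sq c).const_mul G.sign
  have h1 : G.q = fun c => G.sign * (1 - c ^ 2) := by funext c; rw [q]
  rw [h1]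
  exact h.congr_deriv (by ring)

theorem hasDerivAt_sqrt_q_mul_q {G : Geometry} {c : ℝ} (hc : c ∈ G.dom) :
    HasDerivAt (fun c => √(G.q c) * G.q c) (-(3 * G.sign * c * √(G.q c))) c := by
  have h := ((G.hasDerivAt_q c).sqrt (q_pos hc).ne').fun_mul (G.hasDerivAt_q c)
  refine h.congr_deriv ?_
  have h0 := (Real.sqrt_pos.2 (q_pos hc)).ne'
  have h1 := Real.mul_self_sqrt (q_pos hc).le
  rw [div_mul_eq_mul_div, eq_comm, div_add' _ _ _ (by positivity), eq_div_iff (by positivity)]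
  linear_combination (-2 * G.sign * c) * h1

/-- An antiderivative used to integrate the approximate identity against affine functions. -/
def deltaPrim (G : Geometry) (n : ℕ) (a b c : ℝ) : ℝ :=
  √(G.q c) * G.q c * (G.lam n * G.ker1 (G.lam n * c) * (a + b * c) - G.ker (G.lam n * c) * b)

theorem hasDerivAt_comp_lam {G : Geometry} {g : ℝ → ℝ} {g' : ℝ} {n : ℕ} {c : ℝ}
    (h : HasDerivAt g g' (G.lam n * c)) :
    HasDerivAt (fun c => g (G.lam n * c)) (G.lam n * g') c := by
  have h1 : HasDerivAt (fun c => G.lam n * c) (G.lam n) c := by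
    simpa using (hasDerivAt_id c).const_mul (G.lam n)
  have h2 := HasDerivAt.comp c h h1
  rwa [mul_comm] at h2

/-- Green's identity in one variable. For Lk = σ((1 - c²)k'' - 3ck' - k), the expression √q (g Lk -
k Lg) is the derivative of q^(3/2) (k'g - kg'). Here k = ker(λₙc), g = a + bc, and Lg = -σ(a + 4bc).
-/
theorem hasDerivAt_deltaPrim {G : Geometry} {c : ℝ} (hc : c ∈ G.dom) (n : ℕ) (a b : ℝ) :
    HasDerivAt (G.deltaPrim n a b)
      (√(G.q c) * (G.delta n c * (a + b * c)) +
        G.sign * (√(G.q c) * G.ker (G.lam n * c) * (a + 4 * b * c))) c := by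
  have hl := lam_mul_mem_dom (G.dom_subset_rng hc) n
  have h1 : HasDerivAt (fun c => a + b * c) b c := by
    simpa using ((hasDerivAt_id c).const_mul b).const_add a
  have h2 := (((hasDerivAt_comp_lam (hasDerivAt_ker1 hl)).const_mul (G.lam n)).fun_mul h1).fun_sub
    ((hasDerivAt_comp_lam (hasDerivAt_ker hl)).mul_const b)
  have h3 := (hasDerivAt_sqrt_q_mul_q hc).fun_mul h2
  refine h3.congr_deriv ?_
  rw [delta_eq (G.dom_subset_rng hc)]
  rw [show G.q c = G.sign * (1 - c ^ 2) from rfl]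
  ring

theorem continuous_deltaAux (G : Geometry) (n : ℕ) :
    ContinuousOn (fun c => G.ker (G.lam n * c)) G.rng ∧
    ContinuousOn (fun c => G.ker1 (G.lam n * c)) G.rng ∧ ContinuousOn (G.delta n) G.rng :=
  ⟨continuousOn_comp_lam G.continuousOn_ker n, continuousOn_comp_lam G.continuousOn_ker1 n,
    continuousOn_const.mul (continuousOn_comp_lam G.continuousOn_ker2 n)⟩

theorem q_lo (G : Geometry) : G.q G.lo = 0 := by cases G <;> norm_num [q, lo]

theorem integral_delta (G : Geometry) {M : ℝ} (hM : 1 < M) (n : ℕ) (a b : ℝ) :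
    ∫ c in G.lo..G.hi M, √(G.q c) * (G.delta n c * (a + b * c)) =
      G.deltaPrim n a b (G.hi M) -
        G.sign * ∫ c in G.lo..G.hi M, √(G.q c) * G.ker (G.lam n * c) * (a + 4 * b * c) := by
  obtain ⟨h1, h2, h3⟩ := G.continuous_deltaAux n
  have hle := G.lo_le_hi hM
  have hsub := G.Icc_subset_rng (M := M)
  have hq := G.continuous_q
  have hsq := hq.sqrt.continuousOn (s := Set.Icc G.lo (G.hi M))
  have hi1 : IntervalIntegrable (fun c => √(G.q c) * (G.delta n c * (a + b * c))) volume
      G.lo (G.hi M) := ContinuousOn.intervalIntegrable_of_Icc hle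
    (hsq.mul ((h3.mono hsub).mul (by fun_prop)))
  have hi2 : IntervalIntegrable (fun c => √(G.q c) * G.ker (G.lam n * c) * (a + 4 * b * c)) volume
      G.lo (G.hi M) := ContinuousOn.intervalIntegrable_of_Icc hle
    ((hsq.mul (h1.mono hsub)).mul (by fun_prop))
  have hcont : ContinuousOn (G.deltaPrim n a b) (Set.Icc G.lo (G.hi M)) :=
    (hsq.mul hq.continuousOn).mul (((continuousOn_const.mul (h2.mono hsub)).mul (by fun_prop)).sub
      ((h1.mono hsub).mul continuousOn_const))
  have h := intervalIntegral.integral_eq_sub_of_hasDerivAt_of_le hle hcont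
    (fun c hc => hasDerivAt_deltaPrim (G.Ioo_subset_dom hc) n a b)
    (hi1.add (hi2.const_mul _))
  rw [intervalIntegral.integral_add hi1 (hi2.const_mul _),
    intervalIntegral.integral_const_mul] at h
  have h0 : G.deltaPrim n a b G.lo = 0 := by rw [deltaPrim, q_lo]; simp
  rw [h0] at h
  linarith

theorem integral_arccos_neg :
    (∫ c in (-1 : ℝ)..1, Real.arccos (-c)) = Real.pi ∧
      ∫ c in (-1 : ℝ)..1, c * Real.arccos (-c) = Real.pi / 4 := by
  have hd : ∀ c ∈ Set.Ioo (-1 : ℝ) 1, HasDerivAt (fun c => Real.arccos (-c)) (1 / √(1 - c ^ 2)) c ∧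
      HasDerivAt (fun c : ℝ => √(1 - c ^ 2)) (-(c / √(1 - c ^ 2))) c ∧ 0 < √(1 - c ^ 2) ∧
      √(1 - c ^ 2) * √(1 - c ^ 2) = 1 - c ^ 2 := by
    rintro c ⟨h1, h2⟩
    have h0 : 0 < 1 - c ^ 2 := by nlinarith
    refine ⟨?_, ?_, Real.sqrt_pos.2 h0, Real.mul_self_sqrt h0.le⟩
    · have h := (Real.hasDerivAt_arccos (x := -c) (by linarith) (by linarith)).comp c
        (hasDerivAt_neg c)
      refine h.congr_deriv ?_
      rw [neg_sq]; ring
    · refine ((hasDerivAt_one_sub_sq c).sqrt h0.ne').congr_deriv ?_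
      rw [neg_div, mul_div_mul_left _ _ two_ne_zero]
  have hc : Continuous fun c : ℝ => Real.arccos (-c) := Real.continuous_arccos.comp continuous_neg
  have hs : Continuous fun c : ℝ => √(1 - c ^ 2) := by fun_prop
  constructor
  · have h := intervalIntegral.integral_eq_sub_of_hasDerivAt_of_le (a := (-1 : ℝ)) (b := 1)
      (f := fun c => c * Real.arccos (-c) + √(1 - c ^ 2)) (f' := fun c => Real.arccos (-c))
      (by norm_num) (by fun_prop) (fun c hc' => by
        obtain ⟨d1, d2, h0, h1⟩ := hd c hc'
        refine (((hasDerivAt_id c).fun_mul d1).fun_add d2).congr_deriv ?_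
        simp only [id]
        ring) (hc.intervalIntegrable _ _)
    rw [h]
    norm_num
  · have h := intervalIntegral.integral_eq_sub_of_hasDerivAt_of_le (a := (-1 : ℝ)) (b := 1)
      (f := fun c => (c ^ 2 / 2 - 1 / 4) * Real.arccos (-c) + c * √(1 - c ^ 2) / 4)
      (f' := fun c => c * Real.arccos (-c))
      (by norm_num) (by fun_prop) (fun c hc' => by
        obtain ⟨d1, d2, h0, h1⟩ := hd c hc'
        have d3 : HasDerivAt (fun c : ℝ => c ^ 2 / 2 - 1 / 4) c c := by
          refine (((hasDerivAt_pow 2 c).div_const 2).sub_const (1 / 4)).congr_deriv ?_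
          norm_num
        refine ((d3.fun_mul d1).fun_add
          (((hasDerivAt_id c).fun_mul d2).div_const 4)).congr_deriv ?_
        simp only [id]
        generalize √(1 - c ^ 2) = r at *
        field_simp
        linear_combination 2 * h1) ((continuous_id.mul hc).intervalIntegrable _ _)
    rw [h]
    norm_num
    ring

/-- The limiting value of the right side of `integral_delta`, in which the normalisation of the
kernel enters. On H³, √q · ker is the constant -1/4π and the integrals are elementary; on S³ it is
-arccos(-c)/4π² and the boundary term vanishes. -/
theorem integral_sqrt_q_mul_ker (G : Geometry) {M : ℝ} (hM : 1 < M) (a b : ℝ) :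
    √(G.q (G.hi M)) * G.q (G.hi M) *
        (G.ker1 (G.hi M) * (a + b * G.hi M) - G.ker (G.hi M) * b) -
      G.sign * ∫ c in G.lo..G.hi M, √(G.q c) * G.ker c * (a + 4 * b * c) =
    (a + b) / (4 * Real.pi) := by
  have hpi := Real.pi_pos
  cases G with
  | spherical =>
    have h0 : spherical.q 1 = 0 := by norm_num [q]
    have h1 : ∫ c in (-1 : ℝ)..1, √(spherical.q c) * spherical.ker c * (a + 4 * b * c) =
        ∫ c in (-1 : ℝ)..1, (-(1 / (4 * Real.pi ^ 2)) * a * Real.arccos (-c) +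
          -(1 / (4 * Real.pi ^ 2)) * (4 * b) * (c * Real.arccos (-c))) := by
      refine intervalIntegral.integral_congr_ae ?_
      have hne : ∀ᵐ c : ℝ, c ≠ 1 := by simp [ae_iff]
      filter_upwards [hne] with c hc hcm
      rw [Set.uIoc_of_le (by norm_num)] at hcm
      have h2 : c < 1 := lt_of_le_of_ne hcm.2 hc
      have h4 : 0 < 1 - c ^ 2 := by nlinarith [hcm.1]
      have h3 := Real.sqrt_pos.2 h4
      simp only [q, ker, sign, one_mul]
      field_simp
      ring
    have hc : Continuous fun c : ℝ => Real.arccos (-c) := Real.continuous_arccos.comp continuous_neg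
    have hc2 : Continuous fun c : ℝ => c * Real.arccos (-c) := continuous_id.mul hc
    simp only [lo, hi, h0, Real.sqrt_zero, zero_mul, zero_sub, sign, one_mul, h1]
    rw [intervalIntegral.integral_add ((hc.intervalIntegrable _ _).const_mul _)
      ((hc2.intervalIntegrable _ _).const_mul _), intervalIntegral.integral_const_mul,
      intervalIntegral.integral_const_mul, integral_arccos_neg.1, integral_arccos_neg.2]
    field_simp
    ring
  | hyperbolic =>
    have hq : ∀ c : ℝ, hyperbolic.q c = c ^ 2 - 1 := fun c => by rw [q, sign]; ring
    have h1 : ∫ c in (1 : ℝ)..M, √(hyperbolic.q c) * hyperbolic.ker c * (a + 4 * b * c) =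
        ∫ c in (1 : ℝ)..M, -(1 / (4 * Real.pi)) * (a + 4 * b * c) := by
      refine intervalIntegral.integral_congr_ae (Eventually.of_forall fun c hcm => ?_)
      rw [Set.uIoc_of_le hM.le] at hcm
      have h4 : 0 < c ^ 2 - 1 := by nlinarith [hcm.1]
      have h3 := Real.sqrt_pos.2 h4
      simp only [hq, ker]
      rw [mul_div_cancel₀ _ h3.ne']
    have h2 : ∫ c in (1 : ℝ)..M, -(1 / (4 * Real.pi)) * (a + 4 * b * c) =
        -(1 / (4 * Real.pi)) * (a * (M - 1) + 2 * b * (M ^ 2 - 1)) := by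
      rw [intervalIntegral.integral_const_mul, intervalIntegral.integral_add
        (f := fun _ => a) (g := fun c => 4 * b * c) (continuous_const.intervalIntegrable _ _)
        ((by fun_prop : Continuous fun c : ℝ => 4 * b * c).intervalIntegrable _ _ ),
        intervalIntegral.integral_const, intervalIntegral.integral_const_mul, integral_id]
      simp only [smul_eq_mul]
      ring
    have h4 : 0 < M ^ 2 - 1 := by nlinarith
    have h3 := Real.sqrt_pos.2 h4
    have h5 : (1 : ℝ) - M ^ 2 = -(M ^ 2 - 1) := by ring
    simp only [lo, hi]
    rw [h1, h2]
    simp only [hq, ker1, ker, kap, sign, h5]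
    generalize hS : M ^ 2 - 1 = S at *
    have hMM : M ^ 2 = S + 1 := by linarith
    field_simp
    ring_nf
    linear_combination b * hMM

/-- Taking a = 1, b = 0 shows that the mass tends to 1; taking a = 1, b = -1 shows that it
concentrates at c = 1, that is, at x = y. -/
theorem tendsto_integral_delta (G : Geometry) {M : ℝ} (hM : 1 < M) (a b : ℝ) :
    Tendsto (fun n => ∫ c in Set.Iic M, G.delta n c * (a + b * c) ∂G.nu) atTop (𝓝 (a + b)) := by
  have hle := G.lo_le_hi hM
  have hpi := Real.pi_pos
  have h1 : Tendsto (fun n => ∫ c in G.lo..G.hi M,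
      √(G.q c) * G.ker (G.lam n * c) * (a + 4 * b * c)) atTop
      (𝓝 (∫ c in G.lo..G.hi M, √(G.q c) * G.ker c * (a + 4 * b * c))) := by
    simp only [intervalIntegral.integral_of_le hle, ← setIntegral_congr_set (G.dom_inter_Iic hM)]
    refine tendsto_integral_of_dominated_convergence (fun c => |a + 4 * b * c|) (fun n => ?_) ?_
      (fun n => ?_) ?_
    · refine (ContinuousOn.aestronglyMeasurable ?_
        (G.isOpen_dom.measurableSet.inter measurableSet_Iic))
      exact ((G.continuous_q.sqrt.continuousOn.mul ((G.continuous_deltaAux n).1.mono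
        (Set.inter_subset_left.trans G.dom_subset_rng))).mul (by fun_prop))
    · rw [← IntegrableOn, integrableOn_congr_set_ae (G.dom_inter_Iic hM)]
      exact ((by fun_prop : Continuous fun c : ℝ => |a + 4 * b * c|).continuousOn.integrableOn_Icc
        (a := G.lo) (b := G.hi M)).mono_set Set.Ioc_subset_Icc_self
    · filter_upwards [ae_restrict_mem (G.isOpen_dom.measurableSet.inter measurableSet_Iic)]
        with c hc
      have h0 := Real.sqrt_pos.2 (q_pos hc.1)
      have h2 := abs_ker_lam_le hc.1 n
      rw [Real.norm_eq_abs, abs_mul, abs_mul, abs_of_pos h0]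
      refine mul_le_of_le_one_left (abs_nonneg _) ?_
      rwa [mul_comm, ← le_div_iff₀ h0]
    · filter_upwards [ae_restrict_mem (G.isOpen_dom.measurableSet.inter measurableSet_Iic)]
        with c hc
      exact ((tendsto_comp_lam G.continuousOn_ker hc.1).const_mul _).mul_const _
  have h2 : Tendsto (fun n => G.deltaPrim n a b (G.hi M)) atTop
      (𝓝 (√(G.q (G.hi M)) * G.q (G.hi M) *
        (G.ker1 (G.hi M) * (a + b * G.hi M) - G.ker (G.hi M) * b))) := by
    cases G with
    | spherical =>
      have h0 : spherical.q 1 = 0 := by norm_num [q]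
      simp only [deltaPrim, hi, h0, Real.sqrt_zero, zero_mul]
      exact tendsto_const_nhds
    | hyperbolic =>
      have hd : M ∈ hyperbolic.dom := hM
      have t1 := tendsto_comp_lam hyperbolic.continuousOn_ker hd
      have t2 := hyperbolic.tendsto_lam.mul (tendsto_comp_lam hyperbolic.continuousOn_ker1 hd)
      rw [one_mul] at t2
      exact ((t2.mul_const _).sub (t1.mul_const _)).const_mul _
  have h3 := (h2.sub (h1.const_mul G.sign)).const_mul (4 * Real.pi)
  rw [integral_sqrt_q_mul_ker G hM, mul_div_cancel₀ _ (by positivity)] at h3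
  refine h3.congr fun n => ?_
  rw [← integral_delta G hM, setIntegral_nu G hM, ← intervalIntegral.integral_const_mul]
  simp only [mul_assoc]

/-! ### Integral operators with kernels depending on the distance -/

/-- The integral operator with kernel `k ⟨x, y⟩`. -/
def conv (G : Geometry) (k : ℝ → ℝ) (f : G.points → ℝ) (y : E4) : ℝ :=
  ∫ x : G.points, k (G.form x y) * f x ∂G.vol

/-- Smooth functions with compact support. -/
structure IsTest (G : Geometry) (f : G.points → ℝ) : Prop where
  smooth : G.Smooth f
  compact : HasCompactSupport f

/-- The derivative along the infinitesimal rotations. -/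
def rotD (G : Geometry) (a j : Fin 4) (f : G.points → ℝ) (x : G.points) : ℝ :=
  G.D f x (G.rot a j x)

theorem rotD_eq {G : Geometry} {f : G.points → ℝ} (hf : G.Smooth f) (a j : Fin 4) (x : G.points) :
    G.rotD a j f x = fderiv ℝ (G.ext f) x (G.rot a j x) :=
  D_eq_fderiv (hf.differentiableAt (mem_cone x)) _

theorem Smooth.rotD {G : Geometry} {f : G.points → ℝ} (hf : G.Smooth f) (a j : Fin 4) :
    G.Smooth (G.rotD a j f) := by
  refine smooth_of_contDiffAt (g := fun z => fderiv ℝ (G.ext f) z (G.rot a j z))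
    (fun x => (rotD_eq hf a j x).symm) fun y => ?_
  exact ((hf.contDiffAt (mem_cone y)).fderiv_right (m := ∞) (by simp)).clm_apply
    (G.rot a j).contDiff.contDiffAt

theorem IsTest.rotD {G : Geometry} {f : G.points → ℝ} (hf : G.IsTest f) (a j : Fin 4) :
    G.IsTest (G.rotD a j f) :=
  ⟨hf.smooth.rotD a j, hasCompactSupport_D hf.compact _⟩

theorem IsTest.continuous {G : Geometry} {f : G.points → ℝ} (hf : G.IsTest f) : Continuous f :=
  hf.smooth.continuous

theorem exists_abs_le {G : Geometry} {f : G.points → ℝ} (hf : Continuous f)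
    (hc : HasCompactSupport f) : ∃ B, 0 ≤ B ∧ ∀ x, |f x| ≤ B := by
  obtain ⟨B, hB⟩ := hc.exists_bound_of_continuous hf
  exact ⟨|B|, abs_nonneg _, fun x => (hB x).trans (le_abs_self _)⟩

/-- Compact support of f bounds ⟨x, y⟩ uniformly for y near a given point. On H³ this permits the
cutoff c ≤ M, below which q⁻¹ is integrable for `nu`. -/
theorem exists_form_le {G : Geometry} {f : G.points → ℝ} (hc : HasCompactSupport f) {Z : Set E4}
    (hZ : IsCompact Z) (hZ' : Z ⊆ G.cone) :
    ∃ M, 1 < M ∧ ∀ x, f x ≠ 0 → ∀ z ∈ Z, G.form x (G.proj z) ≤ M := by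
  have h1 : ContinuousOn (fun p : G.points × E4 => G.form p.1 (G.proj p.2)) (tsupport f ×ˢ Z) := by
    have h2 : ContinuousOn (fun p : G.points × E4 => G.proj p.2) (tsupport f ×ˢ Z) :=
      (G.contDiffOn_proj (n := 0)).continuousOn.comp continuousOn_snd fun p hp => hZ' hp.2
    exact G.continuous_form.comp_continuousOn
      ((continuous_subtype_val.comp continuous_fst).continuousOn.prodMk h2)
  obtain ⟨M, hM⟩ := ((hc.isCompact.prod hZ).image_of_continuousOn h1).bddAbove
  refine ⟨max M 2, lt_max_of_lt_right (by norm_num), fun x hx z hz => le_max_of_le_left ?_⟩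
  exact hM ⟨(x, z), ⟨subset_tsupport f hx, hz⟩, rfl⟩

theorem exists_form_le' {G : Geometry} {f : G.points → ℝ} (hc : HasCompactSupport f)
    (y : G.points) : ∃ M, 1 < M ∧ ∀ x, f x ≠ 0 → G.form x y ≤ M := by
  obtain ⟨M, h1, h2⟩ := exists_form_le hc (isCompact_singleton (x := (y : E4)))
    (Set.singleton_subset_iff.2 (mem_cone y))
  refine ⟨M, h1, fun x hx => ?_⟩
  have := h2 x hx y rfl
  rwa [proj_of_mem y.2] at this

theorem aestronglyMeasurable_comp_form {G : Geometry} {g : ℝ → ℝ}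
    (hg : AEStronglyMeasurable g G.nu) (y : G.points) :
    AEStronglyMeasurable (fun x : G.points => g (G.form x y)) G.vol :=
  hg.comp_measurePreserving (measurePreserving_form y)

theorem integral_indicator_comp_form {G : Geometry} {g : ℝ → ℝ} (hg : AEStronglyMeasurable g G.nu)
    (y : G.points) (M : ℝ) :
    ∫ x : G.points, (Set.Iic M).indicator g (G.form x y) ∂G.vol = ∫ c in Set.Iic M, g c ∂G.nu := by
  rw [← integral_indicator measurableSet_Iic, ← (measurePreserving_form y).map_eq, integral_map
    (measurePreserving_form y).measurable.aemeasurable]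
  rw [(measurePreserving_form y).map_eq]
  exact hg.indicator measurableSet_Iic

theorem integrable_indicator_comp_form {G : Geometry} {g : ℝ → ℝ} {M : ℝ}
    (hg : IntegrableOn g (Set.Iic M) G.nu) (y : G.points) :
    Integrable (fun x : G.points => (Set.Iic M).indicator g (G.form x y)) G.vol :=
  (measurePreserving_form y).integrable_comp_of_integrable
    ((integrable_indicator_iff measurableSet_Iic).2 hg)

/-- Bounding |f| by B on c ≤ M and pushing the volume forward to `nu` leaves a one-dimensional
integral. The bound depends on y only through M. -/
theorem integrable_comp_form_mul {G : Geometry} {g : ℝ → ℝ} {f : G.points → ℝ} {y : G.points}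
    {M B : ℝ} (hg : AEStronglyMeasurable g G.nu) (hgi : IntegrableOn g (Set.Iic M) G.nu)
    (hf : AEStronglyMeasurable f G.vol) (hB : ∀ x, |f x| ≤ B)
    (hM : ∀ x, f x ≠ 0 → G.form x y ≤ M) :
    Integrable (fun x : G.points => g (G.form x y) * f x) G.vol ∧
      |∫ x : G.points, g (G.form x y) * f x ∂G.vol| ≤ B * ∫ c in Set.Iic M, |g c| ∂G.nu := by
  have hbound : ∀ x : G.points, ‖g (G.form x y) * f x‖ ≤
      B * (Set.Iic M).indicator (fun c => |g c|) (G.form x y) := by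
    intro x
    have hB0 : 0 ≤ B := (abs_nonneg _).trans (hB x)
    rw [Real.norm_eq_abs, abs_mul, mul_comm]
    by_cases h : f x = 0
    · rw [h, abs_zero, zero_mul]
      exact mul_nonneg hB0 (Set.indicator_nonneg (fun _ _ => abs_nonneg _) _)
    · rw [Set.indicator_of_mem (Set.mem_Iic.2 (hM x h))]
      exact mul_le_mul_of_nonneg_right (hB x) (abs_nonneg _)
  have hi := (integrable_indicator_comp_form hgi.abs y).const_mul B
  refine ⟨hi.mono' ((aestronglyMeasurable_comp_form hg y).mul hf)
    (Eventually.of_forall hbound), ?_⟩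
  refine (norm_integral_le_of_norm_le hi (Eventually.of_forall hbound)).trans ?_
  rw [integral_const_mul, integral_indicator_comp_form (by exact hg.norm)]

theorem integrable_of_norm_le {E : Type*} [NormedAddCommGroup E] {G : Geometry} {f : G.points → ℝ}
    (hf : Continuous f) (hc : HasCompactSupport f) {y : G.points} {M B : ℝ} (hM : 1 < M)
    (hM' : ∀ x, f x ≠ 0 → G.form x y ≤ M)
    {F : G.points → E} (hF : AEStronglyMeasurable F G.vol)
    (h : ∀ x : G.points, G.form x y ∈ G.dom → ‖F x‖ ≤ B * (G.q (G.form x y))⁻¹ * |f x|) :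
    Integrable F G.vol := by
  obtain ⟨C, -, hC⟩ := exists_abs_le hf hc
  have h1 := (integrable_comp_form_mul (g := fun c => (G.q c)⁻¹) (f := fun x => |f x|) (y := y)
    (B := C) G.measurable_q.inv.aestronglyMeasurable (G.integrableOn_inv_q hM)
    (by exact hf.abs.aestronglyMeasurable) (fun x => by rw [abs_abs]; exact hC x)
    (fun x hx => hM' x (abs_ne_zero.1 hx))).1
  refine (h1.const_mul B).mono' hF ?_
  filter_upwards [ae_form_mem_dom y] with x hx
  rw [← mul_assoc]
  exact h x hx

theorem integral_mul_rotD {G : Geometry} {u : E4 → ℝ} (hu : ∀ x : G.points, ContDiffAt ℝ 1 u x)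
    {f : G.points → ℝ} (hf : G.IsTest f) (a j : Fin 4) :
    ∫ x : G.points, u x * G.rotD a j f x ∂G.vol =
      -∫ x : G.points, fderiv ℝ u x (G.rot a j x) * f x ∂G.vol := by
  have hfe : ∀ x : G.points, ContDiffAt ℝ 1 (G.ext f) x := fun x =>
    (hf.smooth.contDiffAt (mem_cone x)).of_le (by exact_mod_cast le_top)
  have h0 := integral_rot a j (h := fun z => u z * G.ext f z) (fun x => (hu x).mul (hfe x))
    (by simp only [ext_coe]; exact hf.compact.mul_left)
  have h1 : ∀ x : G.points, fderiv ℝ (fun z => u z * G.ext f z) x (G.rot a j x) =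
      u x * G.rotD a j f x + fderiv ℝ u x (G.rot a j x) * f x := by
    intro x
    rw [(((hu x).differentiableAt one_ne_zero).hasFDerivAt.fun_mul
      ((hfe x).differentiableAt one_ne_zero).hasFDerivAt).fderiv, rotD_eq hf.smooth, ext_coe]
    simp only [add_apply, smul_apply, smul_eq_mul]
    ring
  simp only [h1] at h0
  rw [integral_add] at h0
  · linarith
  · exact ((continuous_of_contDiffAt hu).mul
      (hf.rotD a j).continuous).integrable_of_hasCompactSupport (hf.rotD a j).compact.mul_left
  · exact ((continuous_fderiv_apply hu _).mul
      hf.continuous).integrable_of_hasCompactSupport hf.compact.mul_left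

theorem hasFDerivAt_comp_form {G : Geometry} {k : ℝ → ℝ} {k' : ℝ} {x y : E4}
    (hk : HasDerivAt k k' (G.form x y)) :
    HasFDerivAt (fun z => k (G.form x z)) (k' • G.bil x) y := by
  have h : HasFDerivAt (fun z => G.form x z) (G.bil x) y := by
    have h1 : (fun z => G.form x z) = G.bil x := by funext z; rw [bil_apply]
    rw [h1]
    exact (G.bil x).hasFDerivAt
  exact hk.comp_hasFDerivAt y h

theorem hasFDerivAt_comp_form_left {G : Geometry} {k : ℝ → ℝ} {k' : ℝ} {x y : E4}
    (hk : HasDerivAt k k' (G.form x y)) :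
    HasFDerivAt (fun z => k (G.form z y)) (k' • G.bil y) x := by
  simp only [G.form_comm _ y]
  exact hasFDerivAt_comp_form (by rwa [form_comm])

theorem contDiff_form_left (G : Geometry) (y : E4) {n} : ContDiff ℝ n fun z => G.form z y :=
  G.contDiff_form.comp (contDiff_id.prodMk contDiff_const)

theorem contDiffAt_comp_form {G : Geometry} {k : ℝ → ℝ} {n} (hk : ∀ c ∈ G.rng, ContDiffAt ℝ n k c)
    (x y : G.points) : ContDiffAt ℝ n (fun z => k (G.form z y)) x :=
  (hk _ (form_mem_rng x.2 y.2)).comp (x : E4) (G.contDiff_form_left y).contDiffAt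

/-- Integration by parts puts the rotation on the kernel in the variable x. As ⟨x, y⟩ is invariant
under isometries, this is minus its rotation in y, and the two signs cancel. -/
theorem conv_rotD {G : Geometry} {k : ℝ → ℝ} (hk : ∀ c ∈ G.rng, ContDiffAt ℝ 1 k c)
    {f : G.points → ℝ} (hf : G.IsTest f) (a j : Fin 4) (y : G.points) :
    G.conv k (G.rotD a j f) y =
      ∫ x : G.points, deriv k (G.form x y) * G.form x (G.rot a j y) * f x ∂G.vol := by
  rw [conv, integral_mul_rotD (u := fun z => k (G.form z y))
    (fun x => contDiffAt_comp_form hk x y) hf, ← integral_neg]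
  refine integral_congr_ae (Eventually.of_forall fun x => ?_)
  have h := hasFDerivAt_comp_form_left (y := (y : E4))
    ((hk _ (form_mem_rng x.2 y.2)).differentiableAt one_ne_zero).hasDerivAt
  simp only [h.fderiv, smul_apply, bil_apply, smul_eq_mul]
  rw [G.form_comm y, form_rot_left]
  ring

theorem continuousOn_deriv {G : Geometry} {k : ℝ → ℝ} (hk : ∀ c ∈ G.rng, ContDiffAt ℝ 1 k c)
    {c : ℝ} (hc : c ∈ G.rng) : ContinuousAt (deriv k) c := by
  have h := ((hk c hc).fderiv_right (m := 0) (by simp)).continuousAt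
  exact h.clm_apply continuousAt_const

theorem continuous_comp_form {G : Geometry} {k : ℝ → ℝ} (hk : ∀ c ∈ G.rng, ContinuousAt k c)
    {y : E4} (hy : y ∈ G.points) : Continuous fun x : G.points => k (G.form x y) := by
  refine continuous_iff_continuousAt.2 fun x => ?_
  exact ContinuousAt.comp (f := fun x : G.points => G.form x y) (hk _ (form_mem_rng x.2 hy))
    (G.continuous_form.comp
    (continuous_subtype_val.prodMk continuous_const)).continuousAt

/-- The derivative of a convolution, in terms of convolutions. -/
def convDeriv (G : Geometry) (k : ℝ → ℝ) (f : G.points → ℝ) (z : E4) : E4 →L[ℝ] ℝ :=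
  ∑ j, ∑ a, (G.proj z a * G.conv k (G.rotD a j f) (G.proj z)) •
    (EuclideanSpace.proj j : E4 →L[ℝ] ℝ).comp (fderiv ℝ G.proj z)

/-- The right side is the derivative of the convolution along τ; expand τ by `sum_smul_rot` and
apply `conv_rotD`. The left side contains k only undifferentiated, so it survives the passage to a
singular kernel. -/
theorem sum_conv_rotD {G : Geometry} {k : ℝ → ℝ} (hk : ∀ c ∈ G.rng, ContDiffAt ℝ 1 k c)
    {f : G.points → ℝ} (hf : G.IsTest f) (y : G.points) {τ : E4} (hτ : G.form y τ = 0) :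
    ∑ j, ∑ a, ((y : E4) a * G.conv k (G.rotD a j f) y) * τ j =
      ∫ x : G.points, deriv k (G.form x y) * G.form x τ * f x ∂G.vol := by
  have hcont : ∀ v, Continuous fun x : G.points => deriv k (G.form x y) * G.form x v * f x :=
    fun v => ((continuous_comp_form (fun c hc => continuousOn_deriv hk hc) y.2).mul
      (G.continuous_form.comp (continuous_subtype_val.prodMk continuous_const))).mul hf.continuous
  have hint : ∀ v, Integrable
      (fun x : G.points => deriv k (G.form x y) * G.form x v * f x) G.vol := fun v =>
    (hcont v).integrable_of_hasCompactSupport hf.compact.mul_left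
  have h : ∀ x : G.points, deriv k (G.form x y) * G.form x τ * f x = ∑ j, ∑ a,
      (τ j * (y : E4) a) * (deriv k (G.form x y) * G.form x (G.rot a j y) * f x) := by
    intro x
    have h1 : G.form x τ = ∑ j, ∑ a, (τ j * (y : E4) a) * G.form x (G.rot a j y) := by
      conv_lhs => rw [← sum_smul_rot y.2 hτ]
      simp only [← bil_apply, map_sum, map_smul, smul_eq_mul]
    rw [h1]
    simp only [Finset.mul_sum, Finset.sum_mul]
    exact Finset.sum_congr rfl fun j _ => Finset.sum_congr rfl fun a _ => by ring
  simp only [h]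
  rw [integral_finsetSum _ fun j _ => integrable_finsetSum _ fun a _ => (hint _).const_mul _]
  refine Finset.sum_congr rfl fun j _ => ?_
  rw [integral_finsetSum _ fun a _ => (hint _).const_mul _]
  refine Finset.sum_congr rfl fun a _ => ?_
  rw [integral_const_mul, conv_rotD hk hf]
  ring

/-- Differentiation under the integral, dominated on a compact ball times the support of f, followed
by `sum_conv_rotD` to remove the derivative from k. -/
theorem hasFDerivAt_conv {G : Geometry} {k : ℝ → ℝ} (hk : ∀ c ∈ G.rng, ContDiffAt ℝ 1 k c)
    {f : G.points → ℝ} (hf : G.IsTest f) {z₀ : E4} (hz₀ : z₀ ∈ G.cone) :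
    HasFDerivAt (fun z => G.conv k f (G.proj z)) (G.convDeriv k f z₀) z₀ := by
  obtain ⟨r, hr, hsub⟩ := Metric.nhds_basis_closedBall.mem_iff.1 (G.isOpen_cone.mem_nhds hz₀)
  set F' : E4 → G.points → E4 →L[ℝ] ℝ := fun z x =>
    (deriv k (G.form x (G.proj z))) • (G.bil x).comp (fderiv ℝ G.proj z) with hF'
  have hproj : ContinuousOn (fun p : G.points × E4 => G.proj p.2)
      (tsupport f ×ˢ Metric.closedBall z₀ r) :=
    (G.contDiffOn_proj (n := 0)).continuousOn.comp continuousOn_snd fun p hp => hsub hp.2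
  have hfproj : ContinuousOn (fun p : G.points × E4 => fderiv ℝ G.proj p.2)
      (tsupport f ×ˢ Metric.closedBall z₀ r) :=
    ((G.contDiffOn_proj (n := 1)).continuousOn_fderiv_of_isOpen G.isOpen_cone le_rfl).comp
      continuousOn_snd fun p hp => hsub hp.2
  have hform : ContinuousOn (fun p : G.points × E4 => G.form p.1 (G.proj p.2))
      (tsupport f ×ˢ Metric.closedBall z₀ r) :=
    G.continuous_form.comp_continuousOn
      ((continuous_subtype_val.comp continuous_fst).continuousOn.prodMk hproj)
  have hcont : ContinuousOn (fun p : G.points × E4 => F' p.2 p.1)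
      (tsupport f ×ˢ Metric.closedBall z₀ r) := by
    have h1 : ContinuousOn (fun p : G.points × E4 => deriv k (G.form p.1 (G.proj p.2)))
        (tsupport f ×ˢ Metric.closedBall z₀ r) := fun p hp =>       ContinuousAt.comp_continuousWithinAt (f := fun p : G.points × E4 =>
        G.form p.1 (G.proj p.2))
        (continuousOn_deriv hk (form_mem_rng p.1.2 (proj_mem (hsub hp.2)))) (hform p hp)
    exact h1.smul (((G.bil.continuous.comp
      (continuous_subtype_val.comp continuous_fst))).continuousOn.clm_comp hfproj)
  obtain ⟨C, hC⟩ := (hf.compact.isCompact.prod (isCompact_closedBall z₀ r)).exists_bound_of_continuousOn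
    hcont
  have hint : ∀ z ∈ G.cone, Integrable (fun x : G.points => k (G.form x (G.proj z)) * f x) G.vol :=
    fun z hz => ((continuous_comp_form (fun c hc => (hk c hc).continuousAt) (proj_mem hz)).mul
      hf.continuous).integrable_of_hasCompactSupport hf.compact.mul_left
  have hcontF : Continuous fun x => f x • F' z₀ x := by
    refine hf.continuous.smul ((continuous_comp_form (fun c hc => continuousOn_deriv hk hc)
      (proj_mem hz₀)).smul ?_)
    exact (G.bil.continuous.comp continuous_subtype_val).clm_comp continuous_const
  have hmain := hasFDerivAt_integral_of_dominated_of_fderiv_le (𝕜 := ℝ) (μ := G.vol)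
    (F := fun z x => k (G.form x (G.proj z)) * f x) (F' := fun z x => f x • F' z x) (x₀ := z₀)
    (bound := fun x => |f x| * C) (s := Metric.ball z₀ r) (Metric.ball_mem_nhds z₀ hr)
    (by
      filter_upwards [G.isOpen_cone.mem_nhds hz₀] with z hz
      exact (hint z hz).aestronglyMeasurable) (hint z₀ hz₀)
    hcontF.aestronglyMeasurable
    (Eventually.of_forall fun x z hz => by
      rw [norm_smul, Real.norm_eq_abs]
      by_cases hx : f x = 0
      · simp [hx]
      · exact mul_le_mul_of_nonneg_left (hC (x, z) ⟨subset_tsupport f hx,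
          Metric.ball_subset_closedBall hz⟩) (abs_nonneg _))
    ((hf.continuous.abs.integrable_of_hasCompactSupport hf.compact.abs).mul_const C)
    (Eventually.of_forall fun x z hz => by
      have hz' := hsub (Metric.ball_subset_closedBall hz)
      have h1 := hasFDerivAt_comp_form (x := (x : E4)) (y := G.proj z)
        ((hk _ (form_mem_rng x.2 (proj_mem hz'))).differentiableAt one_ne_zero).hasDerivAt
      have h2 := h1.comp z ((contDiffAt_proj (n := 1) hz').differentiableAt
        one_ne_zero).hasFDerivAt
      refine (h2.mul_const (f x)).congr_fderiv ?_
      rw [hF', ContinuousLinearMap.smul_comp])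
  refine hmain.congr_fderiv ?_
  ext v
  rw [ContinuousLinearMap.integral_apply
    (hcontF.integrable_of_hasCompactSupport hf.compact.smul_right)]
  have h := sum_conv_rotD hk hf ⟨G.proj z₀, proj_mem hz₀⟩ (form_fderiv_proj hz₀ v)
  simp only [convDeriv, sum_apply, smul_apply, ContinuousLinearMap.comp_apply,
    PiLp.proj_apply, smul_eq_mul]
  rw [h]
  refine integral_congr_ae (Eventually.of_forall fun x => ?_)
  simp only [hF', smul_apply, ContinuousLinearMap.comp_apply, bil_apply, smul_eq_mul]
  ring

/-! ### The integral operator with the singular kernel -/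

/-- The regularized kernels. -/
def kern (G : Geometry) (n : ℕ) (c : ℝ) : ℝ := G.ker (G.lam n * c)

theorem contDiffAt_kern {G : Geometry} (n : ℕ) {m : ℕ∞} {c : ℝ} (hc : c ∈ G.rng) :
    ContDiffAt ℝ m (G.kern n) c :=
  (contDiffAt_ker (lam_mul_mem_dom hc n)).comp c (by fun_prop)

theorem hasDerivAt_kern {G : Geometry} (n : ℕ) {c : ℝ} (hc : c ∈ G.rng) :
    HasDerivAt (G.kern n) (G.lam n * G.ker1 (G.lam n * c)) c :=
  hasDerivAt_comp_lam (hasDerivAt_ker (lam_mul_mem_dom hc n))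

theorem integrableOn_kern (G : Geometry) {M : ℝ} (hM : 1 < M) (n : ℕ) :
    IntegrableOn (G.kern n) (Set.Iic M) G.nu := by
  refine ((G.integrableOn_inv_q hM).const_mul (1 + |M|)).mono'
    ((aestronglyMeasurable_nu ((continuousOn_comp_lam G.continuousOn_ker n).mono
      G.dom_subset_rng)).mono_measure Measure.restrict_le_self) ?_
  filter_upwards [ae_restrict_of_ae G.ae_nu, ae_restrict_mem measurableSet_Iic] with c hc hcM
  exact (abs_ker_lam_le hc n).trans (one_div_sqrt_q_le hc hcM)

theorem integrableOn_ker (G : Geometry) {M : ℝ} (hM : 1 < M) :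
    IntegrableOn G.ker (Set.Iic M) G.nu := by
  refine ((G.integrableOn_inv_q hM).const_mul (1 + |M|)).mono'
    ((aestronglyMeasurable_nu G.continuousOn_ker).mono_measure Measure.restrict_le_self) ?_
  filter_upwards [ae_restrict_of_ae G.ae_nu, ae_restrict_mem measurableSet_Iic] with c hc hcM
  exact (abs_ker_le hc).trans (one_div_sqrt_q_le hc hcM)

theorem integrable_ker_mul {G : Geometry} {f : G.points → ℝ} (hf : Continuous f)
    (hc : HasCompactSupport f) (y : G.points) :
    Integrable (fun x : G.points => G.ker (G.form x y) * f x) G.vol := by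
  obtain ⟨B, -, hB⟩ := exists_abs_le hf hc
  obtain ⟨M, hM, hM'⟩ := exists_form_le' hc y
  exact (integrable_comp_form_mul (aestronglyMeasurable_nu G.continuousOn_ker)
    (G.integrableOn_ker hM) hf.aestronglyMeasurable hB hM').1

theorem abs_conv_kern_sub_le {G : Geometry} {f : G.points → ℝ} (hf : Continuous f) {B M : ℝ}
    (hM : 1 < M) (hB : ∀ x, |f x| ≤ B) {y : G.points} (hM' : ∀ x, f x ≠ 0 → G.form x y ≤ M)
    (n : ℕ) : |G.conv (G.kern n) f y - G.conv G.ker f y| ≤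
      B * ∫ c in Set.Iic M, |G.ker (G.lam n * c) - G.ker c| ∂G.nu := by
  have m1 := aestronglyMeasurable_nu ((continuousOn_comp_lam G.continuousOn_ker n).mono
      G.dom_subset_rng)
  have m2 := aestronglyMeasurable_nu G.continuousOn_ker
  have i1 := (integrable_comp_form_mul m1 (G.integrableOn_kern hM n) hf.aestronglyMeasurable
    hB hM').1
  have i2 := (integrable_comp_form_mul m2 (G.integrableOn_ker hM) hf.aestronglyMeasurable hB hM').1
  have h := (integrable_comp_form_mul (m1.sub m2)
    ((G.integrableOn_kern hM n).sub (G.integrableOn_ker hM)) hf.aestronglyMeasurable hB hM').2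
  rw [conv, conv, ← integral_sub (by exact i1) i2]
  simp only [Pi.sub_apply, sub_mul] at h
  exact h

theorem tendsto_conv_kern {G : Geometry} {f : G.points → ℝ} (hf : Continuous f)
    (hc : HasCompactSupport f) (y : G.points) :
    Tendsto (fun n => G.conv (G.kern n) f y) atTop (𝓝 (G.conv G.ker f y)) := by
  obtain ⟨B, -, hB⟩ := exists_abs_le hf hc
  obtain ⟨M, hM, hM'⟩ := exists_form_le' hc y
  rw [tendsto_iff_norm_sub_tendsto_zero]
  have h := (G.tendsto_integral_ker_sub hM).const_mul B
  rw [mul_zero] at h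
  exact squeeze_zero (fun _ => norm_nonneg _) (abs_conv_kern_sub_le hf hM hB hM') h

/-- The error is at most B times the L¹(`nu`) distance of the kernels on c ≤ M, and M can be chosen
uniformly for z in a compact set. -/
theorem tendstoLocallyUniformlyOn_conv_kern {G : Geometry} {f : G.points → ℝ} (hf : Continuous f)
    (hc : HasCompactSupport f) :
    TendstoLocallyUniformlyOn (fun n z => G.conv (G.kern n) f (G.proj z))
      (fun z => G.conv G.ker f (G.proj z)) atTop G.cone := by
  rw [tendstoLocallyUniformlyOn_iff_forall_isCompact G.isOpen_cone]
  intro Z hZ' hZ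
  obtain ⟨B, -, hB⟩ := exists_abs_le hf hc
  obtain ⟨M, hM, hM'⟩ := exists_form_le hc hZ hZ'
  rw [Metric.tendstoUniformlyOn_iff]
  intro ε hε
  have h := (G.tendsto_integral_ker_sub hM).const_mul B
  rw [mul_zero] at h
  filter_upwards [h.eventually_lt_const hε] with n hn z hz
  rw [dist_comm, Real.dist_eq]
  exact (abs_conv_kern_sub_le (y := ⟨G.proj z, proj_mem (hZ' hz)⟩) hf hM hB
    (fun x hx => hM' x hx z hz) n).trans_lt hn

/-- Both the regularised convolutions and their derivatives converge, the derivatives locally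
uniformly: `convDeriv` is built from convolutions of the test functions `rotD a j f` with the
undifferentiated kernel. -/
theorem hasFDerivAt_conv_ker {G : Geometry} {f : G.points → ℝ} (hf : G.IsTest f) {z : E4}
    (hz : z ∈ G.cone) :
    HasFDerivAt (fun z => G.conv G.ker f (G.proj z)) (G.convDeriv G.ker f z) z := by
  refine hasFDerivAt_of_tendstoLocallyUniformlyOn G.isOpen_cone
    (f := fun n z => G.conv (G.kern n) f (G.proj z)) (f' := fun n => G.convDeriv (G.kern n) f)
    (l := atTop) ?_
    (fun n z hz => hasFDerivAt_conv (fun c hc => contDiffAt_kern n hc) hf hz)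
    (fun z hz => tendsto_conv_kern hf.continuous hf.compact ⟨G.proj z, proj_mem hz⟩) hz
  have hterm : ∀ j a : Fin 4, TendstoLocallyUniformlyOn (fun n z =>
      (G.proj z a * G.conv (G.kern n) (G.rotD a j f) (G.proj z)) •
        (EuclideanSpace.proj j : E4 →L[ℝ] ℝ).comp (fderiv ℝ G.proj z))
      (fun z => (G.proj z a * G.conv G.ker (G.rotD a j f) (G.proj z)) •
        (EuclideanSpace.proj j : E4 →L[ℝ] ℝ).comp (fderiv ℝ G.proj z)) atTop G.cone := by
    intro j a
    have h1 := tendstoLocallyUniformlyOn_conv_kern (hf.rotD a j).continuous (hf.rotD a j).compact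
    have hA : ContinuousOn (fun z => G.proj z a •
        (EuclideanSpace.proj j : E4 →L[ℝ] ℝ).comp (fderiv ℝ G.proj z)) G.cone := by
      have hp := (G.contDiffOn_proj (n := 1)).continuousOn
      refine ContinuousOn.smul ((PiLp.continuous_apply 2 _ a).comp_continuousOn hp) ?_
      exact continuousOn_const.clm_comp
        ((G.contDiffOn_proj (n := 1)).continuousOn_fderiv_of_isOpen G.isOpen_cone le_rfl)
    rw [tendstoLocallyUniformlyOn_iff_forall_isCompact G.isOpen_cone] at h1 ⊢
    intro Z hZ' hZ
    obtain ⟨C, hC⟩ := hZ.exists_bound_of_continuousOn (hA.mono hZ')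
    have h2 := h1 Z hZ' hZ
    rw [Metric.tendstoUniformlyOn_iff] at h2 ⊢
    intro ε hε
    have hC1 : 0 < |C| + 1 := by positivity
    filter_upwards [h2 (ε / (|C| + 1)) (by positivity)] with n hn z hz
    have h3 := hn z hz
    rw [dist_eq_norm] at h3 ⊢
    rw [mul_comm (G.proj z a), mul_comm (G.proj z a), mul_smul, mul_smul, ← sub_smul, norm_smul]
    calc _ ≤ ‖G.conv G.ker (G.rotD a j f) (G.proj z) -
          G.conv (G.kern n) (G.rotD a j f) (G.proj z)‖ * (|C| + 1) := by
          gcongr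
          linarith [hC z hz, le_abs_self C]
      _ < ε / (|C| + 1) * (|C| + 1) := by gcongr
      _ = ε := by field_simp
  have hzero : TendstoLocallyUniformlyOn (fun (_ : ℕ) (_ : E4) => (0 : E4 →L[ℝ] ℝ)) 0 atTop
      G.cone := by
    rw [tendstoLocallyUniformlyOn_iff_forall_isCompact G.isOpen_cone]
    intro Z _ _
    rw [Metric.tendstoUniformlyOn_iff]
    intro ε hε
    exact Eventually.of_forall fun n z _ => by simpa using hε
  have hsum : ∀ (g : ℕ → Fin 4 → E4 → E4 →L[ℝ] ℝ) (g' : Fin 4 → E4 → E4 →L[ℝ] ℝ),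
      (∀ i, TendstoLocallyUniformlyOn (fun n => g n i) (g' i) atTop G.cone) →
      TendstoLocallyUniformlyOn (fun n z => ∑ i, g n i z) (fun z => ∑ i, g' i z) atTop
        G.cone := by
    intro g g' h
    simp only [Fin.sum_univ_four]
    exact (((h 0).add (h 1)).add (h 2)).add (h 3)
  exact hsum _ _ fun j => hsum _ _ fun a => hterm j a

/-- Induction on the order. The derivative is a combination, with smooth coefficients, of
convolutions of the same kernel with `rotD a j f`, which are again test functions; so the induction
must run over all f. -/
theorem contDiffOn_conv_ker {G : Geometry} {f : G.points → ℝ} (hf : G.IsTest f) :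
    ContDiffOn ℝ ∞ (fun z => G.conv G.ker f (G.proj z)) G.cone := by
  rw [contDiffOn_infty]
  intro n
  induction n generalizing f with
  | zero =>
    rw [Nat.cast_zero, contDiffOn_zero]
    exact fun z hz => (hasFDerivAt_conv_ker hf hz).continuousAt.continuousWithinAt
  | succ n ih =>
    push_cast
    rw [contDiffOn_succ_iff_fderiv_of_isOpen G.isOpen_cone]
    refine ⟨fun z hz => (hasFDerivAt_conv_ker hf hz).differentiableAt.differentiableWithinAt,
      by simp, ?_⟩
    refine ContDiffOn.congr (f := G.convDeriv G.ker f) ?_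
      fun z hz => (hasFDerivAt_conv_ker hf hz).fderiv
    refine ContDiffOn.sum fun j _ => ContDiffOn.sum fun a _ => ContDiffOn.smul (ContDiffOn.mul ?_
      (ih (hf.rotD a j))) ?_
    · exact contDiff_euclidean.1 contDiff_id a |>.comp_contDiffOn G.contDiffOn_proj
    · refine contDiffOn_const.clm_comp ?_
      exact (G.contDiffOn_proj (n := ∞)).fderiv_of_isOpen G.isOpen_cone (by exact_mod_cast le_top)

/-- The integral operator with the singular kernel. -/
def pot (G : Geometry) (f : G.points → ℝ) (y : G.points) : ℝ := G.conv G.ker f y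

theorem ext_pot {G : Geometry} (f : G.points → ℝ) {z : E4} (hz : z ∈ G.cone) :
    G.ext (G.pot f) z = G.conv G.ker f (G.proj z) := ext_of_mem _ hz

theorem IsTest.smooth_pot {G : Geometry} {f : G.points → ℝ} (hf : G.IsTest f) :
    G.Smooth (G.pot f) :=
  (contDiffOn_conv_ker hf).congr fun _ hz => ext_pot f hz

theorem norm_ker1_mul_form_le {G : Geometry} {y x : G.points} {M : ℝ} {u : ℝ} {τ : E4}
    (hτ : G.form y τ = 0) (hu : |u| * √(G.q (G.form x y)) ≤ 3 * (1 + |M|) * (G.q (G.form x y))⁻¹)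
    (b : ℝ) : ‖u * G.form x τ * b‖ ≤
      (√(G.dot τ τ) * (3 * (1 + |M|))) * (G.q (G.form x y))⁻¹ * |b| := by
  have h1 := abs_form_tan_le x.2 y.2 τ
  rw [tan_of_form_eq_zero hτ] at h1
  rw [Real.norm_eq_abs, abs_mul, abs_mul]
  refine mul_le_mul_of_nonneg_right ?_ (abs_nonneg _)
  calc |u| * |G.form x τ| ≤ |u| * (√(G.q (G.form x y)) * √(G.dot τ τ)) := by gcongr
    _ = √(G.dot τ τ) * (|u| * √(G.q (G.form x y))) := by ring
    _ ≤ √(G.dot τ τ) * (3 * (1 + |M|) * (G.q (G.form x y))⁻¹) := by gcongr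
    _ = _ := by ring

theorem aestronglyMeasurable_ker1_mul {G : Geometry} {f : G.points → ℝ} (hf : Continuous f)
    (y : G.points) (τ : E4) :
    AEStronglyMeasurable (fun x : G.points => G.ker1 (G.form x y) * G.form x τ * f x) G.vol :=
  ((aestronglyMeasurable_comp_form (aestronglyMeasurable_nu G.continuousOn_ker1) y).mul
    (G.measurable_form τ).aestronglyMeasurable).mul hf.aestronglyMeasurable

theorem integrable_ker1_mul {G : Geometry} {f : G.points → ℝ} (hf : Continuous f)
    (hc : HasCompactSupport f) (y : G.points) {τ : E4} (hτ : G.form y τ = 0) :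
    Integrable (fun x : G.points => G.ker1 (G.form x y) * G.form x τ * f x) G.vol := by
  obtain ⟨M, hM, hM'⟩ := exists_form_le' hc y
  refine integrable_of_norm_le (B := √(G.dot τ τ) * (3 * (1 + |M|))) hf hc hM hM'
    (aestronglyMeasurable_ker1_mul hf y τ) fun x hx => ?_
  by_cases hfx : f x = 0
  · simp [hfx]
  · exact norm_ker1_mul_form_le hτ (abs_ker1_mul_sqrt_le hx (hM' x hfx)) _

/-- The limit of `sum_conv_rotD` for the regularised kernels: the left side converges in L¹, the
right side by domination with q⁻¹. Thus the singular integral may be differentiated once under the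
integral sign. -/
theorem sum_conv_ker_rotD {G : Geometry} {f : G.points → ℝ} (hf : G.IsTest f) (y : G.points)
    {τ : E4} (hτ : G.form y τ = 0) :
    ∑ j, ∑ a, ((y : E4) a * G.conv G.ker (G.rotD a j f) y) * τ j =
      ∫ x : G.points, G.ker1 (G.form x y) * G.form x τ * f x ∂G.vol := by
  obtain ⟨M, hM, hM'⟩ := exists_form_le' hf.compact y
  have h1 : Tendsto (fun n => ∑ j, ∑ a, ((y : E4) a * G.conv (G.kern n) (G.rotD a j f) y) * τ j)
      atTop (𝓝 (∑ j, ∑ a, ((y : E4) a * G.conv G.ker (G.rotD a j f) y) * τ j)) :=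
    tendsto_finsetSum _ fun j _ => tendsto_finsetSum _ fun a _ =>
      ((tendsto_conv_kern (hf.rotD a j).continuous (hf.rotD a j).compact y).const_mul _).mul_const _
  have h2 : Tendsto (fun n => G.lam n *
      ∫ x : G.points, G.ker1 (G.lam n * G.form x y) * G.form x τ * f x ∂G.vol) atTop
      (𝓝 (1 * ∫ x : G.points, G.ker1 (G.form x y) * G.form x τ * f x ∂G.vol)) := by
    refine G.tendsto_lam.mul ?_
    refine tendsto_integral_of_dominated_convergence (fun x : G.points =>
      (√(G.dot τ τ) * (3 * (1 + |M|))) * (G.q (G.form x y))⁻¹ * |f x|) (fun n => ?_) ?_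
      (fun n => ?_) ?_
    · exact ((aestronglyMeasurable_comp_form (aestronglyMeasurable_nu
        ((continuousOn_comp_lam G.continuousOn_ker1 n).mono G.dom_subset_rng)) y).mul
        (G.measurable_form τ).aestronglyMeasurable).mul hf.continuous.aestronglyMeasurable
    · refine integrable_of_norm_le (B := √(G.dot τ τ) * (3 * (1 + |M|))) hf.continuous hf.compact
        hM hM' ?_ fun x hx => ?_
      · exact ((G.measurable_q.comp (G.measurable_form y)).inv.const_mul _).aestronglyMeasurable.mul
          hf.continuous.abs.aestronglyMeasurable
      · have := q_pos hx
        rw [Real.norm_eq_abs, abs_of_nonneg (by positivity)]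
    · filter_upwards [ae_form_mem_dom y] with x hx
      by_cases hfx : f x = 0
      · simp [hfx]
      · exact norm_ker1_mul_form_le hτ (abs_ker1_lam_mul_le hx (hM' x hfx) n) _
    · filter_upwards [ae_form_mem_dom y] with x hx
      exact ((tendsto_comp_lam G.continuousOn_ker1 hx).mul_const _).mul_const _
  rw [one_mul] at h2
  refine tendsto_nhds_unique h1 (h2.congr fun n => ?_)
  rw [sum_conv_rotD (fun c hc => contDiffAt_kern n hc) hf y hτ, ← integral_const_mul]
  refine integral_congr_ae (Eventually.of_forall fun x => ?_)
  simp only [(hasDerivAt_kern n (form_mem_rng x.2 y.2)).deriv]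
  ring

theorem IsTest.D_pot {G : Geometry} {f : G.points → ℝ} (hf : G.IsTest f) (y : G.points) (v : E4) :
    G.D (G.pot f) y v =
      ∫ x : G.points, G.ker1 (G.form x y) * G.form x (G.tan y v) * f x ∂G.vol := by
  have hd : DifferentiableAt ℝ (fun z => G.conv G.ker f (G.proj z)) y :=
    (hasFDerivAt_conv_ker hf (mem_cone y)).differentiableAt
  rw [D_eq (g := fun z => G.conv G.ker f (G.proj z))
    (fun x => by simp only [proj_of_mem x.2]; rfl) hd, (hasFDerivAt_conv_ker hf (mem_cone y)).fderiv,
    ← sum_conv_ker_rotD hf y (form_tan y.2 v)]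
  simp only [convDeriv, sum_apply, smul_apply, ContinuousLinearMap.comp_apply,
    PiLp.proj_apply, smul_eq_mul, (hasFDerivAt_proj y.2).fderiv, tanL_apply,
    tan_of_form_eq_zero (form_tan y.2 v), proj_of_mem y.2]

/-- The operator commutes with isometries, hence with their generators. For the regularised kernels
both sides are the same integral, by `conv_rotD` and `sum_conv_rotD`; then pass to the limit. -/
theorem IsTest.rotD_pot {G : Geometry} {f : G.points → ℝ} (hf : G.IsTest f) (a j : Fin 4) :
    G.rotD a j (G.pot f) = G.pot (G.rotD a j f) := by
  funext y
  rw [Geometry.rotD, hf.D_pot, tan_rot]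
  rw [← sum_conv_ker_rotD hf y (G.form_self_rot a j y)]
  refine tendsto_nhds_unique (tendsto_finsetSum _ fun j' _ => tendsto_finsetSum _ fun a' _ =>
    ((tendsto_conv_kern (hf.rotD a' j').continuous (hf.rotD a' j').compact y).const_mul _).mul_const _)
    ((tendsto_conv_kern (hf.rotD a j).continuous (hf.rotD a j).compact y).congr fun n => ?_)
  rw [conv_rotD (fun c hc => contDiffAt_kern n hc) hf,
    sum_conv_rotD (fun c hc => contDiffAt_kern n hc) hf y (G.form_self_rot a j y)]

/-! ### The integral operator inverts the Laplacian with mass term -/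

theorem conv_kern_rotD_rotD {G : Geometry} {f : G.points → ℝ} (hf : G.IsTest f) (n : ℕ)
    (a j : Fin 4) (y : G.points) :
    G.conv (G.kern n) (G.rotD a j (G.rotD a j f)) y =
      ∫ x : G.points, (G.lam n ^ 2 * G.ker2 (G.lam n * G.form x y) * G.form x (G.rot a j y) ^ 2 -
        G.lam n * G.ker1 (G.lam n * G.form x y) * G.form (G.rot a j x) (G.rot a j y)) * f x
        ∂G.vol := by
  rw [conv_rotD (fun c hc => contDiffAt_kern n hc) (hf.rotD a j)]
  have hk1 : ∀ c ∈ G.rng, HasDerivAt (fun c => G.lam n * G.ker1 (G.lam n * c))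
      (G.lam n * (G.lam n * G.ker2 (G.lam n * c))) c := fun c hc =>
    (hasDerivAt_comp_lam (hasDerivAt_ker1 (lam_mul_mem_dom hc n))).const_mul _
  have hk1' : ∀ c ∈ G.rng, ContDiffAt ℝ 1 (fun c => G.lam n * G.ker1 (G.lam n * c)) c :=
    fun c hc => contDiffAt_const.mul
      ((contDiffAt_ker1 (n := 1) (lam_mul_mem_dom hc n)).comp c (by fun_prop))
  have h := integral_mul_rotD (u := fun z => G.lam n * G.ker1 (G.lam n * G.form z y) *
    G.form z (G.rot a j y)) (fun x => (contDiffAt_comp_form hk1' x y).mul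
      (G.contDiff_form_left _).contDiffAt) hf a j
  rw [← integral_neg] at h
  convert h using 1
  · refine integral_congr_ae (Eventually.of_forall fun x => ?_)
    simp only [(hasDerivAt_kern n (form_mem_rng x.2 y.2)).deriv]
  · refine integral_congr_ae (Eventually.of_forall fun x => ?_)
    have h1 := (hasFDerivAt_comp_form_left (y := (y : E4)) (hk1 _ (form_mem_rng x.2 y.2))).fun_mul
      (hasFDerivAt_comp_form_left (G := G) (x := (x : E4)) (y := G.rot a j y) (hasDerivAt_id _))
    simp only [id] at h1
    simp only [h1.fderiv, add_apply, smul_apply, bil_apply, smul_eq_mul, one_mul]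
    have h2 : G.form y (G.rot a j x) = -G.form x (G.rot a j y) := by rw [form_comm, form_rot_left]
    rw [h2, G.form_comm (G.rot a j y) (G.rot a j x)]
    ring

/-- The operator (σ/2) Σ coeff coeff rot² is the Casimir form of the Laplacian. Acting on k(c), its
second-order part is governed by this sum and its first-order part by the next one; together they
give σ((1 - c²)k'' - 3ck'). -/
theorem sum_form_rot_sq {G : Geometry} {x y : E4} (hx : x ∈ G.points) (hy : y ∈ G.points) :
    ∑ a, ∑ j, G.coeff a * G.coeff j * G.form x (G.rot a j y) ^ 2 = 2 * (1 - G.form x y ^ 2) := by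
  have h1 := form_self hx
  have h2 := form_self hy
  have h3 : ∑ a, ∑ j, G.coeff a * G.coeff j * G.form x (G.rot a j y) ^ 2 =
      2 * (G.form x x * G.form y y - G.form x y ^ 2) := by
    simp only [form_rot_right]
    cases G <;> simp [Fin.sum_univ_four, met, coeff, sign, form] <;> ring
  rw [h3, h1, h2, one_mul]

theorem sum_form_rot_rot (G : Geometry) (x y : E4) :
    ∑ a, ∑ j, G.coeff a * G.coeff j * G.form (G.rot a j x) (G.rot a j y) = 6 * G.form x y := by
  simp only [rot_apply]
  cases G <;> simp [Fin.sum_univ_four, met, coeff, sign, form, e] <;> ring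

/-- Two integrations by parts move the Laplacian from f to the regularised kernel, where `delta_eq`
evaluates it. -/
theorem sum_conv_kern {G : Geometry} {f : G.points → ℝ} (hf : G.IsTest f) (n : ℕ) (y : G.points) :
    (∑ a, ∑ j, G.sign / 2 * (G.coeff a * G.coeff j) *
      G.conv (G.kern n) (G.rotD a j (G.rotD a j f)) y) - G.sign * G.conv (G.kern n) f y =
      ∫ x : G.points, G.delta n (G.form x y) * f x ∂G.vol := by
  have hcomp : ∀ {g : ℝ → ℝ}, ContinuousOn g G.dom →
      Continuous fun x : G.points => g (G.lam n * G.form x y) := fun hg =>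
    continuous_comp_form (k := fun c => _) (fun c hc => ContinuousAt.comp (f := fun c => G.lam n * c)
      (hg.continuousAt (G.isOpen_dom.mem_nhds (lam_mul_mem_dom hc n))) (by fun_prop)) y.2
  have hform : ∀ v : E4, Continuous fun x : G.points => G.form x v := fun v =>
    G.continuous_form.comp (continuous_subtype_val.prodMk continuous_const)
  have hint : ∀ a j, Integrable (fun x : G.points => (G.lam n ^ 2 *
      G.ker2 (G.lam n * G.form x y) * G.form x (G.rot a j y) ^ 2 -
        G.lam n * G.ker1 (G.lam n * G.form x y) * G.form (G.rot a j x) (G.rot a j y)) * f x)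
        G.vol := by
    intro a j
    refine Continuous.integrable_of_hasCompactSupport ?_ hf.compact.mul_left
    refine Continuous.mul (Continuous.sub ?_ ?_) hf.continuous
    · exact (continuous_const.mul (hcomp G.continuousOn_ker2)).mul ((hform _).pow 2)
    · refine (continuous_const.mul (hcomp G.continuousOn_ker1)).mul ?_
      exact G.continuous_form.comp (((G.rot a j).continuous.comp continuous_subtype_val).prodMk
        continuous_const)
  have hint0 : Integrable (fun x : G.points => G.kern n (G.form x y) * f x) G.vol :=
    ((hcomp G.continuousOn_ker).mul hf.continuous).integrable_of_hasCompactSupport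
      hf.compact.mul_left
  have h : ∀ x : G.points, G.delta n (G.form x y) * f x =
      (∑ a, ∑ j, G.sign / 2 * (G.coeff a * G.coeff j) * ((G.lam n ^ 2 *
      G.ker2 (G.lam n * G.form x y) * G.form x (G.rot a j y) ^ 2 -
        G.lam n * G.ker1 (G.lam n * G.form x y) * G.form (G.rot a j x) (G.rot a j y)) * f x))
        - G.sign * (G.kern n (G.form x y) * f x) := by
    intro x
    have e1 := sum_form_rot_sq x.2 y.2
    have e2 := G.sum_form_rot_rot x y
    rw [delta_eq (form_mem_rng x.2 y.2), kern]
    have e3 : ∀ p r t : ℝ, ∑ a, ∑ j, G.sign / 2 * (G.coeff a * G.coeff j) *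
        ((p * G.form x (G.rot a j y) ^ 2 - r * G.form (G.rot a j x) (G.rot a j y)) * t) =
        G.sign / 2 * p * t *
          (∑ a, ∑ j, G.coeff a * G.coeff j * G.form x (G.rot a j y) ^ 2) -
        G.sign / 2 * r * t *
          (∑ a, ∑ j, G.coeff a * G.coeff j * G.form (G.rot a j x) (G.rot a j y)) := by
      intro p r t
      simp only [Finset.mul_sum, ← Finset.sum_sub_distrib]
      exact Finset.sum_congr rfl fun a _ => Finset.sum_congr rfl fun j _ => by ring
    rw [e3, e1, e2]
    ring
  simp only [h]
  rw [integral_sub (integrable_finsetSum _ fun a _ => integrable_finsetSum _ fun j _ =>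
      (hint a j).const_mul _) (hint0.const_mul _), integral_const_mul,
    integral_finsetSum _ fun a _ => integrable_finsetSum _ fun j _ => (hint a j).const_mul _]
  congr 1
  refine Finset.sum_congr rfl fun a _ => ?_
  rw [integral_finsetSum _ fun j _ => (hint a j).const_mul _]
  refine Finset.sum_congr rfl fun j _ => ?_
  rw [integral_const_mul, conv_kern_rotD_rotD hf]

/-- On the values of ⟨x, y⟩ the distance of c from 1 is affine in c. This is why affine functions
suffice for testing the approximate identity. -/
theorem one_sub_abs {G : Geometry} {c : ℝ} (hc : c ∈ G.rng) : |c - 1| = G.sign * (1 - c) := by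
  cases G with
  | spherical => rw [abs_of_nonpos (by linarith [hc.2]), sign]; ring
  | hyperbolic =>
    have h : 1 ≤ c := hc
    rw [abs_of_nonneg (by linarith), sign]; ring

theorem integrableOn_delta (G : Geometry) {M : ℝ} (hM : 1 < M) (n : ℕ) (a b : ℝ) :
    IntegrableOn (fun c => G.delta n c * (a + b * c)) (Set.Iic M) G.nu := by
  rw [integrableOn_nu hM]
  refine (ContinuousOn.integrableOn_Icc ?_).mono_set Set.Ioc_subset_Icc_self
  have h1 := G.continuous_q
  exact (by fun_prop : Continuous fun c => 4 * Real.pi * √(G.q c)).continuousOn.mul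
    (((G.continuous_deltaAux n).2.2.mono G.Icc_subset_rng).mul (by fun_prop))

theorem aestronglyMeasurable_delta (G : Geometry) (n : ℕ) (a b : ℝ) :
    AEStronglyMeasurable (fun c => G.delta n c * (a + b * c)) G.nu :=
  aestronglyMeasurable_nu (((G.continuous_deltaAux n).2.2.mono G.dom_subset_rng).mul (by fun_prop))

/-- The usual argument for nonnegative approximate identities, with |f(x) - f(y)| dominated by an
affine function of c whose value at c = 1 is small. -/
theorem tendsto_integral_delta_mul {G : Geometry} {f : G.points → ℝ} (hf : Continuous f)
    (hc : HasCompactSupport f) (y : G.points) :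
    Tendsto (fun n => ∫ x : G.points, G.delta n (G.form x y) * f x ∂G.vol) atTop (𝓝 (f y)) := by
  obtain ⟨B, hB0, hB⟩ := exists_abs_le hf hc
  obtain ⟨M, hM, hM'⟩ := exists_form_le' hc y
  -- The cutoff c ≤ M contains the support of f and makes the affine majorants integrable on H³.
  set ind : ℕ → G.points → ℝ := fun n x =>
    (Set.Iic M).indicator (fun c => G.delta n c) (G.form x y) with hind
  have hind_mul : ∀ n (a b : ℝ) (x : G.points), ind n x * (a + b * G.form x y) =
      (Set.Iic M).indicator (fun c => G.delta n c * (a + b * c)) (G.form x y) := by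
    intro n a b x
    simp only [hind, Set.indicator]
    split_ifs <;> simp
  have hind0 : ∀ n x, 0 ≤ ind n x := by
    intro n x
    simp only [hind, Set.indicator]
    split_ifs
    · exact delta_nonneg (form_mem_rng x.2 y.2) n
    · exact le_rfl
  have hint : ∀ n (a b : ℝ), Integrable (fun x : G.points => ind n x * (a + b * G.form x y))
      G.vol := by
    intro n a b
    simp only [hind_mul]
    exact integrable_indicator_comp_form (G.integrableOn_delta hM n a b) y
  have hval : ∀ n (a b : ℝ), ∫ x : G.points, ind n x * (a + b * G.form x y) ∂G.vol =
      ∫ c in Set.Iic M, G.delta n c * (a + b * c) ∂G.nu := by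
    intro n a b
    simp only [hind_mul]
    exact integral_indicator_comp_form (G.aestronglyMeasurable_delta n a b) y M
  have hlim : ∀ a b : ℝ, Tendsto (fun n => ∫ x : G.points, ind n x * (a + b * G.form x y) ∂G.vol)
      atTop (𝓝 (a + b)) := by
    intro a b
    simp only [hval]
    exact G.tendsto_integral_delta hM a b
  have hint1 : ∀ n, Integrable (ind n) G.vol := fun n => by simpa using hint n 1 0
  have hdiff : Tendsto (fun n => ∫ x, ind n x * (f x - f y) ∂G.vol) atTop (𝓝 0) := by
    rw [Metric.tendsto_atTop']
    intro ε hε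
    obtain ⟨η, hη, hη'⟩ := exists_form_lt_imp_mem y
      (hf.continuousAt.preimage_mem_nhds (Metric.ball_mem_nhds (f y) (half_pos hε)))
    -- Where |c - 1| < η continuity gives ε/2; elsewhere 2B ≤ (2B/η)|c - 1|. The right side is ε/2 +
    -- (2B/η)|c - 1| in affine form, so its integrals tend to ε/2.
    have hle : ∀ x : G.points, |f x - f y| ≤
        (ε / 2 + 2 * B / η * G.sign) + (-(2 * B / η * G.sign)) * G.form x y := by
      intro x
      have h1 : |G.form x y - 1| = G.sign * (1 - G.form x y) := one_sub_abs (form_mem_rng x.2 y.2)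
      have h2 : (ε / 2 + 2 * B / η * G.sign) + (-(2 * B / η * G.sign)) * G.form x y =
          ε / 2 + 2 * B / η * |G.form x y - 1| := by rw [h1]; ring
      rw [h2]
      rcases lt_or_ge |G.form x y - 1| η with h | h
      · have h3 := hη' x h
        rw [Set.mem_preimage, Metric.mem_ball, Real.dist_eq] at h3
        have : 0 ≤ 2 * B / η * |G.form x y - 1| := by positivity
        linarith
      · have h3 : 2 * B ≤ 2 * B / η * |G.form x y - 1| := by
          rw [div_mul_eq_mul_div, le_div_iff₀ hη]
          gcongr
        have h4 := (abs_sub (f x) (f y)).trans (add_le_add (hB x) (hB y))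
        linarith
    have h5 := hlim (ε / 2 + 2 * B / η * G.sign) (-(2 * B / η * G.sign))
    have h6 := h5.eventually_lt_const (show _ < ε by linarith)
    obtain ⟨N, hN⟩ := eventually_atTop.1 h6
    refine ⟨N, fun n hn => ?_⟩
    rw [Real.dist_eq, sub_zero]
    rw [← Real.norm_eq_abs]
    refine lt_of_le_of_lt (norm_integral_le_of_norm_le (hint n _ _)
      (Eventually.of_forall fun x => ?_)) (hN n hn.le)
    rw [Real.norm_eq_abs, abs_mul, abs_of_nonneg (hind0 n x)]
    exact mul_le_mul_of_nonneg_left (hle x) (hind0 n x)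
  have hone := (hlim 1 0).const_mul (f y)
  have hsum := hdiff.add hone
  simp only [add_zero, zero_mul, mul_one, zero_add] at hsum
  refine hsum.congr fun n => ?_
  have hb : Integrable (fun x => ind n x * (f x - f y)) G.vol := by
    refine (hint1 n).mul_bdd (c := 2 * B)
      (by exact (hf.sub continuous_const).aestronglyMeasurable)
      (Eventually.of_forall fun x => ?_)
    refine (abs_sub (f x) (f y)).trans ?_
    linarith [hB x, hB y]
  rw [← integral_const_mul, ← integral_add hb ((hint1 n).const_mul _)]
  refine integral_congr_ae (Eventually.of_forall fun x => ?_)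
  simp only
  by_cases hx : G.form x y ≤ M
  · have : ind n x = G.delta n (G.form x y) := Set.indicator_of_mem (Set.mem_Iic.2 hx) _
    rw [this]; ring
  · have h1 : f x = 0 := by
      by_contra h
      exact hx (hM' x h)
    rw [h1]; ring

/-- `ker` is the fundamental solution of Δ - σ. The rotations pass through `pot` onto f, where the
kernel may be regularised; the result is ∫ `delta` · f, which tends to f(y). -/
theorem IsTest.laplacian_pot {G : Geometry} {f : G.points → ℝ} (hf : G.IsTest f) (y : G.points) :
    (∑ a, ∑ j, G.sign / 2 * (G.coeff a * G.coeff j) *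
      G.rotD a j (G.rotD a j (G.pot f)) y) - G.sign * G.pot f y = f y := by
  simp only [hf.rotD_pot, (hf.rotD _ _).rotD_pot]
  refine tendsto_nhds_unique (Tendsto.sub (tendsto_finsetSum _ fun a _ => tendsto_finsetSum _
    fun j _ => (tendsto_conv_kern ((hf.rotD a j).rotD a j).continuous
      ((hf.rotD a j).rotD a j).compact y).const_mul _)
    ((tendsto_conv_kern hf.continuous hf.compact y).const_mul _)) ?_
  simp only [sum_conv_kern hf]
  exact tendsto_integral_delta_mul hf.continuous hf.compact y

/-! ### Algebra of the cross product -/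

/-- The `3 × 3` minors. -/
def minor (y v w : E4) (a b c : Fin 4) : ℝ :=
  y a * (v b * w c - v c * w b) - y b * (v a * w c - v c * w a) + y c * (v a * w b - v b * w a)

theorem volForm_eq (y u v w : E4) : volForm y u v w =
    minor y u v 0 1 2 * w 3 - minor y u v 0 1 3 * w 2 + minor y u v 0 2 3 * w 1 -
      minor y u v 1 2 3 * w 0 := by
  simp [volForm, Matrix.det_succ_row_zero, Fin.sum_univ_succ, Fin.succAbove, minor]
  ring

theorem cross_eq (G : Geometry) (y v w : E4) : G.cross y v w =
    !₂[-(G.sign * minor y v w 1 2 3), minor y v w 0 2 3, -minor y v w 0 1 3, minor y v w 0 1 2] := by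
  ext i
  fin_cases i <;> simp [cross, raise, coeff, volForm_eq, e]

/-- The cross product as a linear map in the last two arguments. -/
def crossL (G : Geometry) (y : E4) : E4 →ₗ[ℝ] E4 →ₗ[ℝ] E4 :=
  LinearMap.mk₂ ℝ (G.cross y)
    (fun u v w => by
      ext i; fin_cases i <;> simp [cross_eq, minor] <;> ring)
    (fun c v w => by
      ext i; fin_cases i <;> simp [cross_eq, minor] <;> ring)
    (fun u v w => by
      ext i; fin_cases i <;> simp [cross_eq, minor] <;> ring)
    (fun c v w => by
      ext i; fin_cases i <;> simp [cross_eq, minor] <;> ring)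

theorem crossL_apply (G : Geometry) (y v w : E4) : G.crossL y v w = G.cross y v w := rfl

theorem minor_self (y w : E4) (a b c : Fin 4) :
    minor y y w a b c = 0 ∧ minor y w y a b c = 0 ∧ minor y w w a b c = 0 := by
  refine ⟨?_, ?_, ?_⟩ <;> rw [minor] <;> ring

theorem cross_self_left (G : Geometry) (y w : E4) : G.cross y y w = 0 := by
  ext i; fin_cases i <;> simp [cross_eq, minor_self]

theorem cross_self_right (G : Geometry) (y w : E4) : G.cross y w y = 0 := by
  ext i; fin_cases i <;> simp [cross_eq, minor_self]

theorem cross_self (G : Geometry) (y w : E4) : G.cross y w w = 0 := by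
  ext i; fin_cases i <;> simp [cross_eq, minor_self]

theorem cross_anticomm (G : Geometry) (y v w : E4) : G.cross y v w = -G.cross y w v := by
  ext i; fin_cases i <;> simp [cross_eq, minor] <;> ring

theorem cross_tan (G : Geometry) (y v w : E4) : G.cross y v (G.tan y w) = G.cross y v w := by
  rw [tan, ← crossL_apply, map_sub, map_smul, crossL_apply, crossL_apply, cross_self_right,
    smul_zero, sub_zero]

theorem form_cross (G : Geometry) (y v w : E4) : G.form y (G.cross y v w) = 0 := by
  cases G <;> simp [form, cross_eq, minor, sign] <;> ring

theorem raise_form (G : Geometry) (v : E4) : G.raise (fun i => G.form v (e i)) = G.sign • v := by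
  ext i
  simp only [raise, form_e, PiLp.smul_apply, smul_eq_mul, met]
  linear_combination (G.sign * v i) * G.coeff_mul_self i

/-- The algebraic expression giving the curl in terms of partial derivatives. -/
def curlSum (G : Geometry) (y : E4) (w : Fin 4 → E4) : E4 :=
  ∑ l, G.coeff l • G.cross y (e l) (w l)

theorem curlSum_eq (G : Geometry) (y : E4) (w : Fin 4 → E4) : G.curlSum y w =
    !₂[-(y 1 * (w 2 3 - w 3 2) - y 2 * (w 1 3 - w 3 1) + y 3 * (w 1 2 - w 2 1)) * G.sign,
      y 0 * (w 2 3 - w 3 2) - y 2 * (G.sign * w 0 3 - w 3 0) + y 3 * (G.sign * w 0 2 - w 2 0),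
      -(y 0 * (w 1 3 - w 3 1) - y 1 * (G.sign * w 0 3 - w 3 0) + y 3 * (G.sign * w 0 1 - w 1 0)),
      y 0 * (w 1 2 - w 2 1) - y 1 * (G.sign * w 0 2 - w 2 0) + y 2 * (G.sign * w 0 1 - w 1 0)] := by
  ext i
  fin_cases i <;> simp [curlSum, Fin.sum_univ_four, coeff, cross_eq, minor, e] <;> ring

theorem curlSum_apply (G : Geometry) (y : E4) (w : Fin 4 → E4) :
    G.curlSum y w 0 =
      -(y 1 * (w 2 3 - w 3 2) - y 2 * (w 1 3 - w 3 1) + y 3 * (w 1 2 - w 2 1)) * G.sign ∧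
    G.curlSum y w 1 =
      y 0 * (w 2 3 - w 3 2) - y 2 * (G.sign * w 0 3 - w 3 0) + y 3 * (G.sign * w 0 2 - w 2 0) ∧
    G.curlSum y w 2 =
      -(y 0 * (w 1 3 - w 3 1) - y 1 * (G.sign * w 0 3 - w 3 0) + y 3 * (G.sign * w 0 1 - w 1 0)) ∧
    G.curlSum y w 3 =
      y 0 * (w 1 2 - w 2 1) - y 1 * (G.sign * w 0 2 - w 2 0) + y 2 * (G.sign * w 0 1 - w 1 0) := by
  rw [curlSum_eq]
  exact ⟨rfl, rfl, rfl, rfl⟩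

theorem raise_apply (G : Geometry) (l : Fin 4 → ℝ) (i : Fin 4) :
    G.raise l i = G.coeff i * l i := rfl

theorem coeff_apply (G : Geometry) :
    G.coeff 0 = G.sign ∧ G.coeff 1 = 1 ∧ G.coeff 2 = 1 ∧ G.coeff 3 = 1 := by
  simp [coeff]

/-- The pointwise algebra of curl curl = -Δ + grad div + curvature. Here P and Q stand for the first
and second partial derivatives of an extension that is homogeneous of degree 0, and `hP`, `hQP` are
Euler's relations for it and its derivatives. -/
theorem curlSum_curlSum {G : Geometry} {y : E4} (hy : y ∈ G.points) (P : Fin 4 → E4)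
    (Q : Fin 4 → Fin 4 → E4) (hQ : ∀ i j, Q i j = Q j i)
    (hP : ∀ k, ∑ i, y i * P i k = 0) (hQP : ∀ i k, (∑ j, y j * Q i j k) + P i k = 0) :
    G.curlSum y (fun l => G.curlSum (e l) P + G.curlSum y (Q l)) =
      -G.tan y (∑ i, G.coeff i • Q i i) + (G.raise (fun i => ∑ l, Q i l l) +
        (G.sign * ∑ l, P l l) • y) - G.raise (fun i => G.form y (P i)) := by
  have hn := form_self hy
  ext k
  have h1 : (∑ l, ((∑ j, y j * Q l j l) + P l l)) = 0 := Finset.sum_eq_zero fun l _ => hQP l l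
  have h2 : ∑ m, G.met m * y m * ((∑ j, y j * Q k j m) + P k m) = 0 :=
    Finset.sum_eq_zero fun m _ => by rw [hQP, mul_zero]
  have h3 : ∑ l, y l * ((∑ j, y j * Q l j k) + P l k) = 0 :=
    Finset.sum_eq_zero fun l _ => by rw [hQP, mul_zero]
  have h4 := hP k
  have q10 := hQ 1 0
  have q20 := hQ 2 0
  have q30 := hQ 3 0
  have q21 := hQ 2 1
  have q31 := hQ 3 1
  have q32 := hQ 3 2
  -- The difference of the two sides is an explicit combination of Euler's relations and ⟨y, y⟩ - 1,
  -- a polynomial identity to be checked in coordinates.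
  have main : G.curlSum y (fun l => G.curlSum (e l) P + G.curlSum y (Q l)) k -
      (-G.tan y (∑ i, G.coeff i • Q i i) + (G.raise (fun i => ∑ l, Q i l l) +
        (G.sign * ∑ l, P l l) • y) - G.raise (fun i => G.form y (P i))) k =
      G.sign * (∑ i, y i * P i k) - G.sign * y k * (∑ l, ((∑ j, y j * Q l j l) + P l l)) -
      G.coeff k * (∑ m, G.met m * y m * ((∑ j, y j * Q k j m) + P k m)) +
      G.sign * (∑ l, y l * ((∑ j, y j * Q l j k) + P l k)) +
      (G.form y y - 1) * (G.coeff k * (∑ l, Q k l l) - (∑ i, G.coeff i • Q i i) k) := by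
    clear h1 h2 h3 h4 hn hQP hP hQ hy
    have hk : k = 0 ∨ k = 1 ∨ k = 2 ∨ k = 3 := by fin_cases k <;> simp
    have hs : G.sign = 1 ∨ G.sign = -1 := by cases G <;> simp [sign]
    rcases hs with hs | hs <;> rcases hk with rfl | rfl | rfl | rfl <;>
    · simp only [Fin.sum_univ_four, q10, q20, q30, q21, q31, q32, curlSum_apply, tan, raise_apply,
        form, PiLp.add_apply, PiLp.sub_apply, PiLp.neg_apply, PiLp.smul_apply, smul_eq_mul, met,
        coeff_apply, e_apply, Fin.reduceEq, if_true, if_false, hs]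
      ring
  rw [h1, h2, h3, h4, hn] at main
  linarith

/-- The algebra of div curl = 0: symmetric second derivatives are contracted with the antisymmetric
volume form, and the first-order terms also cancel. -/
theorem sum_curlSum_apply (G : Geometry) (y : E4) (P : Fin 4 → E4)
    (Q : Fin 4 → Fin 4 → E4) (hQ : ∀ i j, Q i j = Q j i) :
    ∑ l, (G.curlSum (e l) P + G.curlSum y (Q l)) l = 0 := by
  simp only [curlSum_eq, Fin.sum_univ_four, hQ 1 0, hQ 2 0, hQ 3 0, hQ 2 1, hQ 3 1, hQ 3 2]
  simp [e]
  ring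

theorem form_curlSum (G : Geometry) (y : E4) (w : Fin 4 → E4) : G.form y (G.curlSum y w) = 0 := by
  rw [curlSum, ← bil_apply, map_sum]
  refine Finset.sum_eq_zero fun l _ => ?_
  rw [map_smul, bil_apply, form_cross, smul_zero]

/-- On functions homogeneous of degree 0 the Casimir operator of the isometry group agrees, at
points with ⟨y, y⟩ = 1, with the flat operator Σ coeff ∂ᵢ². Euler's relations account for the
difference. -/
theorem sum_rot_rot {G : Geometry} {y : E4} (hy : y ∈ G.points) (P : Fin 4 → ℝ)
    (Q : Fin 4 → Fin 4 → ℝ) (hQ : ∀ i j, Q i j = Q j i) (hP : ∑ i, y i * P i = 0)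
    (hQP : ∀ i, (∑ j, y j * Q i j) + P i = 0) :
    ∑ a, ∑ j, G.sign / 2 * (G.coeff a * G.coeff j) *
      ((∑ l, ∑ m, (G.rot a j y) l * (G.rot a j y) m * Q l m) +
        ∑ l, (G.rot a j (G.rot a j y)) l * P l) = ∑ i, G.coeff i * Q i i := by
  have hn := form_self hy
  have h3 : ∑ l, y l * ((∑ j, y j * Q l j) + P l) = 0 :=
    Finset.sum_eq_zero fun l _ => by rw [hQP, mul_zero]
  have main : (∑ a, ∑ j, G.sign / 2 * (G.coeff a * G.coeff j) *
      ((∑ l, ∑ m, (G.rot a j y) l * (G.rot a j y) m * Q l m) +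
        ∑ l, (G.rot a j (G.rot a j y)) l * P l)) - ∑ i, G.coeff i * Q i i =
      (G.form y y - 1) * (∑ i, G.coeff i * Q i i) -
        G.sign * (∑ l, y l * ((∑ j, y j * Q l j) + P l)) - 2 * G.sign * (∑ i, y i * P i) := by
    have q10 := hQ 1 0
    have q20 := hQ 2 0
    have q30 := hQ 3 0
    have q21 := hQ 2 1
    have q31 := hQ 3 1
    have q32 := hQ 3 2
    clear hn h3 hQP hP hQ hy
    have hs : G.sign = 1 ∨ G.sign = -1 := by cases G <;> simp [sign]
    rcases hs with hs | hs <;>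
    · simp only [Fin.sum_univ_four, q10, q20, q30, q21, q31, q32, rot_apply, form,
        PiLp.sub_apply, PiLp.smul_apply, smul_eq_mul, met,
        coeff_apply, e_apply, Fin.reduceEq, if_true, if_false, hs]
      ring
  rw [h3, hP, hn] at main
  linarith

/-! ### Vector calculus in terms of extensions -/

theorem tan_e (G : Geometry) (y : E4) (i : Fin 4) :
    G.tan y (e i) = e i - (G.met i * y i) • y := by rw [tan, form_e]

theorem sum_coeff_met (G : Geometry) (y : E4) :
    ∑ i, (G.coeff i * (G.met i * y i)) • e i = G.sign • y := by
  conv_rhs => rw [eq_sum_e y, Finset.smul_sum]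
  refine Finset.sum_congr rfl fun i _ => ?_
  rw [smul_smul, met]
  congr 1
  linear_combination (G.sign * y i) * G.coeff_mul_self i

/-- All tangential projections in the definition can be dropped. The outer one is absorbed by the
cross product, and the normal parts of the directions sum to a cross product with y as a factor. -/
theorem curl_eq {G : Geometry} {W : G.points → E4} {g : E4 → E4} {g' : E4 →L[ℝ] E4}
    (h : ∀ x : G.points, g x = W x) {y : G.points} (hg : HasFDerivAt g g' y) :
    G.curl W y = G.curlSum y fun l => g' (e l) := by
  have h0 : ∑ l, G.coeff l • G.cross y (e l) ((G.met l * (y : E4) l) • g' y) = 0 := by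
    have h1 : ∀ l, G.coeff l • G.cross y (e l) ((G.met l * (y : E4) l) • g' y) =
        G.crossL y ((G.coeff l * (G.met l * (y : E4) l)) • e l) (g' y) := by
      intro l
      rw [← crossL_apply, map_smul, map_smul, LinearMap.smul_apply, smul_smul]
    simp only [h1]
    rw [← LinearMap.sum_apply, ← map_sum, sum_coeff_met, map_smul, LinearMap.smul_apply,
      crossL_apply, cross_self_left, smul_zero]
  rw [curl, curlSum, ← sub_zero (∑ l, _ • G.cross _ (e l) (g' (e l))), ← h0,
    ← Finset.sum_sub_distrib]
  refine Finset.sum_congr rfl fun l _ => ?_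
  rw [cov, cross_tan, D_eq_of_hasFDerivAt h hg, tan_e, map_sub, map_smul, ← crossL_apply, map_sub,
    smul_sub]
  rfl

/-- The trace over the tangent space is the ambient trace of the derivative minus its normal-normal
entry. -/
theorem div_eq {G : Geometry} {W : G.points → E4} {g : E4 → E4} {g' : E4 →L[ℝ] E4}
    (h : ∀ x : G.points, g x = W x) {y : G.points} (hg : HasFDerivAt g g' y) :
    G.div W y = ∑ l, (g' (e l)) l - G.form y (g' y) := by
  have h1 : ∀ l, (G.cov W y (e l)) l = (g' (e l)) l - G.met l * (y : E4) l * (g' y) l -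
      G.form y (g' ((y : E4) l • e l)) + (G.met l * (y : E4) l * (y : E4) l) * G.form y (g' y) := by
    intro l
    rw [cov, D_eq_of_hasFDerivAt h hg, tan_e, map_sub, map_smul, tan, form_sub_right,
      form_smul_right, map_smul, form_smul_right]
    simp only [PiLp.sub_apply, PiLp.smul_apply, smul_eq_mul]
    ring
  have h2 : ∑ l, G.form y (g' ((y : E4) l • e l)) = G.form y (g' y) := by
    conv_rhs => rw [eq_sum_e (y : E4)]
    rw [map_sum, ← bil_apply, map_sum]
    simp only [bil_apply, ← eq_sum_e]
  rw [div]
  simp only [h1]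
  rw [Finset.sum_add_distrib, Finset.sum_sub_distrib, Finset.sum_sub_distrib, h2, ← form_eq_sum,
    ← Finset.sum_mul, ← form_eq_sum, form_self y.2]
  ring

theorem grad_eq {G : Geometry} {f : G.points → ℝ} {g : E4 → ℝ} {g' : E4 →L[ℝ] ℝ}
    (h : ∀ x : G.points, g x = f x) {y : G.points} (hg : HasFDerivAt g g' y) :
    G.grad f y = G.raise (fun i => g' (e i)) - (G.sign * g' y) • (y : E4) := by
  ext i
  simp only [grad, raise_apply, PiLp.sub_apply, PiLp.smul_apply, smul_eq_mul]
  rw [D_eq_of_hasFDerivAt h hg, tan_e, map_sub, map_smul, smul_eq_mul, met]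
  linear_combination (-(G.sign * (y : E4) i * g' y)) * G.coeff_mul_self i

/-- Euler's relation: the extension is constant on the ray through z. -/
theorem fderiv_ext_self {F : Type*} [NormedAddCommGroup F] [NormedSpace ℝ F] {G : Geometry}
    {f : G.points → F} (hf : G.Smooth f) {z : E4} (hz : z ∈ G.cone) :
    fderiv ℝ (G.ext f) z z = 0 := by
  have h1 : HasDerivAt (fun t : ℝ => t • z) z 1 := by
    simpa using (hasDerivAt_id (1 : ℝ)).smul_const z
  have h2 : HasFDerivAt (G.ext f) (fderiv ℝ (G.ext f) z) ((1 : ℝ) • z) := by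
    rw [one_smul]; exact (hf.differentiableAt hz).hasFDerivAt
  have h3 := h2.comp_hasDerivAt (1 : ℝ) h1
  have h4 : (G.ext f ∘ fun t : ℝ => t • z) =ᶠ[𝓝 1] fun _ => G.ext f z := by
    filter_upwards [lt_mem_nhds (zero_lt_one' ℝ)] with t ht
    have h5 : G.proj (t • z) = G.proj z := by
      rw [proj, form_smul_left, form_smul_right, ← mul_assoc, Real.sqrt_mul (by positivity),
        Real.sqrt_mul_self ht.le, mul_inv, smul_smul, mul_right_comm, inv_mul_cancel₀ ht.ne',
        one_mul, proj]
    simp only [Function.comp_apply, ext, h5]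
  exact h3.unique ((hasDerivAt_const (1 : ℝ) (G.ext f z)).congr_of_eventuallyEq h4)

/-- The expression `curlSum` as a continuous bilinear map. -/
def curlSumL (G : Geometry) : E4 →L[ℝ] (Fin 4 → E4) →L[ℝ] E4 :=
  LinearMap.toContinuousBilinearMap <| LinearMap.mk₂ ℝ G.curlSum
    (fun u v w => by
      ext i; fin_cases i <;> simp [curlSum_eq] <;> ring)
    (fun c v w => by
      ext i; fin_cases i <;> simp [curlSum_eq] <;> ring)
    (fun u v w => by
      ext i; fin_cases i <;> simp [curlSum_eq] <;> ring)
    (fun c v w => by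
      ext i; fin_cases i <;> simp [curlSum_eq] <;> ring)

theorem curlSumL_apply (G : Geometry) (y : E4) (w : Fin 4 → E4) :
    G.curlSumL y w = G.curlSum y w := rfl

theorem precomp_add_apply {E F H : Type*} [NormedAddCommGroup E] [NormedSpace ℝ E]
    [NormedAddCommGroup F] [NormedSpace ℝ F] [NormedAddCommGroup H] [NormedSpace ℝ H]
    (B : E →L[ℝ] F →L[ℝ] H) (u : E) (w : F) (L : E4 →L[ℝ] F) (L' : E4 →L[ℝ] E) (v : E4) :
    (B.precompR E4 u L + B.precompL E4 L' w) v = B u (L v) + B (L' v) w := rfl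

/-- The first partial derivatives of the homogeneous extension. -/
def pd {G : Geometry} (A : G.points → E4) (z : E4) (i : Fin 4) : E4 := fderiv ℝ (G.ext A) z (e i)

/-- The second partial derivatives of the homogeneous extension. -/
def pd2 {G : Geometry} (A : G.points → E4) (z : E4) (i j : Fin 4) : E4 :=
  fderiv ℝ (fderiv ℝ (G.ext A)) z (e i) (e j)

section

variable {G : Geometry} {A : G.points → E4} (hA : G.Smooth A)

include hA

theorem Smooth.contDiffAt_fderiv_ext {z : E4} (hz : z ∈ G.cone) :
    ContDiffAt ℝ ∞ (fderiv ℝ (G.ext A)) z :=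
  (hA.contDiffAt hz).fderiv_right (m := ∞) (by simp)

theorem Smooth.hasFDerivAt_fderiv_ext {z : E4} (hz : z ∈ G.cone) :
    HasFDerivAt (fderiv ℝ (G.ext A)) (fderiv ℝ (fderiv ℝ (G.ext A)) z) z :=
  ((hA.contDiffAt_fderiv_ext hz).differentiableAt (by simp)).hasFDerivAt

theorem Smooth.hasFDerivAt_pd {z : E4} (hz : z ∈ G.cone) :
    HasFDerivAt (pd A)
      (ContinuousLinearMap.pi fun i => (fderiv ℝ (fderiv ℝ (G.ext A)) z).flip (e i)) z := by
  refine hasFDerivAt_pi.2 fun i => ?_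
  have h := (hA.hasFDerivAt_fderiv_ext hz).clm_apply (hasFDerivAt_const (e i) z)
  refine h.congr_fderiv ?_
  rw [ContinuousLinearMap.comp_zero, zero_add]

theorem Smooth.contDiffAt_pd {z : E4} (hz : z ∈ G.cone) : ContDiffAt ℝ ∞ (pd A) z :=
  contDiffAt_pi.2 fun _ => (hA.contDiffAt_fderiv_ext hz).clm_apply contDiffAt_const

theorem Smooth.pd2_symm {z : E4} (hz : z ∈ G.cone) (i j : Fin 4) : pd2 A z i j = pd2 A z j i :=
  (hA.contDiffAt hz).isSymmSndFDerivAt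
    (by rw [minSmoothness_of_isRCLikeNormedField]; exact WithTop.coe_le_coe.2 le_top) _ _

theorem Smooth.fderiv_fderiv_self {z : E4} (hz : z ∈ G.cone) (v : E4) :
    fderiv ℝ (fderiv ℝ (G.ext A)) z v z + fderiv ℝ (G.ext A) z v = 0 := by
  have h1 := (hA.hasFDerivAt_fderiv_ext hz).clm_apply (hasFDerivAt_id z)
  have h2 : (fun w => fderiv ℝ (G.ext A) w (id w)) =ᶠ[𝓝 z] fun _ => 0 := by
    filter_upwards [G.isOpen_cone.mem_nhds hz] with w hw
    exact fderiv_ext_self hA hw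
  have h3 := h1.unique ((hasFDerivAt_const (0 : E4) z).congr_of_eventuallyEq h2)
  have h4 := congrArg (fun L : E4 →L[ℝ] E4 => L v) h3
  simp only [add_apply, ContinuousLinearMap.comp_apply, ContinuousLinearMap.flip_apply, id,
    ContinuousLinearMap.id_apply, zero_apply] at h4
  rw [add_comm]; exact h4

theorem Smooth.sum_mul_pd (y : G.points) (k : Fin 4) : ∑ i, (y : E4) i * pd A y i k = 0 := by
  have h := fderiv_ext_self hA (mem_cone y)
  have h1 : fderiv ℝ (G.ext A) y y = ∑ i, (y : E4) i • pd A y i := by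
    conv_lhs => rw [eq_sum_e (y : E4), map_sum]
    simp only [map_smul, ← eq_sum_e, pd]
  rw [h1] at h
  have h2 := congrArg (fun v : E4 => v k) h
  simpa using h2

theorem Smooth.sum_mul_pd2 (y : G.points) (i k : Fin 4) :
    (∑ j, (y : E4) j * pd2 A y i j k) + pd A y i k = 0 := by
  have h := hA.fderiv_fderiv_self (mem_cone y) (e i)
  have h1 : fderiv ℝ (fderiv ℝ (G.ext A)) y (e i) y = ∑ j, (y : E4) j • pd2 A y i j := by
    conv_lhs => rw [eq_sum_e (y : E4), map_sum]
    simp only [map_smul, ← eq_sum_e, pd2]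
  rw [h1] at h
  have h2 := congrArg (fun v : E4 => v k) h
  simpa [pd] using h2

theorem Smooth.curl_apply (y : G.points) : G.curlSum y (pd A y) = G.curl A y :=
  (curl_eq (fun x => ext_coe A x) (hA.hasFDerivAt y)).symm

theorem Smooth.hasFDerivAt_curl (y : G.points) :
    HasFDerivAt (fun z => G.curlSum z (pd A z))
      (G.curlSumL.precompR E4 y (ContinuousLinearMap.pi fun i =>
        (fderiv ℝ (fderiv ℝ (G.ext A)) y).flip (e i)) +
        G.curlSumL.precompL E4 (ContinuousLinearMap.id ℝ E4) (pd A y)) (y : E4) :=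
  G.curlSumL.hasFDerivAt_of_bilinear (hasFDerivAt_id _) (hA.hasFDerivAt_pd (mem_cone y))

theorem Smooth.curl : G.Smooth (G.curl A) := by
  refine smooth_of_contDiffAt (g := fun z => G.curlSum z (pd A z)) hA.curl_apply fun y => ?_
  exact (G.curlSumL.contDiff.contDiffAt.comp _ contDiffAt_id).clm_apply
    (hA.contDiffAt_pd (mem_cone y))

theorem Smooth.div_curl (y : G.points) : G.div (G.curl A) y = 0 := by
  rw [div_eq hA.curl_apply (hA.hasFDerivAt_curl y)]
  have h1 := G.sum_curlSum_apply y (pd A y) (pd2 A y) (hA.pd2_symm (mem_cone y))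
  rw [precomp_add_apply, curlSumL_apply, curlSumL_apply, form_add_right, form_curlSum,
    ContinuousLinearMap.id_apply, form_curlSum, add_zero, sub_zero, ← h1]
  exact Finset.sum_congr rfl fun l _ => by rw [add_comm]; rfl

/-- The scalar function `x ↦ ∑ ∂ᵢAᵢ - ⟨x, A⟩`, the tangential divergence of `A`. -/
theorem Smooth.grad_divergence (y : G.points) :
    G.grad (fun x => ∑ l, pd A x l l - G.form x (A x)) y =
      G.raise (fun i => ∑ l, pd2 A y i l l) + (G.sign * ∑ l, pd A y l l) • (y : E4) -
        G.raise (fun i => G.form y (pd A y i)) - G.sign • G.tan y (A y) := by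
  have h1 : HasFDerivAt (fun z => ∑ l, pd A z l l) (∑ l, ((EuclideanSpace.proj l : E4 →L[ℝ] ℝ).comp
      ((fderiv ℝ (fderiv ℝ (G.ext A)) y).flip (e l)))) (y : E4) :=
    HasFDerivAt.fun_sum fun l _ => (EuclideanSpace.proj l : E4 →L[ℝ] ℝ).hasFDerivAt.comp (y : E4)
      (hasFDerivAt_pi.1 (hA.hasFDerivAt_pd (mem_cone y)) l)
  have h2 := G.bil.hasFDerivAt_of_bilinear (hasFDerivAt_id (y : E4)) (hA.hasFDerivAt y)
  rw [grad_eq (g := fun z => ∑ l, pd A z l l - G.bil (id z) (G.ext A z))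
    (fun x => by rw [ext_coe, bil_apply, id]) (h1.fun_sub h2)]
  -- The first partial derivatives are homogeneous of degree -1, and the second derivative is
  -- symmetric.
  have h3 : ∑ l, (fderiv ℝ (fderiv ℝ (G.ext A)) y y (e l)) l = -∑ l, pd A y l l := by
    rw [eq_neg_iff_add_eq_zero, ← Finset.sum_add_distrib]
    refine Finset.sum_eq_zero fun l _ => ?_
    have h4 := congrArg (fun v : E4 => v l) (hA.fderiv_fderiv_self (mem_cone y) (e l))
    have h5 := (hA.contDiffAt (mem_cone y)).isSymmSndFDerivAt
      (by rw [minSmoothness_of_isRCLikeNormedField]; exact WithTop.coe_le_coe.2 le_top) (y : E4) (e l)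
    rw [h5]
    simpa [pd] using h4
  have h6 : G.form y (0 : E4) = 0 := by simp [form]
  ext k
  simp only [raise_apply, PiLp.add_apply, PiLp.sub_apply, PiLp.smul_apply, smul_eq_mul, sub_apply,
    precomp_add_apply, sum_apply, ContinuousLinearMap.comp_apply,
    ContinuousLinearMap.flip_apply, PiLp.proj_apply, id,
    bil_apply, ContinuousLinearMap.id_apply, ext_coe, h3, fderiv_ext_self hA (mem_cone y), tan, h6]
  rw [G.form_comm (e k), form_e, met]
  simp only [pd, pd2]
  linear_combination (-(G.sign * A y k)) * G.coeff_mul_self k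

/-- Here A need not be tangent, which is essential because the vector potential is formed from
ambient components. The last term cancels the one produced by `grad_divergence` and is the effect of
curvature. -/
theorem Smooth.curl_curl (y : G.points) :
    G.curl (G.curl A) y = -G.tan y (∑ i, G.coeff i • pd2 A y i i) +
      G.grad (fun x => ∑ l, pd A x l l - G.form x (A x)) y + G.sign • G.tan y (A y) := by
  rw [curl_eq hA.curl_apply (hA.hasFDerivAt_curl y), hA.grad_divergence]
  have h1 := curlSum_curlSum y.2 (pd A y) (pd2 A y) (hA.pd2_symm (mem_cone y)) (hA.sum_mul_pd y)
    (hA.sum_mul_pd2 y)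
  have h2 : ∀ l, (G.curlSumL.precompR E4 y (ContinuousLinearMap.pi fun i =>
        (fderiv ℝ (fderiv ℝ (G.ext A)) y).flip (e i)) +
        G.curlSumL.precompL E4 (ContinuousLinearMap.id ℝ E4) (pd A y)) (e l) =
      G.curlSum (e l) (pd A y) + G.curlSum y (pd2 A y l) := fun l => by
    rw [add_comm]; rfl
  simp only [h2, h1]
  module

/-- Identifies the Laplacian on the components of A, as used in `IsTest.laplacian_pot`, with the
ambient expression in `Smooth.curl_curl`. -/
theorem Smooth.sum_rotD_rotD (y : G.points) (k : Fin 4) :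
    ∑ a, ∑ j, G.sign / 2 * (G.coeff a * G.coeff j) *
      G.rotD a j (G.rotD a j fun x => A x k) y = (∑ i, G.coeff i • pd2 A y i i) k := by
  have h1 : ∀ a j (x : G.points), (fderiv ℝ (G.ext A) x (G.rot a j x)) k =
      G.rotD a j (fun x => A x k) x := by
    intro a j x
    rw [Geometry.rotD, D_eq_of_hasFDerivAt (g := fun z => G.ext A z k) (fun x => by rw [ext_coe])
      ((EuclideanSpace.proj k : E4 →L[ℝ] ℝ).hasFDerivAt.comp (x : E4) (hA.hasFDerivAt x)), tan_rot]
    rfl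
  have h2 : ∀ a j, G.rotD a j (G.rotD a j fun x => A x k) y =
      (∑ l, ∑ m, (G.rot a j y) l * (G.rot a j y) m * pd2 A y l m k) +
        ∑ l, (G.rot a j (G.rot a j y)) l * pd A y l k := by
    intro a j
    rw [Geometry.rotD, D_eq_of_hasFDerivAt (h1 a j)
      ((EuclideanSpace.proj k : E4 →L[ℝ] ℝ).hasFDerivAt.comp (y : E4)
        ((hA.hasFDerivAt_fderiv_ext (mem_cone y)).clm_apply (G.rot a j).hasFDerivAt)), tan_rot]
    simp only [ContinuousLinearMap.comp_apply, add_apply, ContinuousLinearMap.flip_apply,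
      PiLp.proj_apply, PiLp.add_apply]
    generalize G.rot a j (G.rot a j y) = r2
    generalize G.rot a j y = r
    rw [add_comm]
    congr 1
    · conv_lhs => rw [eq_sum_e r]
      simp only [map_sum, map_smul, sum_apply, smul_apply, PiLp.smul_apply,
        smul_eq_mul, pd2, Finset.sum_apply, WithLp.ofLp_sum, Finset.mul_sum, ← mul_assoc]
      rw [Finset.sum_comm]
      exact Finset.sum_congr rfl fun _ _ => Finset.sum_congr rfl fun _ _ => by ring
    · conv_lhs => rw [eq_sum_e r2]
      simp only [map_sum, map_smul, PiLp.smul_apply, smul_eq_mul, pd, Finset.sum_apply,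
        WithLp.ofLp_sum]
  simp only [h2]
  rw [sum_rot_rot y.2 (fun l => pd A y l k) (fun l m => pd2 A y l m k)
    (fun i j => by rw [hA.pd2_symm (mem_cone y)]) (hA.sum_mul_pd y k)
    (fun i => hA.sum_mul_pd2 y i k)]
  simp

end

/-! ### The vector potential and the Biot-Savart operator -/

/-- The vector potential of `U`: the integral operator with the singular kernel, applied to the
components in the ambient space. -/
def vpot (G : Geometry) (U : G.points → E4) (y : G.points) : E4 :=
  WithLp.toLp 2 fun k => G.pot (fun x => U x k) y

/-- The integrand of the parallel transport formula. -/
def bsIntegrand (G : Geometry) (V : G.points → E4) (y x : G.points) : E4 :=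
  (G.sign * G.ker1 (G.form x y)) • G.cross y (V x) x

theorem isTest_component {G : Geometry} {U : G.points → E4} (hU : U ∈ G.compactFields) (k : Fin 4) :
    G.IsTest fun x => U x k := by
  refine ⟨smooth_of_contDiffAt (g := fun z => G.ext U z k) (fun x => by rw [ext_coe])
    fun y => ?_, hU.2.comp_left (g := fun v : E4 => v k) rfl⟩
  exact contDiffAt_euclidean.1 (hU.1.2.contDiffAt (mem_cone y)) k

theorem smooth_vpot {G : Geometry} {U : G.points → E4} (hU : U ∈ G.compactFields) :
    G.Smooth (G.vpot U) := by
  refine smooth_of_contDiffAt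
    (g := fun z => WithLp.toLp 2 fun k => G.ext (G.pot fun x => U x k) z)
    (fun x => by simp only [ext_coe]; rfl) fun y => contDiffAt_euclidean.2 fun k => ?_
  exact (isTest_component hU k).smooth_pot.contDiffAt (mem_cone y)

theorem pd_eq_D {G : Geometry} {A : G.points → E4} (hA : G.Smooth A) (y : G.points) (i k : Fin 4) :
    pd A y i k = G.D (fun x => A x k) y (e i) := by
  rw [D_eq_of_hasFDerivAt (g := fun z => G.ext A z k) (fun x => by rw [ext_coe])
    ((EuclideanSpace.proj k : E4 →L[ℝ] ℝ).hasFDerivAt.comp (y : E4) (hA.hasFDerivAt y))]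
  simp only [ContinuousLinearMap.comp_apply, PiLp.proj_apply]
  rw [tan_e, map_sub, map_smul, fderiv_ext_self hA (mem_cone y), smul_zero, sub_zero]
  rfl

theorem pd_vpot {G : Geometry} {U : G.points → E4} (hU : U ∈ G.compactFields) (y : G.points)
    (i k : Fin 4) : pd (G.vpot U) y i k =
      ∫ x : G.points, G.ker1 (G.form x y) * G.form x (G.tan y (e i)) * U x k ∂G.vol := by
  rw [pd_eq_D (smooth_vpot hU), ← (isTest_component hU k).D_pot]
  rfl

theorem integrable_pd_vpot {G : Geometry} {U : G.points → E4} (hU : U ∈ G.compactFields)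
    (y : G.points) (i k : Fin 4) : Integrable (fun x : G.points =>
      G.ker1 (G.form x y) * G.form x (G.tan y (e i)) * U x k) G.vol :=
  integrable_ker1_mul (isTest_component hU k).continuous (isTest_component hU k).compact y
    (form_tan y.2 _)

theorem form_tan_right (G : Geometry) (x y v : E4) : G.form x (G.tan y v) = G.form (G.tan y x) v := by
  rw [tan, tan, form_sub_right, form_sub_left, form_smul_right, form_smul_left, G.form_comm y x,
    mul_comm]

/-- Expands the cross product so that each scalar coefficient, times `ker1`, is the integrand of a
partial derivative of the vector potential. Only the tangential part of x matters, and the minus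
sign comes from exchanging x and v. -/
theorem sign_smul_cross {G : Geometry} (y x v : E4) :
    G.sign • G.cross y v x = -∑ i, ∑ k, (G.form x (G.tan y (e i)) * v k) •
      G.coeff i • G.cross y (e i) (e k) := by
  have h1 : ∀ i, G.form x (G.tan y (e i)) * G.coeff i = G.sign * (G.tan y x) i := by
    intro i
    rw [form_tan_right, form_e, met]
    linear_combination (G.sign * G.tan y x i) * G.coeff_mul_self i
  rw [cross_anticomm, ← crossL_apply, show G.crossL y x v = G.crossL y (G.tan y x) v by
    rw [tan, map_sub, map_smul, LinearMap.sub_apply, LinearMap.smul_apply, crossL_apply _ y y,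
      cross_self_left, smul_zero, sub_zero]]
  rw [smul_neg, neg_inj]
  conv_lhs => rw [eq_sum_e (G.tan y x), eq_sum_e v]
  simp only [map_sum, map_smul, LinearMap.sum_apply, LinearMap.smul_apply, Finset.smul_sum,
    smul_smul, crossL_apply]
  refine Finset.sum_comm.trans (Finset.sum_congr rfl fun i _ => Finset.sum_congr rfl fun k _ => ?_)
  congr 1
  linear_combination (-(v k)) * h1 i

theorem bsIntegrand_neg {G : Geometry} (U : G.points → E4) (y x : G.points) :
    G.bsIntegrand (-U) y x = ∑ i, ∑ k,
      (G.ker1 (G.form x y) * G.form x (G.tan y (e i)) * U x k) •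
        G.coeff i • G.cross y (e i) (e k) := by
  rw [bsIntegrand, mul_comm, mul_smul, sign_smul_cross]
  simp only [Pi.neg_apply, PiLp.neg_apply, mul_neg, neg_smul, Finset.sum_neg_distrib, neg_neg]
  rw [Finset.smul_sum]
  refine Finset.sum_congr rfl fun i _ => ?_
  rw [Finset.smul_sum]
  refine Finset.sum_congr rfl fun k _ => ?_
  rw [smul_smul, mul_assoc]

theorem integrable_bsIntegrand_neg {G : Geometry} {U : G.points → E4} (hU : U ∈ G.compactFields)
    (y : G.points) : Integrable (G.bsIntegrand (-U) y) G.vol := by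
  have h : G.bsIntegrand (-U) y = fun x : G.points => ∑ i, ∑ k,
      (G.ker1 (G.form x y) * G.form x (G.tan y (e i)) * U x k) •
        G.coeff i • G.cross y (e i) (e k) := funext fun x => bsIntegrand_neg U y x
  rw [h]
  exact integrable_finsetSum _ fun i _ => integrable_finsetSum _ fun k _ =>
    (integrable_pd_vpot hU y i k).smul_const _

theorem integral_bsIntegrand_neg {G : Geometry} {U : G.points → E4} (hU : U ∈ G.compactFields)
    (y : G.points) : ∫ x, G.bsIntegrand (-U) y x ∂G.vol = G.curl (G.vpot U) y := by
  simp only [bsIntegrand_neg]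
  rw [integral_finsetSum _ fun i _ => integrable_finsetSum _ fun k _ =>
    (integrable_pd_vpot hU y i k).smul_const _, ← (smooth_vpot hU).curl_apply, curlSum]
  refine Finset.sum_congr rfl fun i _ => ?_
  rw [integral_finsetSum _ fun k _ => (integrable_pd_vpot hU y i k).smul_const _]
  conv_rhs => rw [eq_sum_e (pd (G.vpot U) y i), ← crossL_apply, map_sum, Finset.smul_sum]
  refine Finset.sum_congr rfl fun k _ => ?_
  rw [integral_smul_const, ← pd_vpot hU, map_smul, smul_comm, crossL_apply]

theorem laplacian_vpot {G : Geometry} {U : G.points → E4} (hU : U ∈ G.compactFields)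
    (y : G.points) :
    ∑ i, G.coeff i • pd2 (G.vpot U) y i i = U y + G.sign • G.vpot U y := by
  ext k
  rw [← (smooth_vpot hU).sum_rotD_rotD]
  have h := (isTest_component hU k).laplacian_pot y
  simp only [PiLp.add_apply, PiLp.smul_apply, smul_eq_mul]
  have h1 : (G.vpot U y) k = G.pot (fun x => U x k) y := rfl
  rw [h1, ← h]
  ring_nf
  rfl

/-- The tangential divergence of the vector potential. -/
def divPot (G : Geometry) (U : G.points → E4) (y : G.points) : ℝ :=
  ∑ l, pd (G.vpot U) y l l - G.form y (G.vpot U y)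

/-- The main cancellation. The kernel solves Δ - σ instead of Δ precisely so that the term σA in the
Laplacian of A removes the curvature term of `Smooth.curl_curl`. -/
theorem curl_curl_vpot {G : Geometry} {U : G.points → E4} (hU : U ∈ G.compactFields)
    (y : G.points) : G.curl (G.curl (G.vpot U)) y = -U y + G.grad (G.divPot U) y := by
  rw [(smooth_vpot hU).curl_curl, laplacian_vpot hU]
  have h1 : G.tan y (U y + G.sign • G.vpot U y) = U y + G.sign • G.tan y (G.vpot U y) := by
    rw [← tanL_apply, map_add, map_smul, tanL_apply, tanL_apply,
      tan_of_form_eq_zero (hU.1.1 y)]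
  rw [h1]
  change -(U y + _) + G.grad (G.divPot U) y + _ = _
  module

theorem smooth_divPot {G : Geometry} {U : G.points → E4} (hU : U ∈ G.compactFields) :
    G.Smooth (G.divPot U) := by
  have hA := smooth_vpot hU
  refine smooth_of_contDiffAt (g := fun z => ∑ l, pd (G.vpot U) z l l -
    G.form z (G.ext (G.vpot U) z)) (fun x => by rw [ext_coe]; rfl) fun y => ?_
  refine ContDiffAt.sub (ContDiffAt.sum fun l _ => ?_) ?_
  · exact contDiffAt_euclidean.1 (contDiffAt_pi.1 (hA.contDiffAt_pd (mem_cone y)) l) l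
  · exact (G.contDiff_form (n := ∞)).contDiffAt.comp (y : E4)
      (contDiffAt_id.prodMk (hA.contDiffAt (mem_cone y)))

theorem grad_comp_form {G : Geometry} {k : ℝ → ℝ} {k' : ℝ} {x : E4} {y : G.points}
    (hk : HasDerivAt k k' (G.form x y)) {f : G.points → ℝ} (hf : ∀ z : G.points, k (G.form x z) = f z) :
    G.grad f y = (G.sign * k') • G.tan y x := by
  rw [grad_eq hf (hasFDerivAt_comp_form hk)]
  simp only [smul_apply, bil_apply, smul_eq_mul]
  have h : G.raise (fun i => k' * G.form x (e i)) = k' • G.raise fun i => G.form x (e i) := by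
    ext i
    simp only [raise_apply, PiLp.smul_apply, smul_eq_mul]
    ring
  rw [h, raise_form, tan, G.form_comm y]
  module

theorem gradKernel_phiTransport {G : Geometry} {x y : G.points} (h : G.form x y ∈ G.dom) :
    G.gradKernel G.phiTransport x y = (G.sign * G.ker1 (G.form x y)) • G.tan y x :=
  grad_comp_form (hasDerivAt_ker h) fun z => (phiTransport_dist x.2 z.2).symm

/-- The transported vector differs from V(x) by a multiple of x + y, and ∇_y φ is a multiple of the
tangential part of x. The cross product at y kills both y and x × x, so V(x) may replace its
transport. -/
theorem transportIntegrand_eq {G : Geometry} (V : G.points → E4) {x y : G.points}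
    (h : G.form x y ∈ G.dom) : G.transportIntegrand V y x = G.bsIntegrand V y x := by
  rw [transportIntegrand, gradKernel_phiTransport h, bsIntegrand, transport, ← crossL_apply,
    map_smul, crossL_apply, cross_tan, ← crossL_apply, ← crossL_apply, map_sub, map_smul, map_add,
    LinearMap.sub_apply, LinearMap.smul_apply, LinearMap.add_apply, crossL_apply _ _ (x : E4),
    crossL_apply _ _ (y : E4), cross_self, cross_self_left, add_zero, smul_zero, sub_zero]

/-- With φ₀ = ck + const and U tangent at x, both sides equal -(k + ck')⟨U(x), y⟩: differentiating A
under the divergence contributes the part with ck', and the normal component of A the part with k.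
-/
theorem potentialIntegrand_eq {G : Geometry} {U : G.points → E4} (hU : U ∈ G.compactFields)
    {x y : G.points} (h : G.form x y ∈ G.dom) :
    G.potentialIntegrand (-U) y x =
      (∑ l, G.ker1 (G.form x y) * G.form x (G.tan y (e l)) * U x l) -
        ∑ k, (G.met k * (y : E4) k) * (G.ker (G.form x y) * U x k) := by
  have hd : HasDerivAt (fun c => c * G.ker c + G.phi0Const)
      (1 * G.ker (G.form x y) + G.form x y * G.ker1 (G.form x y)) (G.form y x) := by
    rw [G.form_comm y]
    exact ((hasDerivAt_id _).fun_mul (hasDerivAt_ker h)).add_const _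
  have h1 : G.form (U x) (G.tan x y) = G.form (U x) y := by
    rw [tan, form_sub_right, form_smul_right, G.form_comm (U x) x, hU.1.1 x, mul_zero, sub_zero]
  have h2 : ∑ l, G.form x (G.tan y (e l)) * U x l = -(G.form x y * G.form (U x) y) := by
    have h3 : G.form x (G.tan y (U x)) = -(G.form x y * G.form (U x) y) := by
      rw [tan, form_sub_right, form_smul_right, hU.1.1 x, G.form_comm y]; ring
    rw [← h3, form_tan_right, form_eq_sum]
    exact Finset.sum_congr rfl fun l _ => by rw [form_tan_right, form_e]
  have h4 : ∑ l, G.ker1 (G.form x y) * G.form x (G.tan y (e l)) * U x l =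
      G.ker1 (G.form x y) * ∑ l, G.form x (G.tan y (e l)) * U x l := by
    rw [Finset.mul_sum]
    exact Finset.sum_congr rfl fun l _ => mul_assoc _ _ _
  have h5 : ∑ k, (G.met k * (y : E4) k) * (G.ker (G.form x y) * U x k) =
      G.ker (G.form x y) * G.form (U x) y := by
    rw [G.form_comm (U x), form_eq_sum _ (y : E4) (U x), Finset.mul_sum]
    exact Finset.sum_congr rfl fun l _ => by ring
  rw [potentialIntegrand, grad_comp_form hd fun z => by
    rw [phi0_dist z.2 y.2, G.form_comm y], dot, form_smul_right, h4, h2, h5]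
  have h6 : G.form ((-U) x) (G.tan x y) = -G.form (U x) y := by
    rw [← h1, Pi.neg_apply, ← neg_one_smul ℝ, form_smul_left]; ring
  rw [h6]
  linear_combination (-(1 * G.ker (G.form x y) + G.form x y * G.ker1 (G.form x y)) *
    G.form (U x) y) * G.sign_mul_self

theorem potential_neg {G : Geometry} {U : G.points → E4} (hU : U ∈ G.compactFields)
    (y : G.points) : Integrable (G.potentialIntegrand (-U) y) G.vol ∧
      G.potential (-U) y = G.divPot U y := by
  have h : (fun x => (∑ l, G.ker1 (G.form x y) * G.form x (G.tan y (e l)) * U x l) -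
      ∑ k, (G.met k * (y : E4) k) * (G.ker (G.form x y) * U x k)) =ᵐ[G.vol]
      G.potentialIntegrand (-U) y := by
    filter_upwards [ae_form_mem_dom y] with x hx
    exact (potentialIntegrand_eq hU hx).symm
  have hi1 : ∀ l, Integrable (fun x : G.points =>
      G.ker1 (G.form x y) * G.form x (G.tan y (e l)) * U x l) G.vol :=
    fun l => integrable_pd_vpot hU y l l
  have hi2 : ∀ k, Integrable (fun x : G.points =>
      (G.met k * (y : E4) k) * (G.ker (G.form x y) * U x k)) G.vol := fun k =>
    (integrable_ker_mul (isTest_component hU k).continuous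
      (isTest_component hU k).compact y).const_mul _
  have hI := (integrable_finsetSum Finset.univ fun l _ => hi1 l).sub
    (integrable_finsetSum Finset.univ fun k _ => hi2 k)
  refine ⟨hI.congr (by simpa only [Pi.sub_def] using h), ?_⟩
  rw [potential, ← integral_congr_ae h, integral_sub (integrable_finsetSum Finset.univ
    fun l _ => hi1 l) (integrable_finsetSum Finset.univ fun k _ => hi2 k),
    integral_finsetSum _ fun l _ => hi1 l, integral_finsetSum _ fun k _ => hi2 k, divPot,
    form_eq_sum]
  congr 1
  · exact Finset.sum_congr rfl fun l _ => (pd_vpot hU y l l).symm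
  · refine Finset.sum_congr rfl fun k _ => ?_
    rw [integral_const_mul]
    rfl

theorem integrable_bsIntegrand {G : Geometry} (V : G.compactFields) (y : G.points) :
    Integrable (G.bsIntegrand V.1 y) G.vol := by
  simpa using integrable_bsIntegrand_neg (-V).2 y

theorem integral_bsIntegrand {G : Geometry} (V : G.compactFields) (y : G.points) :
    ∫ x, G.bsIntegrand V.1 y x ∂G.vol = G.curl (G.vpot (-V).1) y := by
  simpa using integral_bsIntegrand_neg (-V).2 y

/-- The Biot-Savart operator. -/
def biotSavart (G : Geometry) : G.compactFields →ₗ[ℝ] G.fields where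
  toFun V := ⟨fun y => ∫ x, G.bsIntegrand V.1 y x ∂G.vol, by
    have h : (fun y => ∫ x, G.bsIntegrand V.1 y x ∂G.vol) = G.curl (G.vpot (-V).1) :=
      funext fun y => integral_bsIntegrand V y
    have hA := smooth_vpot (-V).2
    rw [h]
    exact ⟨fun y => by rw [← hA.curl_apply, form_curlSum], hA.curl⟩⟩
  map_add' V W := by
    ext1; funext y
    change ∫ x, G.bsIntegrand (V.1 + W.1) y x ∂G.vol =
      (∫ x, G.bsIntegrand V.1 y x ∂G.vol) + ∫ x, G.bsIntegrand W.1 y x ∂G.vol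
    rw [← integral_add (integrable_bsIntegrand V y) (integrable_bsIntegrand W y)]
    refine integral_congr_ae (Eventually.of_forall fun x => ?_)
    simp only [bsIntegrand, ← crossL_apply, Pi.add_apply, map_add, LinearMap.add_apply, smul_add]
  map_smul' c V := by
    ext1; funext y
    change ∫ x, G.bsIntegrand (c • V.1) y x ∂G.vol = c • ∫ x, G.bsIntegrand V.1 y x ∂G.vol
    rw [← integral_smul]
    refine integral_congr_ae (Eventually.of_forall fun x => ?_)
    simp only [bsIntegrand, ← crossL_apply, Pi.smul_apply, map_smul, LinearMap.smul_apply]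
    rw [smul_comm]

theorem biotSavart_eq_curl {G : Geometry} (V : G.compactFields) :
    (G.biotSavart V).1 = G.curl (G.vpot (-V).1) :=
  funext fun y => integral_bsIntegrand V y

theorem biotSavart_apply {G : Geometry} (V : G.compactFields) (y : G.points) :
    (G.biotSavart V).1 y = ∫ x, G.bsIntegrand V.1 y x ∂G.vol := rfl

theorem biotSavart_transport {G : Geometry} (V : G.compactFields) (y : G.points) :
    Integrable (G.transportIntegrand V.1 y) G.vol ∧
      (G.biotSavart V).1 y = ∫ x, G.transportIntegrand V.1 y x ∂G.vol := by
  have h : G.bsIntegrand V.1 y =ᵐ[G.vol] G.transportIntegrand V.1 y := by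
    filter_upwards [ae_form_mem_dom y] with x hx
    exact (transportIntegrand_eq V.1 hx).symm
  exact ⟨(integrable_bsIntegrand V y).congr h, integral_congr_ae h⟩

/-- Everything except decay at infinity is uniform in the two geometries. The operator is the curl
of the vector potential of -V, so U = -V in the preceding lemmas. -/
theorem isBiotSavart_biotSavart {G : Geometry} (h : ∀ V : G.compactFields,
    Tendsto (fun y => √(G.dot ((G.biotSavart V).1 y) ((G.biotSavart V).1 y)))
      (cocompact G.points) (𝓝 0)) : G.IsBiotSavart G.biotSavart := by
  have hpot : ∀ (V : G.compactFields) (y : G.points), Integrable (G.potentialIntegrand V.1 y) G.vol ∧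
      G.potential V.1 y = G.divPot (-V).1 y := fun V y => by
    simpa using potential_neg (-V).2 y
  have hpot' : ∀ V : G.compactFields, G.potential V.1 = G.divPot (-V).1 := fun V =>
    funext fun y => (hpot V y).2
  refine ⟨fun V y => ?_, fun V y => (hpot V y).1, fun V => ?_, fun V y => ?_, h⟩
  · rw [biotSavart_eq_curl]
    exact (smooth_vpot (-V).2).div_curl y
  · rw [hpot']
    exact smooth_divPot (-V).2
  · rw [biotSavart_eq_curl, hpot', curl_curl_vpot (-V).2]
    simp

/-! ### Decay at infinity in hyperbolic space -/

/-- Lagrange's identity in T_y; since the cross product at y depends only on tangential parts, a and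
b may be arbitrary. -/
theorem dot_cross_self {G : Geometry} {y : E4} (hy : y ∈ G.points) (a b : E4) :
    G.dot (G.cross y a b) (G.cross y a b) =
      G.dot (G.tan y a) (G.tan y a) * G.dot (G.tan y b) (G.tan y b) -
        G.dot (G.tan y a) (G.tan y b) ^ 2 := by
  have h := form_self hy
  rw [dot_tan_tan hy, dot_tan_tan hy, dot_tan_tan hy]
  have main : G.dot (G.cross y a b) (G.cross y a b) =
      G.form y y * (G.form a a * G.form b b - G.form a b ^ 2) -
        G.form y a ^ 2 * G.form b b - G.form y b ^ 2 * G.form a a +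
        2 * G.form y a * G.form y b * G.form a b := by
    cases G <;> simp [dot, form, cross_eq, minor, sign] <;> ring
  rw [main, h, G.form_comm a y, G.form_comm b y]
  linear_combination (-((G.form a a * G.form b b - G.form a b ^ 2) -
        G.form y a ^ 2 * G.form b b - G.form y b ^ 2 * G.form a a +
        2 * G.form y a * G.form y b * G.form a b)) * G.sign_mul_self

/-- With s = ⟨y, v⟩, projecting v to T_y increases its squared length to |v|² + s², which may be
large. Lagrange's identity subtracts s²c² and leaves |v|²q - s². -/
theorem dot_cross_le {x y : hyperbolic.points} {v : E4} (hv : hyperbolic.form x v = 0) :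
    hyperbolic.dot (hyperbolic.cross y v x) (hyperbolic.cross y v x) ≤
      hyperbolic.dot v v * hyperbolic.q (hyperbolic.form x y) := by
  rw [dot_cross_self y.2, dot_tan_self x.2 y.2, dot_tan_tan y.2, dot_tan_tan y.2,
    hyperbolic.form_comm v x, hv, hyperbolic.form_comm v y, hyperbolic.form_comm y x, dot, q, sign]
  nlinarith [sq_nonneg (hyperbolic.form y v)]

theorem one_le_coord (x : hyperbolic.points) : 1 ≤ (x : E4) 0 := by
  obtain ⟨h1, h2⟩ := x.2
  simp only [form, sign] at h1
  nlinarith [sq_nonneg ((x : E4) 1), sq_nonneg ((x : E4) 2), sq_nonneg ((x : E4) 3)]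

theorem abs_spatial_le (x y : hyperbolic.points) :
    |(x : E4) 1 * (y : E4) 1 + (x : E4) 2 * (y : E4) 2 + (x : E4) 3 * (y : E4) 3| ≤
      √((x : E4) 0 ^ 2 - 1) * √((y : E4) 0 ^ 2 - 1) := by
  obtain ⟨h1, -⟩ := x.2
  obtain ⟨h2, -⟩ := y.2
  have h3 := one_le_coord x
  have h4 := one_le_coord y
  simp only [form, sign] at h1 h2
  rw [← Real.sqrt_mul (by nlinarith)]
  refine Real.abs_le_sqrt ?_
  have e1 : (x : E4) 0 ^ 2 - 1 = (x : E4) 1 ^ 2 + (x : E4) 2 ^ 2 + (x : E4) 3 ^ 2 := by linarith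
  have e2 : (y : E4) 0 ^ 2 - 1 = (y : E4) 1 ^ 2 + (y : E4) 2 ^ 2 + (y : E4) 3 ^ 2 := by linarith
  rw [e1, e2]
  nlinarith [sq_nonneg ((x : E4) 1 * (y : E4) 2 - (x : E4) 2 * (y : E4) 1),
    sq_nonneg ((x : E4) 1 * (y : E4) 3 - (x : E4) 3 * (y : E4) 1),
    sq_nonneg ((x : E4) 2 * (y : E4) 3 - (x : E4) 3 * (y : E4) 2)]

/-- With r = √(x₀² - 1), Cauchy–Schwarz gives y₀(x₀ - r) ≤ c, while 1 = (x₀ - r)(x₀ + r) ≤ 2x₀(x₀ -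
r). -/
theorem coord_le_form (x y : hyperbolic.points) :
    (y : E4) 0 ≤ 2 * (x : E4) 0 * hyperbolic.form x y := by
  have h := (abs_le.1 (abs_spatial_le x y)).2
  have hx := one_le_coord x
  have hy := one_le_coord y
  have hf : hyperbolic.form x y = (x : E4) 0 * (y : E4) 0 -
      ((x : E4) 1 * (y : E4) 1 + (x : E4) 2 * (y : E4) 2 + (x : E4) 3 * (y : E4) 3) := by
    rw [form, sign]; ring
  have h1 : √((y : E4) 0 ^ 2 - 1) ≤ (y : E4) 0 :=
    Real.sqrt_le_iff.2 ⟨by linarith, by linarith⟩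
  set r := √((x : E4) 0 ^ 2 - 1) with hr
  have hr0 : 0 ≤ r := Real.sqrt_nonneg _
  have hr2 : r * r = (x : E4) 0 ^ 2 - 1 := Real.mul_self_sqrt (by nlinarith)
  have h2 : (y : E4) 0 * ((x : E4) 0 - r) ≤ hyperbolic.form x y := by
    rw [hf]
    nlinarith [mul_le_mul_of_nonneg_left h1 hr0]
  have h3 : 1 ≤ 2 * (x : E4) 0 * ((x : E4) 0 - r) := by nlinarith [sq_nonneg ((x : E4) 0 - r)]
  nlinarith [mul_le_mul_of_nonneg_left h2 (by linarith : 0 ≤ 2 * (x : E4) 0),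
    mul_le_mul_of_nonneg_left h3 (by linarith : 0 ≤ (y : E4) 0)]

theorem form_le_coord (x y : hyperbolic.points) :
    hyperbolic.form x y ≤ 2 * (x : E4) 0 * (y : E4) 0 := by
  have h := (abs_le.1 (abs_spatial_le x y)).1
  have hx := one_le_coord x
  have hy := one_le_coord y
  have h1 : √((y : E4) 0 ^ 2 - 1) ≤ (y : E4) 0 := Real.sqrt_le_iff.2 ⟨by linarith, by linarith⟩
  have h2 : √((x : E4) 0 ^ 2 - 1) ≤ (x : E4) 0 := Real.sqrt_le_iff.2 ⟨by linarith, by linarith⟩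
  have h3 := mul_le_mul h2 h1 (Real.sqrt_nonneg _) (by linarith)
  have hf : hyperbolic.form x y = (x : E4) 0 * (y : E4) 0 -
      ((x : E4) 1 * (y : E4) 1 + (x : E4) 2 * (y : E4) 2 + (x : E4) 3 * (y : E4) 3) := by
    rw [form, sign]; ring
  rw [hf]
  linarith

/-- Since exp(arcosh c) = c + √(c² - 1) ≤ 2c, decay in 1/y₀ is decay in exp(-α). -/
theorem exp_dist_le (p y : hyperbolic.points) :
    Real.exp (hyperbolic.dist p y) ≤ 4 * (p : E4) 0 * (y : E4) 0 := by
  have h1 : 1 ≤ hyperbolic.form p y := form_mem_rng p.2 y.2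
  rw [dist, Real.exp_arcosh h1]
  have h2 : √(hyperbolic.form p y ^ 2 - 1) ≤ hyperbolic.form p y :=
    Real.sqrt_le_iff.2 ⟨by linarith, by linarith⟩
  have h3 := form_le_coord p y
  linarith

/-- The magnitude of a vector field. -/
def mag (G : Geometry) (V : G.points → E4) (x : G.points) : ℝ := √(G.dot (V x) (V x))

theorem continuous_mag {G : Geometry} {V : G.points → E4} (hV : Continuous V) :
    Continuous (G.mag V) :=
  (continuous_const.mul (G.continuous_form.comp (hV.prodMk hV))).sqrt

theorem hasCompactSupport_mag {G : Geometry} {V : G.points → E4} (hV : HasCompactSupport V) :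
    HasCompactSupport (G.mag V) :=
  hV.comp_left (g := fun v => √(G.dot v v)) (by simp [dot, form])

/-- On H³, |ker1| √q = c/(4πq), so the integrand is at most c|V|/(4πq). Multiplying by 1 ≤ 2Rc/y₀
from `coord_le_form` extracts the factor 1/y₀ at the price of c²/q, which is bounded apart from a
singularity of order q⁻¹ at c = 1. -/
theorem mag_bsIntegrand_le {V : hyperbolic.points → E4} {x y : hyperbolic.points} {R : ℝ}
    (hv : hyperbolic.form x (V x) = 0) (hc : hyperbolic.form x y ∈ hyperbolic.dom)
    (hR : (x : E4) 0 ≤ R) :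
    √(hyperbolic.dot (hyperbolic.bsIntegrand V y x) (hyperbolic.bsIntegrand V y x)) ≤
      R / (2 * Real.pi * (y : E4) 0) * ((4 / 3) * hyperbolic.mag V x +
        (Set.Iic 2).indicator (fun c => (hyperbolic.q c)⁻¹) (hyperbolic.form x y) *
          hyperbolic.mag V x) := by
  have hy := one_le_coord y
  have hx := one_le_coord x
  have hpi := Real.pi_pos
  have hle := coord_le_form x y
  have hdom : 1 < hyperbolic.form x y := hc
  have hcross := dot_cross_le (y := y) hv
  have hq := q_pos hc
  have hqc : hyperbolic.q (hyperbolic.form x y) = hyperbolic.form x y ^ 2 - 1 := by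
    rw [q, sign]; ring
  set c := hyperbolic.form x y with hcdef
  have hsq := Real.sqrt_pos.2 hq
  have hker1 : |hyperbolic.ker1 c| * √(hyperbolic.q c) = 1 / (4 * Real.pi) * (c / hyperbolic.q c) := by
    rw [ker1, kap, ker, sub_zero, abs_div, abs_one_sub_sq (hyperbolic.dom_subset_rng hc), abs_mul,
      abs_div, abs_neg, abs_of_pos (by linarith : 0 < c), abs_of_pos (by positivity), ← hqc,
      abs_of_pos hsq]
    field_simp
  have h1 : hyperbolic.dot (hyperbolic.bsIntegrand V y x) (hyperbolic.bsIntegrand V y x) =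
      hyperbolic.ker1 c ^ 2 * hyperbolic.dot (hyperbolic.cross y (V x) x)
        (hyperbolic.cross y (V x) x) := by
    rw [bsIntegrand, dot, form_smul_left, form_smul_right, dot, ← hcdef]
    linear_combination (hyperbolic.sign * hyperbolic.ker1 c ^ 2 * hyperbolic.form
      (hyperbolic.cross y (V x) x) (hyperbolic.cross y (V x) x)) * hyperbolic.sign_mul_self
  have h2 : √(hyperbolic.dot (hyperbolic.bsIntegrand V y x) (hyperbolic.bsIntegrand V y x)) ≤
      1 / (4 * Real.pi) * (c / hyperbolic.q c) * hyperbolic.mag V x := by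
    rw [h1, Real.sqrt_mul (sq_nonneg _), Real.sqrt_sq_eq_abs, ← hker1, mul_assoc, mag,
      mul_comm (√(hyperbolic.q c)), ← Real.sqrt_mul (dot_self_nonneg x.2 hv)]
    gcongr
  have h3 : c / hyperbolic.q c ≤ 2 * R / (y : E4) 0 *
      (4 / 3 + (Set.Iic 2).indicator (fun c => (hyperbolic.q c)⁻¹) c) := by
    -- Here c²/q = 1 + q⁻¹, and q > 3 as soon as c > 2; this explains 4/3.
    have h4 : c ^ 2 / hyperbolic.q c ≤
        4 / 3 + (Set.Iic 2).indicator (fun c => (hyperbolic.q c)⁻¹) c := by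
      have h5 : c ^ 2 / hyperbolic.q c = 1 + (hyperbolic.q c)⁻¹ := by
        rw [hqc] at hq ⊢
        field_simp
        ring
      rw [h5]
      by_cases h6 : c ≤ 2
      · rw [Set.indicator_of_mem (Set.mem_Iic.2 h6)]; linarith
      · rw [Set.indicator_of_notMem (by simpa using h6)]
        have h7 : (hyperbolic.q c)⁻¹ ≤ 3⁻¹ := inv_anti₀ (by norm_num) (by rw [hqc]; nlinarith)
        linarith
    have h8 : 1 ≤ 2 * R / (y : E4) 0 * c := by
      rw [div_mul_eq_mul_div, one_le_div (by linarith)]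
      nlinarith
    calc c / hyperbolic.q c ≤ (2 * R / (y : E4) 0 * c) * (c / hyperbolic.q c) :=
          le_mul_of_one_le_left (by positivity) h8
      _ = 2 * R / (y : E4) 0 * (c ^ 2 / hyperbolic.q c) := by ring
      _ ≤ _ := by
        have : 0 ≤ 2 * R / (y : E4) 0 := by
          have : 0 ≤ R := by linarith
          have : 0 < (y : E4) 0 := by linarith
          positivity
        gcongr
  calc _ ≤ _ := h2
    _ ≤ 1 / (4 * Real.pi) * (2 * R / (y : E4) 0 *
      (4 / 3 + (Set.Iic 2).indicator (fun c => (hyperbolic.q c)⁻¹) c)) * hyperbolic.mag V x := by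
        have : 0 ≤ hyperbolic.mag V x := Real.sqrt_nonneg _
        gcongr
    _ = _ := by
      have : (y : E4) 0 ≠ 0 := by linarith
      field_simp
      ring

/-- The value w of the field is paired with itself: |w|² is the integral of w • integrand, at most
|w| times the integral of the lengths. This stays within the metric of T_y, where a comparison with
the Euclidean norm would cost a factor depending on y. The singular part of the integral is the same
for all y because `nu` is. -/
theorem exists_mag_biotSavart_le (V : hyperbolic.compactFields) :
    ∃ C : ℝ, 0 ≤ C ∧ ∀ y : hyperbolic.points,
      √(hyperbolic.dot ((hyperbolic.biotSavart V).1 y) ((hyperbolic.biotSavart V).1 y)) ≤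
        C / (y : E4) 0 := by
  have hpi := Real.pi_pos
  have hVc := hyperbolic.continuous_mag (V := V.1) V.2.1.2.continuous
  have hVs := hasCompactSupport_mag (G := hyperbolic) V.2.2
  obtain ⟨B, hB0, hB⟩ := exists_abs_le hVc hVs
  obtain ⟨R', hR'⟩ := V.2.2.isCompact.bddAbove_image
    (f := fun x : hyperbolic.points => (x : E4) 0) (by
      exact ((PiLp.continuous_apply 2 _ 0).comp continuous_subtype_val).continuousOn)
  set R := |R'| with hRdef
  have hR : ∀ x, V.1 x ≠ 0 → (x : E4) 0 ≤ R := fun x hx =>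
    (hR' ⟨x, subset_tsupport V.1 hx, rfl⟩).trans (le_abs_self _)
  set K := (4 / 3) * (∫ x, hyperbolic.mag V.1 x ∂hyperbolic.vol) +
    B * ∫ c in Set.Iic 2, |(hyperbolic.q c)⁻¹| ∂hyperbolic.nu with hK
  have hK0 : 0 ≤ K := add_nonneg (mul_nonneg (by norm_num)
    (integral_nonneg fun x => Real.sqrt_nonneg _))
    (mul_nonneg hB0 (integral_nonneg fun c => abs_nonneg _))
  refine ⟨R / (2 * Real.pi) * K, by positivity, fun y => ?_⟩
  have hy := one_le_coord y
  set w := (hyperbolic.biotSavart V).1 y with hw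
  have hwt : hyperbolic.form y w = 0 := (hyperbolic.biotSavart V).2.1 y
  have hbound : ∀ x : hyperbolic.points,
      (Set.Iic 2).indicator (fun c => (hyperbolic.q c)⁻¹) (hyperbolic.form x y) *
        hyperbolic.mag V.1 x ≤
      B * (Set.Iic 2).indicator (fun c => |(hyperbolic.q c)⁻¹|) (hyperbolic.form x y) := by
    intro x
    have h1 := hB x
    rw [abs_of_nonneg (show 0 ≤ hyperbolic.mag V.1 x from Real.sqrt_nonneg _)] at h1
    by_cases hx : hyperbolic.form x y ≤ 2
    · rw [Set.indicator_of_mem (Set.mem_Iic.2 hx), Set.indicator_of_mem (Set.mem_Iic.2 hx), mul_comm]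
      have h2 : 0 ≤ (hyperbolic.q (hyperbolic.form x y))⁻¹ :=
        inv_nonneg.2 (q_nonneg (form_mem_rng x.2 y.2))
      rw [abs_of_nonneg h2]
      exact mul_le_mul_of_nonneg_right h1 h2
    · rw [Set.indicator_of_notMem (by simpa using hx), Set.indicator_of_notMem (by simpa using hx)]
      simp
  have hi1 : Integrable (hyperbolic.mag V.1) hyperbolic.vol :=
    hVc.integrable_of_hasCompactSupport hVs
  have hq_int := hyperbolic.integrableOn_inv_q (M := 2) (by norm_num)
  have hi2 := (integrable_indicator_comp_form hq_int.abs y).const_mul B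
  set g' : hyperbolic.points → ℝ := fun x => R / (2 * Real.pi * (y : E4) 0) *
    ((4 / 3) * hyperbolic.mag V.1 x +
      B * (Set.Iic 2).indicator (fun c => |(hyperbolic.q c)⁻¹|) (hyperbolic.form x y)) with hg'
  have hR0 : 0 ≤ R / (2 * Real.pi * (y : E4) 0) := by
    have : 0 < (y : E4) 0 := by linarith
    positivity
  have hint_g' : Integrable g' hyperbolic.vol := ((hi1.const_mul (4 / 3)).add hi2).const_mul _
  have hval : ∫ x, g' x ∂hyperbolic.vol = R / (2 * Real.pi * (y : E4) 0) * K := by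
    rw [hg', integral_const_mul, integral_add (hi1.const_mul (4 / 3)) hi2, integral_const_mul,
      integral_const_mul, integral_indicator_comp_form
        (g := fun c => |(hyperbolic.q c)⁻¹|)
        (by exact hyperbolic.measurable_q.inv.norm.aestronglyMeasurable)]
  set r := √(hyperbolic.dot w w) with hr
  have hle : ∀ᵐ x ∂hyperbolic.vol, hyperbolic.dot w (hyperbolic.bsIntegrand V.1 y x) ≤ r * g' x := by
    filter_upwards [ae_form_mem_dom y] with x hx
    have hf : hyperbolic.form y (hyperbolic.bsIntegrand V.1 y x) = 0 := by
      rw [bsIntegrand, form_smul_right, form_cross, mul_zero]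
    have h1 := Real.abs_le_sqrt (dot_sq_le y.2 hwt hf)
    rw [Real.sqrt_mul (dot_self_nonneg y.2 hwt)] at h1
    refine (le_abs_self _).trans (h1.trans (mul_le_mul_of_nonneg_left ?_ (Real.sqrt_nonneg _)))
    -- R bounds x₀ only on the support of V; off it the integrand vanishes.
    by_cases hV : V.1 x = 0
    · have h2 : hyperbolic.bsIntegrand V.1 y x = 0 := by
        rw [bsIntegrand, hV, ← crossL_apply]; simp
      rw [h2]
      have h3 : √(hyperbolic.dot (0 : E4) 0) = 0 := by simp [dot, form]
      rw [h3, hg']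
      have h4 : 0 ≤ (Set.Iic 2).indicator (fun c => |(hyperbolic.q c)⁻¹|) (hyperbolic.form x y) :=
        Set.indicator_nonneg (fun _ _ => abs_nonneg _) _
      have h5 : 0 ≤ hyperbolic.mag V.1 x := Real.sqrt_nonneg _
      positivity
    · refine (mag_bsIntegrand_le (V.2.1.1 x) hx (hR x hV)).trans ?_
      exact mul_le_mul_of_nonneg_left (add_le_add le_rfl (hbound x)) hR0
  have hdot : hyperbolic.dot w w = ∫ x, hyperbolic.dot w (hyperbolic.bsIntegrand V.1 y x)
      ∂hyperbolic.vol := by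
    have h1 := (hyperbolic.sign • hyperbolic.bil w).integral_comp_comm (integrable_bsIntegrand V y)
    simp only [smul_apply, bil_apply, smul_eq_mul] at h1
    rw [← biotSavart_apply, ← hw] at h1
    exact h1.symm
  have hrr : r * r ≤ r * (R / (2 * Real.pi * (y : E4) 0) * K) := by
    have h0 : r * r = hyperbolic.dot w w := Real.mul_self_sqrt (dot_self_nonneg y.2 hwt)
    rw [h0, hdot, ← hval, ← integral_const_mul]
    refine integral_mono_ae ?_ (hint_g'.const_mul _) hle
    have h1 := (hyperbolic.sign • hyperbolic.bil w).integrable_comp (integrable_bsIntegrand V y)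
    simp only [smul_apply, bil_apply, smul_eq_mul] at h1
    exact h1
  -- Cancel r from r² ≤ r · bound; for r = 0 the claim holds since the bound is nonnegative.
  have hfin : r ≤ R / (2 * Real.pi * (y : E4) 0) * K := by
    rcases eq_or_lt_of_le (Real.sqrt_nonneg (hyperbolic.dot w w)) with h | h
    · rw [hr, ← h]; positivity
    · exact le_of_mul_le_mul_left hrr h
  refine hfin.trans (le_of_eq ?_)
  have : (y : E4) 0 ≠ 0 := by linarith
  field_simp

theorem exists_mag_biotSavart_le_exp (V : hyperbolic.compactFields) (p : hyperbolic.points) :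
    ∃ C : ℝ, ∀ y : hyperbolic.points,
      √(hyperbolic.dot ((hyperbolic.biotSavart V).1 y) ((hyperbolic.biotSavart V).1 y)) ≤
        C * Real.exp (-hyperbolic.dist p y) := by
  obtain ⟨C, hC0, hC⟩ := exists_mag_biotSavart_le V
  refine ⟨C * (4 * (p : E4) 0), fun y => (hC y).trans ?_⟩
  have h1 := exp_dist_le p y
  have hy := one_le_coord y
  rw [Real.exp_neg, ← div_eq_mul_inv, div_le_div_iff₀ (by linarith) (Real.exp_pos _)]
  nlinarith [mul_le_mul_of_nonneg_left h1 hC0]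

theorem tendsto_coord_atTop :
    Tendsto (fun y : hyperbolic.points => (y : E4) 0) (cocompact hyperbolic.points) atTop := by
  rw [tendsto_atTop]
  intro M
  refine mem_cocompact.2 ⟨hyperboloidPoint '' Metric.closedBall 0 |M|,
    (isCompact_closedBall _ _).image continuous_hyperboloidPoint, fun y hy => ?_⟩
  by_contra h
  refine hy ⟨spatial y, ?_, hyperboloidPoint_spatial y⟩
  have h1 := hyperboloidPoint_spatial y
  have h2 : (y : E4) 0 = √(1 + ‖spatial y‖ ^ 2) := by
    conv_lhs => rw [← h1]
    rfl
  have h3 : √(1 + ‖spatial y‖ ^ 2) < |M| := by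
    rw [← h2]; exact (not_le.1 h).trans_le (le_abs_self _)
  rw [mem_closedBall_zero_iff]
  refine le_trans (Real.le_sqrt_of_sq_le ?_) h3.le
  linarith

theorem tendsto_mag_biotSavart (V : hyperbolic.compactFields) :
    Tendsto (fun y => √(hyperbolic.dot ((hyperbolic.biotSavart V).1 y)
      ((hyperbolic.biotSavart V).1 y))) (cocompact hyperbolic.points) (𝓝 0) := by
  obtain ⟨C, -, hC⟩ := exists_mag_biotSavart_le V
  exact squeeze_zero (fun _ => Real.sqrt_nonneg _) hC (tendsto_const_nhds.div_atTop tendsto_coord_atTop)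

theorem cocompact_spherical : cocompact spherical.points = ⊥ := by
  have : CompactSpace spherical.points :=
    isCompact_iff_compactSpace.1 (isCompact_sphere (0 : E4) 1)
  exact cocompact_eq_bot

/-! ### The gradient of the normal component of the vector potential -/

/-- The integrand of the gradient of `y ↦ ∫ ker ⟨x, y⟩ ⟨y, V x⟩ dx`. -/
def normalIntegrand (G : Geometry) (V : G.points → E4) (y x : G.points) : E4 :=
  G.ker (G.form x y) • G.tan y (V x) + (G.ker1 (G.form x y) * G.form y (V x)) • G.tan y x

/-- Splits the integrand into scalar integrands already known to be integrable, those of A and of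
its partial derivatives. -/
theorem normalIntegrand_eq {G : Geometry} (V : G.points → E4) (y x : G.points) :
    G.normalIntegrand V y x = (∑ k, (G.ker (G.form x y) * V x k) • G.tan y (e k)) +
      ∑ i, ∑ k, (G.ker1 (G.form x y) * G.form x (G.tan y (e i)) * V x k) •
        (G.met k * (y : E4) k * G.met i) • e i := by
  rw [normalIntegrand]
  congr 1
  · conv_lhs => rw [eq_sum_e (V x), ← tanL_apply, map_sum, Finset.smul_sum]
    simp only [map_smul, tanL_apply, smul_smul]
  · conv_lhs => rw [eq_sum_e (G.tan y x), Finset.smul_sum]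
    refine Finset.sum_congr rfl fun i _ => ?_
    simp only [smul_smul, ← Finset.sum_smul]
    congr 1
    rw [form_eq_sum _ (y : E4) (V x), Finset.mul_sum, Finset.sum_mul]
    refine Finset.sum_congr rfl fun k _ => ?_
    rw [form_tan_right, form_e]
    linear_combination (-(G.ker1 (G.form x y) * (G.met k * (y : E4) k * V x k) * (G.tan y x) i)) *
      G.met_mul_self i

theorem integrable_normalIntegrand {G : Geometry} {V : G.points → E4} (hV : V ∈ G.compactFields)
    (y : G.points) : Integrable (G.normalIntegrand V y) G.vol := by
  rw [show G.normalIntegrand V y = _ from funext fun x => normalIntegrand_eq V y x]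
  exact (integrable_finsetSum _ fun k _ => (integrable_ker_mul (isTest_component hV k).continuous
    (isTest_component hV k).compact y).smul_const _).add
    (integrable_finsetSum _ fun i _ => integrable_finsetSum _ fun k _ =>
      (integrable_pd_vpot hV y i k).smul_const _)

/-- The product rule for ⟨y, A(y)⟩: differentiating y gives the tangential part of A,
differentiating A gives the terms with `ker1`. -/
theorem grad_form_vpot {G : Geometry} {V : G.points → E4} (hV : V ∈ G.compactFields) (r : ℝ)
    (y : G.points) : G.grad (fun z => r * G.form z (G.vpot V z)) y =
      (r * G.sign) • ∫ x, G.normalIntegrand V y x ∂G.vol := by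
  have hA := smooth_vpot hV
  have hi1 : ∀ k, Integrable (fun x : G.points => (G.ker (G.form x y) * V x k) • G.tan y (e k))
      G.vol := fun k => (integrable_ker_mul (isTest_component hV k).continuous
    (isTest_component hV k).compact y).smul_const _
  have hi2 : ∀ i k, Integrable (fun x : G.points =>
      (G.ker1 (G.form x y) * G.form x (G.tan y (e i)) * V x k) •
        (G.met k * (y : E4) k * G.met i) • e i) G.vol := fun i k =>
    (integrable_pd_vpot hV y i k).smul_const _
  have h1 : ∫ x, G.normalIntegrand V y x ∂G.vol = G.tan y (G.vpot V y) +
      ∑ i, (G.met i * G.form y (pd (G.vpot V) y i)) • e i := by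
    simp only [normalIntegrand_eq]
    rw [integral_add (integrable_finsetSum _ fun k _ => hi1 k)
      (integrable_finsetSum _ fun i _ => integrable_finsetSum _ fun k _ => hi2 i k),
      integral_finsetSum _ fun k _ => hi1 k,
      integral_finsetSum _ fun i _ => integrable_finsetSum _ fun k _ => hi2 i k]
    congr 1
    · conv_rhs => rw [eq_sum_e (G.vpot V y), ← tanL_apply, map_sum]
      refine Finset.sum_congr rfl fun k _ => ?_
      rw [integral_smul_const, map_smul, tanL_apply]
      rfl
    · refine Finset.sum_congr rfl fun i _ => ?_
      rw [integral_finsetSum _ fun k _ => hi2 i k]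
      simp only [integral_smul_const, smul_smul, ← Finset.sum_smul]
      congr 1
      rw [form_eq_sum, Finset.mul_sum]
      refine Finset.sum_congr rfl fun k _ => ?_
      rw [integral_mul_const, ← pd_vpot hV]
      ring
  have h2 := (G.bil.hasFDerivAt_of_bilinear (hasFDerivAt_id (y : E4)) (hA.hasFDerivAt y)).const_mul r
  rw [grad_eq (g := fun z => r * G.bil (id z) (G.ext (G.vpot V) z))
    (fun x => by rw [ext_coe, bil_apply, id]) h2, h1]
  have h6 : G.form y (0 : E4) = 0 := by simp [form]
  ext k
  simp only [raise_apply, PiLp.add_apply, PiLp.sub_apply, PiLp.smul_apply, smul_eq_mul, smul_apply,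
    precomp_add_apply, id, bil_apply, ContinuousLinearMap.id_apply, ext_coe,
    fderiv_ext_self hA (mem_cone y), tan, h6]
  have h7 : (∑ i, (G.met i * G.form y (pd (G.vpot V) y i)) • e i : E4) k =
      G.met k * G.form y (pd (G.vpot V) y k) := by
    have h8 : ∀ w : Fin 4 → ℝ, (∑ i, w i • e i : E4) = WithLp.toLp 2 w := fun w =>
      (eq_sum_e (WithLp.toLp 2 w)).symm
    rw [h8]
  rw [h7, G.form_comm (e k), form_e, met, pd]
  have h9 := G.coeff_mul_self k
  have h10 := G.sign_mul_self
  linear_combination (r * G.sign * (G.vpot V y) k) * h9 -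
    (r * G.coeff k * G.form y (fderiv ℝ (G.ext (G.vpot V)) y (e k))) * h10

/-! ### Quaternions and the left translation format on the sphere -/

/-- Multiplication of quaternions in coordinates. -/
def qmul (a b : E4) : E4 :=
  !₂[a 0 * b 0 - a 1 * b 1 - a 2 * b 2 - a 3 * b 3, a 0 * b 1 + a 1 * b 0 + a 2 * b 3 - a 3 * b 2,
    a 0 * b 2 - a 1 * b 3 + a 2 * b 0 + a 3 * b 1, a 0 * b 3 + a 1 * b 2 - a 2 * b 1 + a 3 * b 0]

theorem quat_components (z : E4) :
    (quat z).re = z 0 ∧ (quat z).imI = z 1 ∧ (quat z).imJ = z 2 ∧ (quat z).imK = z 3 :=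
  ⟨rfl, rfl, rfl, rfl⟩

theorem quat_qmul (a b : E4) : quat (qmul a b) = quat a * quat b := by
  ext <;> simp [quat_components, qmul]

theorem quat_ne_zero (x : spherical.points) : quat x ≠ 0 := by
  intro h
  have h1 : (x : E4) = 0 := by simpa using h
  have h2 := form_self x.2
  rw [h1] at h2
  simp [form] at h2

/-- Left translation by y moves the base point to 1. There x becomes ξ, and v and its left translate
to y become ξu and u. -/
theorem exists_qmul (x y : spherical.points) (v : E4) : ∃ ξ u : E4,
    (x : E4) = qmul y ξ ∧ v = qmul x u ∧ leftTranslate y x v = qmul y u := by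
  refine ⟨quat.symm ((quat y)⁻¹ * quat x), quat.symm ((quat x)⁻¹ * quat v), ?_, ?_, ?_⟩
  · apply quat.injective
    rw [quat_qmul, LinearIsometryEquiv.apply_symm_apply, mul_inv_cancel_left₀ (quat_ne_zero y)]
  · apply quat.injective
    rw [quat_qmul, LinearIsometryEquiv.apply_symm_apply, mul_inv_cancel_left₀ (quat_ne_zero x)]
  · apply quat.injective
    rw [quat_qmul, LinearIsometryEquiv.apply_symm_apply, leftTranslate,
      LinearIsometryEquiv.apply_symm_apply, mul_assoc]

theorem form_qmul (y a b : E4) :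
    spherical.form (qmul y a) (qmul y b) = spherical.form y y * spherical.form a b := by
  simp [form, qmul, sign]
  ring

theorem form_self_qmul (y a : E4) : spherical.form y (qmul y a) = spherical.form y y * a 0 := by
  simp [form, qmul, sign]
  ring

/-- For unit y, left multiplication is an orientation-preserving isometry, so it carries the vector
product of imaginary parts at 1 to the cross product at y. -/
theorem cross_qmul (y a b : E4) : spherical.cross y (qmul y a) (qmul y b) =
    spherical.form y y • qmul y !₂[0, a 2 * b 3 - a 3 * b 2, a 3 * b 1 - a 1 * b 3,
      a 1 * b 2 - a 2 * b 1] := by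
  ext i
  fin_cases i <;> simp [cross_eq, minor, form, qmul, sign] <;> ring

theorem qmul_assoc (a b c : E4) : qmul (qmul a b) c = qmul a (qmul b c) := by
  apply quat.injective
  simp only [quat_qmul, mul_assoc]

/-- Left multiplication as a linear map. -/
def qmulL (y : E4) : E4 →ₗ[ℝ] E4 where
  toFun := qmul y
  map_add' a b := by
    ext i; fin_cases i <;> simp [qmul] <;> ring
  map_smul' c a := by
    ext i; fin_cases i <;> simp [qmul] <;> ring

theorem qmulL_apply (y a : E4) : qmulL y a = qmul y a := rfl

theorem qmul_one (y : E4) : qmul y (e 0) = y := by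
  ext i; fin_cases i <;> simp [qmul]

/-- After translation to 1 these are identities between the unit quaternion ξ and the imaginary
quaternion u. -/
theorem leftTranslate_identities (x y : spherical.points) {v : E4} (hv : spherical.form x v = 0) :
    spherical.form (leftTranslate y x v) y = 0 ∧
    spherical.form (leftTranslate y x v) x = -spherical.form y v ∧
    spherical.tan y v = spherical.form x y • leftTranslate y x v -
      spherical.cross y (leftTranslate y x v) x ∧
    spherical.cross y v x = spherical.form x y • spherical.cross y (leftTranslate y x v) x +
      (1 - spherical.form x y ^ 2) • leftTranslate y x v +
      spherical.form y v • spherical.tan y x := by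
  obtain ⟨ξ, u, hx, hvu, hw⟩ := exists_qmul x y v
  have hyy := form_self y.2
  have hxx := form_self x.2
  have hu : u 0 = 0 := by
    rw [hvu, form_self_qmul, hxx, one_mul] at hv
    exact hv
  have hξ : spherical.form ξ ξ = 1 := by
    rw [hx, form_qmul, hyy, one_mul] at hxx
    exact hxx
  have hc : spherical.form x y = ξ 0 := by
    rw [form_comm, hx, form_self_qmul, hyy, one_mul]
  have hvy : v = qmul y (qmul ξ u) := by rw [hvu, hx, qmul_assoc]
  have hyv : spherical.form y v = (qmul ξ u) 0 := by rw [hvy, form_self_qmul, hyy, one_mul]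
  have h1 : spherical.form (leftTranslate y x v) y = 0 := by
    rw [hw, form_comm, form_self_qmul, hu, mul_zero]
  refine ⟨h1, ?_, ?_, ?_⟩
  · rw [hyv, hw, hx, form_qmul, hyy]
    simp [form, qmul, sign, hu]
    ring
  · have h2 : qmul ξ u - (qmul ξ u) 0 • e 0 = ξ 0 • u -
        !₂[0, u 2 * ξ 3 - u 3 * ξ 2, u 3 * ξ 1 - u 1 * ξ 3, u 1 * ξ 2 - u 2 * ξ 1] := by
      ext i
      fin_cases i <;> simp [qmul, hu, e] <;> ring
    have h3 := congrArg (qmulL y) h2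
    simp only [map_sub, map_smul, qmulL_apply, qmul_one] at h3
    rw [tan, hyv, hc, hw, hvy, hx, cross_qmul, hyy, one_smul, h3]
  -- The expansion of the triple product (Im ξ × u) × Im ξ, with |Im ξ|² = 1 - ξ₀².
  · have h2 : (!₂[0, (qmul ξ u) 2 * ξ 3 - (qmul ξ u) 3 * ξ 2, (qmul ξ u) 3 * ξ 1 - (qmul ξ u) 1 * ξ 3,
          (qmul ξ u) 1 * ξ 2 - (qmul ξ u) 2 * ξ 1] : E4) =
        ξ 0 • !₂[0, u 2 * ξ 3 - u 3 * ξ 2, u 3 * ξ 1 - u 1 * ξ 3, u 1 * ξ 2 - u 2 * ξ 1] +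
          (1 - ξ 0 ^ 2) • u + (qmul ξ u) 0 • (ξ - ξ 0 • e 0) := by
      have h4 : ξ 0 * ξ 0 + (ξ 1 * ξ 1 + ξ 2 * ξ 2 + ξ 3 * ξ 3) = 1 := by
        simpa [form, sign] using hξ
      rw [← h4]
      ext i
      fin_cases i <;> simp [qmul, hu, e] <;> ring
    have h3 := congrArg (qmulL y) h2
    simp only [map_sub, map_add, map_smul, qmulL_apply, qmul_one] at h3
    rw [tan, form_comm _ (y : E4) (x : E4), hyv, hc, hw, hvy, hx, cross_qmul, cross_qmul, hyy,
      one_smul, one_smul, h3]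

/-- Since φ₀' = k + ck', the left side is (k + ck') LV × x. The quaternion identities express V × x
and the tangential part of V through LV and LV × x; the coefficient of LV that remains is (1 - c²)k'
- ck = -1/4π², by the first-order equation of the kernel. -/
theorem leftIntegrand₀_eq {V : spherical.points → E4} (hV : V ∈ spherical.compactFields)
    {x y : spherical.points} (h : spherical.form x y ∈ spherical.dom) :
    leftIntegrand₀ V y x = spherical.bsIntegrand V y x - spherical.normalIntegrand V y x +
      (1 / (4 * Real.pi ^ 2)) • leftTranslate y x (V x) := by
  have hd : HasDerivAt (fun c => c * spherical.ker c + spherical.phi0Const)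
      (1 * spherical.ker (spherical.form x y) + spherical.form x y *
        spherical.ker1 (spherical.form x y)) (spherical.form x y) :=
    ((hasDerivAt_id _).fun_mul (hasDerivAt_ker h)).add_const _
  obtain ⟨-, -, h3, h4⟩ := leftTranslate_identities x y (hV.1.1 x)
  have h5 : spherical.ker1 (spherical.form x y) * (1 - spherical.form x y ^ 2) =
      spherical.form x y * spherical.ker (spherical.form x y) - 1 / (4 * Real.pi ^ 2) :=
    div_mul_cancel₀ _ (one_sub_sq_ne_zero h)
  rw [leftIntegrand₀, gradKernel, grad_comp_form hd fun z => (phi0_dist x.2 z.2).symm,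
    ← crossL_apply, map_smul, crossL_apply, cross_tan, bsIntegrand, normalIntegrand, h3, h4]
  simp only [sign]
  generalize 1 / (4 * Real.pi ^ 2) = κ at *
  rw [show κ = spherical.form x y * spherical.ker (spherical.form x y) -
    spherical.ker1 (spherical.form x y) * (1 - spherical.form x y ^ 2) by rw [h5]; ring]
  module

/-- Here dφ₁/dc = -k/2 and ⟨LV, x⟩ = -⟨y, V⟩, so the integrand is (k/2)⟨y, V(x)⟩ and its integral is
half the normal component of the vector potential of V. -/
theorem leftIntegrand₁_eq {V : spherical.points → E4} (hV : V ∈ spherical.compactFields)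
    {x y : spherical.points} (h : spherical.form x y ∈ spherical.dom) :
    leftIntegrand₁ V y x = ∑ k, (1 / 2 * (spherical.met k * (y : E4) k)) *
      (spherical.ker (spherical.form x y) * V x k) := by
  obtain ⟨h1, h2, -, -⟩ := leftTranslate_identities x y (hV.1.1 x)
  have h3 : ∑ k, (1 / 2 * (spherical.met k * (y : E4) k)) *
      (spherical.ker (spherical.form x y) * V x k) =
      1 / 2 * spherical.ker (spherical.form x y) * spherical.form y (V x) := by
    rw [form_eq_sum _ (y : E4) (V x), Finset.mul_sum]
    exact Finset.sum_congr rfl fun k _ => by ring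
  have h4 : spherical.gradKernel phi1 x y = _ :=
    grad_comp_form (hasDerivAt_phi1_arccos h) fun z => rfl
  rw [h3, leftIntegrand₁, h4, dot, form_smul_right, tan, form_sub_right, form_smul_right, h1, h2]
  simp only [sign]
  ring

theorem integrable_leftIntegrand₁ {V : spherical.points → E4} (hV : V ∈ spherical.compactFields)
    (y : spherical.points) : Integrable (leftIntegrand₁ V y) spherical.vol := by
  refine (integrable_finsetSum Finset.univ fun k _ => (integrable_ker_mul
    (isTest_component hV k).continuous (isTest_component hV k).compact y).const_mul
      (1 / 2 * (spherical.met k * (y : E4) k))).congr ?_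
  filter_upwards [ae_form_mem_dom y] with x hx
  exact (leftIntegrand₁_eq hV hx).symm

theorem integral_leftIntegrand₁ {V : spherical.points → E4} (hV : V ∈ spherical.compactFields)
    (y : spherical.points) : ∫ x, leftIntegrand₁ V y x ∂spherical.vol =
      1 / 2 * spherical.form y (spherical.vpot V y) := by
  have h : ∀ᵐ x ∂spherical.vol, leftIntegrand₁ V y x =
      ∑ k, (1 / 2 * (spherical.met k * (y : E4) k)) *
        (spherical.ker (spherical.form x y) * V x k) := by
    filter_upwards [ae_form_mem_dom y] with x hx
    exact leftIntegrand₁_eq hV hx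
  rw [integral_congr_ae h, integral_finsetSum _ fun k _ => (integrable_ker_mul
    (isTest_component hV k).continuous (isTest_component hV k).compact y).const_mul _,
    form_eq_sum, Finset.mul_sum]
  refine Finset.sum_congr rfl fun k _ => ?_
  rw [integral_const_mul, mul_assoc]
  rfl

theorem smooth_form_vpot {G : Geometry} {V : G.points → E4} (hV : V ∈ G.compactFields) (r : ℝ) :
    G.Smooth fun y => r * G.form y (G.vpot V y) := by
  refine smooth_of_contDiffAt (g := fun z => r * G.form z (G.ext (G.vpot V) z))
    (fun x => by rw [ext_coe]) fun y => ?_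
  exact contDiffAt_const.mul ((G.contDiff_form (n := ∞)).contDiffAt.comp (y : E4)
      (contDiffAt_id.prodMk ((smooth_vpot hV).contDiffAt (mem_cone y))))

theorem integrable_leftTranslate {V : spherical.points → E4} (hV : V ∈ spherical.compactFields)
    (y : spherical.points) :
    Integrable (fun x : spherical.points => leftTranslate y x (V x)) spherical.vol := by
  have : CompactSpace spherical.points :=
    isCompact_iff_compactSpace.1 (isCompact_sphere (0 : E4) 1)
  have hVc : Continuous V := hV.1.2.continuous
  have hc : Continuous fun x : spherical.points => leftTranslate y x (V x) := by
    unfold leftTranslate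
    exact quat.symm.continuous.comp ((continuous_const.mul
      ((quat.continuous.comp continuous_subtype_val).inv₀ quat_ne_zero)).mul
        (quat.continuous.comp hVc))
  exact hc.integrable_of_hasCompactSupport (HasCompactSupport.of_compactSpace _)

theorem ae_leftIntegrand₀_eq {V : spherical.points → E4} (hV : V ∈ spherical.compactFields)
    (y : spherical.points) : leftIntegrand₀ V y =ᵐ[spherical.vol] fun x =>
      spherical.bsIntegrand V y x - spherical.normalIntegrand V y x +
        (1 / (4 * Real.pi ^ 2)) • leftTranslate y x (V x) := by
  filter_upwards [ae_form_mem_dom y] with x hx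
  exact leftIntegrand₀_eq hV hx

/-- The Biot-Savart formula on the sphere in left translation format. -/
theorem biotSavart_leftTranslate (V : spherical.compactFields) :
    (∀ y : spherical.points, Integrable (leftIntegrand₀ V.1 y) spherical.vol) ∧
    (∀ y : spherical.points,
      Integrable (fun x : spherical.points => leftTranslate y x (V.1 x)) spherical.vol) ∧
    (∀ y : spherical.points, Integrable (leftIntegrand₁ V.1 y) spherical.vol) ∧
    spherical.Smooth (fun y => ∫ x, leftIntegrand₁ V.1 y x ∂spherical.vol) ∧
    ∀ y : spherical.points, (spherical.biotSavart V).1 y =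
      (∫ x, leftIntegrand₀ V.1 y x ∂spherical.vol)
      - (1 / (4 * Real.pi ^ 2)) • (∫ x : spherical.points, leftTranslate y x (V.1 x) ∂spherical.vol)
      + (2 : ℝ) • spherical.grad (fun z => ∫ x, leftIntegrand₁ V.1 z x ∂spherical.vol) y := by
  have hbs := integrable_bsIntegrand V
  have hn := integrable_normalIntegrand V.2
  have hl := integrable_leftTranslate V.2
  have hlc : ∀ y : spherical.points, Integrable (fun x : spherical.points =>
      (1 / (4 * Real.pi ^ 2)) • leftTranslate y x (V.1 x)) spherical.vol :=
    fun y => (hl y).smul (1 / (4 * Real.pi ^ 2))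
  have hbn : ∀ y, Integrable (fun x => spherical.bsIntegrand V.1 y x -
      spherical.normalIntegrand V.1 y x) spherical.vol := fun y => (hbs y).sub (hn y)
  have h1 : (fun z => ∫ x, leftIntegrand₁ V.1 z x ∂spherical.vol) =
      fun z : spherical.points => 1 / 2 * spherical.form z (spherical.vpot V.1 z) :=
    funext fun z => integral_leftIntegrand₁ V.2 z
  rw [h1]
  refine ⟨fun y => ((hbn y).add (hlc y)).congr (ae_leftIntegrand₀_eq V.2 y).symm,
    hl, integrable_leftIntegrand₁ V.2, smooth_form_vpot V.2 _, fun y => ?_⟩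
  have h2 : ∫ x, leftIntegrand₀ V.1 y x ∂spherical.vol =
      (∫ x, spherical.bsIntegrand V.1 y x ∂spherical.vol) -
      (∫ x, spherical.normalIntegrand V.1 y x ∂spherical.vol) +
      (1 / (4 * Real.pi ^ 2)) •
        ∫ x : spherical.points, leftTranslate y x (V.1 x) ∂spherical.vol := by
    rw [integral_congr_ae (ae_leftIntegrand₀_eq V.2 y), integral_add (hbn y) (hlc y),
      integral_sub (hbs y) (hn y), integral_smul]
  have h3 := grad_form_vpot V.2 (1 / 2) y
  -- Twice the gradient of half the normal component restores the integral of `normalIntegrand`, and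
  -- the two multiples of the integral of LV cancel.
  rw [h2, h3, biotSavart_apply, show spherical.sign = 1 from rfl]
  module

end Geometry

end BiotSavart

end

theorem theorem2 :
    -- on `S³`: one operator, given by the left-translation and by the parallel transport formula
    (∃ BS : S3.compactFields →ₗ[ℝ] S3.fields,
      S3.IsBiotSavart BS ∧
      (∀ V : S3.compactFields,
        (∀ y : S3.points, Integrable (Geometry.leftIntegrand₀ V.1 y) S3.vol) ∧
        (∀ y : S3.points,
          Integrable (fun x : S3.points => Geometry.leftTranslate y x (V.1 x)) S3.vol) ∧
        (∀ y : S3.points, Integrable (Geometry.leftIntegrand₁ V.1 y) S3.vol) ∧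
        S3.Smooth (fun y => ∫ x, Geometry.leftIntegrand₁ V.1 y x ∂S3.vol) ∧
        ∀ y : S3.points,
          (BS V).1 y =
            (∫ x, Geometry.leftIntegrand₀ V.1 y x ∂S3.vol)
            - (1 / (4 * Real.pi ^ 2)) •
                (∫ x : S3.points, Geometry.leftTranslate y x (V.1 x) ∂S3.vol)
            + (2 : ℝ) • S3.grad (fun z => ∫ x, Geometry.leftIntegrand₁ V.1 z x ∂S3.vol) y) ∧
      (∀ (V : S3.compactFields) (y : S3.points),
        Integrable (S3.transportIntegrand V.1 y) S3.vol ∧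
        (BS V).1 y = ∫ x, S3.transportIntegrand V.1 y x ∂S3.vol)) ∧
    -- on `H³`: the parallel transport formula, and the rate of decay at infinity
    (∃ BS : H3.compactFields →ₗ[ℝ] H3.fields,
      H3.IsBiotSavart BS ∧
      (∀ (V : H3.compactFields) (y : H3.points),
        Integrable (H3.transportIntegrand V.1 y) H3.vol ∧
        (BS V).1 y = ∫ x, H3.transportIntegrand V.1 y x ∂H3.vol) ∧
      (∀ (V : H3.compactFields) (p : H3.points),
        ∃ C : ℝ, ∀ y : H3.points,
          √(H3.dot ((BS V).1 y) ((BS V).1 y)) ≤ C * Real.exp (-H3.dist p y))) := by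
  refine ⟨⟨Geometry.biotSavart S3, Geometry.isBiotSavart_biotSavart fun V => ?_,
    Geometry.biotSavart_leftTranslate, Geometry.biotSavart_transport⟩,
    ⟨Geometry.biotSavart H3, Geometry.isBiotSavart_biotSavart Geometry.tendsto_mag_biotSavart,
      Geometry.biotSavart_transport, Geometry.exists_mag_biotSavart_le_exp⟩⟩
  rw [Geometry.cocompact_spherical]
  exact tendsto_bot
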